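/- Let $D^{1,2}(\mathbb{R}^3)$ be the space of all $u\in L^6(\mathbb{R}^3)$ with weak gradient $\nabla u\in L^2(\mathbb{R}^3)$, let $$E=\Big\{u\in D^{1,2}(\mathbb{R}^3):\ \int_{\mathbb{R}^3}\int_{\mathbb{R}^3}\frac{u^2(x)u^2(y)}{|x-y|}\,dx\,dy<+\infty\Big\},$$ $$\|u\|_E=\Big(\int_{\mathbb{R}^3}|\nabla u|^2\,dx+\Big(\int_{\mathbb{R}^3}\int_{\mathbb{R}^3}\frac{u^2(x)u^2(y)}{|x-y|}\,dx\,dy\Big)^{1/2}\Big)^{1/2},$$ and let $E_r\subset E$ be the subspace of radial functions, with the same norm. Let $p\in(18/7,3)$. Then $\int_{\mathbb{R}^3}|v|^p\,dx<+\infty$ for every $v\in E_r$, and the functional $J:E_r\to\mathbb{R}$, $$J(v)=\frac12\int_{\mathbb{R}^3}|\nabla v|^2\,dx+\frac14\int_{\mathbb{R}^3}\int_{\mathbb{R}^3}\frac{v^2(x)v^2(y)}{|x-y|}\,dx\,dy-\frac1p\int_{\mathbb{R}^3}|v|^p\,dx,$$ is coercive, that is, $J(v)\to+\infty$ as $\|v\|_E\to\infty$,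 and lower semicontinuous with respect to the weak topology of $E_r$. Moreover $J$ attains its infimum on $E_r$, and this infimum is negative. Finally, the equation $$-\Delta v+\Big(v^2\star\frac1{|x|}\Big)v=|v|^{p-2}v\quad\text{in }\mathbb{R}^3$$ has a weak solution $v\in E$ (tested against all $\varphi\in C_0^\infty(\mathbb{R}^3)$, both nonlinear terms being locally integrable) with $v>0$ almost everywhere. -/

import Mathlib

open MeasureTheory Filter Topology
open scoped ENNReal ContDiff

noncomputable section

namespace CoulombSobolev

/-- Three-dimensional Euclidean space. -/
abbrev R3 : Type := EuclideanSpace ℝ (Fin 3)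

/-- The Coulomb energy `∬ u(x)² u(y)² / |x - y| dx dy`, with values in `[0, ∞]`. -/
def coulombEnergy (u : R3 → ℝ) : ℝ≥0∞ :=
  ∫⁻ x, ∫⁻ y, ENNReal.ofReal (u x ^ 2 * u y ^ 2 / ‖x - y‖)

/-! The Coulomb kernel is `1 / |x - y| = ∫ h(q, x)² h(q, y)² dq` with Gaussians `h`, so that the
fourth root of the Coulomb energy is a mixed `L⁴(L²)` norm; this yields the triangle inequality
that the vector space structure of `E` and its norm rest on. -/

def heatConst (t : ℝ) : ℝ :=
  ((2 / √Real.pi) * ((Real.pi / (4 * t ^ 2)) ^ (3 / 2 : ℝ))⁻¹) ^ (1 / 4 : ℝ)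

def heat (q : ℝ × R3) (x : R3) : ℝ≥0∞ :=
  ENNReal.ofReal (heatConst q.1 * Real.exp (-(q.1 ^ 2 * ‖x - q.2‖ ^ 2)))

lemma measurable_heat : Measurable (fun w : (ℝ × R3) × R3 => heat w.1 w.2) := by
  unfold heat heatConst
  fun_prop

def heatMeasure : Measure (ℝ × R3) := (volume.restrict (Set.Ioi 0)).prod volume

instance : SFinite heatMeasure := by unfold heatMeasure; infer_instance

lemma lintegral_heat (x y : R3) (hxy : x ≠ y) :
    ∫⁻ q, heat q x ^ 2 * heat q y ^ 2 ∂heatMeasure = ENNReal.ofReal (1 / ‖x - y‖) := by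
  have hr : 0 < ‖x - y‖ := norm_pos_iff.2 (sub_ne_zero.2 hxy)
  have hm : Measurable (fun q : ℝ × R3 => heat q x ^ 2 * heat q y ^ 2) := by
    unfold heat heatConst
    fun_prop
  unfold heatMeasure
  rw [lintegral_prod _ hm.aemeasurable]
  have key : ∀ t ∈ Set.Ioi (0 : ℝ), ∫⁻ z, heat (t, z) x ^ 2 * heat (t, z) y ^ 2 =
      ENNReal.ofReal ((2 / √Real.pi) * Real.exp (-‖x - y‖ ^ 2 * t ^ 2)) := by
    intro t ht
    have ht : 0 < t := ht
    set m : R3 := (1 / 2 : ℝ) • (x + y)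
    have hA : 0 < (2 / √Real.pi) * ((Real.pi / (4 * t ^ 2)) ^ (3 / 2 : ℝ))⁻¹ := by
      have := Real.pi_pos; positivity
    have hc : 0 ≤ heatConst t := by unfold heatConst; positivity
    have hc4 : heatConst t ^ 4 =
        (2 / √Real.pi) * ((Real.pi / (4 * t ^ 2)) ^ (3 / 2 : ℝ))⁻¹ := by
      unfold heatConst
      rw [← Real.rpow_natCast, ← Real.rpow_mul hA.le]
      norm_num
    have hg := GaussianFourier.integral_rexp_neg_mul_sq_norm (V := R3)
      (b := 4 * t ^ 2) (by positivity)
    have hfr : (Module.finrank ℝ R3 / 2 : ℝ) = 3 / 2 := by simp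
    rw [hfr] at hg
    have hpos : 0 < (Real.pi / (4 * t ^ 2)) ^ (3 / 2 : ℝ) := by
      have := Real.pi_pos; positivity
    have hint : Integrable (fun z : R3 => Real.exp (-(4 * t ^ 2) * ‖z‖ ^ 2)) := by
      by_contra h
      rw [integral_undef h] at hg
      exact hpos.ne hg
    have hpt : ∀ z : R3, heat (t, z) x ^ 2 * heat (t, z) y ^ 2 =
        ENNReal.ofReal (heatConst t ^ 4 * Real.exp (-‖x - y‖ ^ 2 * t ^ 2)) *
          ENNReal.ofReal (Real.exp (-(4 * t ^ 2) * ‖z - m‖ ^ 2)) := by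
      intro z
      have e1 : ‖x - z‖ ^ 2 + ‖y - z‖ ^ 2 = 2 * ‖z - m‖ ^ 2 + ‖x - y‖ ^ 2 / 2 := by
        simp only [EuclideanSpace.norm_sq_eq, Fin.sum_univ_three, Real.norm_eq_abs, sq_abs, m,
          PiLp.sub_apply, PiLp.smul_apply, PiLp.add_apply, smul_eq_mul]
        ring
      unfold heat
      rw [← ENNReal.ofReal_pow (by positivity), ← ENNReal.ofReal_pow (by positivity),
        ← ENNReal.ofReal_mul (by positivity), ← ENNReal.ofReal_mul (by positivity)]
      congr 1
      simp only [mul_pow, ← Real.exp_nat_mul]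
      rw [show ∀ a b c d : ℝ, a * b * (c * d) = a * c * (b * d) by intros; ring,
        ← Real.exp_add, mul_assoc (heatConst t ^ 4), ← Real.exp_add]
      congr 1
      · ring
      · congr 1
        push_cast
        linear_combination (-2 * t ^ 2) * e1
    simp only [hpt]
    rw [lintegral_const_mul _ (by fun_prop),
      lintegral_sub_right_eq_self (fun z : R3 => ENNReal.ofReal (Real.exp (-(4 * t ^ 2) * ‖z‖ ^ 2))) m,
      ← ofReal_integral_eq_lintegral_ofReal hint (ae_of_all _ fun z => (Real.exp_pos _).le), hg,
      ← ENNReal.ofReal_mul (by positivity), hc4]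
    congr 1
    field_simp
  rw [setLIntegral_congr_fun measurableSet_Ioi key]
  have hg := integral_gaussian_Ioi (‖x - y‖ ^ 2)
  have hi : IntegrableOn (fun t : ℝ => Real.exp (-‖x - y‖ ^ 2 * t ^ 2)) (Set.Ioi 0) :=
    (integrable_exp_neg_mul_sq (by positivity)).integrableOn
  rw [← ofReal_integral_eq_lintegral_ofReal (hi.const_mul _) (ae_of_all _ fun z => by positivity),
    integral_const_mul, hg, Real.sqrt_div Real.pi_pos.le, Real.sqrt_sq hr.le]
  congr 1
  have := Real.sqrt_pos.2 Real.pi_pos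
  field_simp

lemma coulombEnergy_congr {u v : R3 → ℝ} (h : u =ᵐ[volume] v) :
    coulombEnergy u = coulombEnergy v := by
  unfold coulombEnergy
  refine lintegral_congr_ae ?_
  filter_upwards [h] with x hx
  refine lintegral_congr_ae ?_
  filter_upwards [h] with y hy
  rw [hx, hy]

lemma coulombEnergy_eq_heat {u : R3 → ℝ} (hu : Measurable u) :
    coulombEnergy u =
      ∫⁻ q, ((∫⁻ x, (heat q x * ‖u x‖ₑ) ^ (2 : ℝ)) ^ (1 / 2 : ℝ)) ^ (4 : ℝ) ∂heatMeasure := by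
  have hmh : ∀ q, Measurable (heat q) := fun q => by unfold heat heatConst; fun_prop
  have hR : ∀ q, ((∫⁻ x, (heat q x * ‖u x‖ₑ) ^ (2 : ℝ)) ^ (1 / 2 : ℝ)) ^ (4 : ℝ) =
      ∫⁻ x, ∫⁻ y, (heat q x ^ 2 * heat q y ^ 2) * (‖u x‖ₑ ^ 2 * ‖u y‖ₑ ^ 2) := by
    intro q
    rw [← ENNReal.rpow_mul]
    norm_num
    rw [sq]
    have hmeas : Measurable fun y => (heat q y * ‖u y‖ₑ) ^ 2 := by
      have := hmh q; fun_prop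
    rw [← lintegral_mul_const _ hmeas]
    refine lintegral_congr fun x => ?_
    rw [← lintegral_const_mul _ hmeas]
    refine lintegral_congr fun y => ?_
    ring
  simp only [hR]
  have hM : Measurable (fun w : ((ℝ × R3) × R3) × R3 =>
      (heat w.1.1 w.1.2 ^ 2 * heat w.1.1 w.2 ^ 2) * (‖u w.1.2‖ₑ ^ 2 * ‖u w.2‖ₑ ^ 2)) := by
    have h1 : Measurable (fun w : ((ℝ × R3) × R3) × R3 => heat w.1.1 w.1.2) :=
      measurable_heat.comp measurable_fst
    have h2 : Measurable (fun w : ((ℝ × R3) × R3) × R3 => heat w.1.1 w.2) :=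
      measurable_heat.comp (by fun_prop : Measurable (fun w : ((ℝ × R3) × R3) × R3 => (w.1.1, w.2)))
    fun_prop
  rw [lintegral_lintegral_swap (Measurable.lintegral_prod_right hM).aemeasurable]
  unfold coulombEnergy
  refine lintegral_congr fun x => ?_
  rw [lintegral_lintegral_swap (by
    exact (hM.comp (by fun_prop : Measurable (fun w : (ℝ × R3) × R3 => ((w.1, x), w.2)))).aemeasurable)]
  refine lintegral_congr_ae ?_
  have hne : ∀ᵐ y : R3, y ≠ x := by simp [ae_iff]
  filter_upwards [hne] with y hy
  have hmq : ∀ x, Measurable (fun q : ℝ × R3 => heat q x) := fun x => by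
    unfold heat heatConst; fun_prop
  rw [lintegral_mul_const _ (by have := hmq x; have := hmq y; fun_prop),
    lintegral_heat x y hy.symm, Real.enorm_eq_ofReal_abs, Real.enorm_eq_ofReal_abs,
    ← ENNReal.ofReal_pow (abs_nonneg _), ← ENNReal.ofReal_pow (abs_nonneg _), sq_abs, sq_abs,
    ← ENNReal.ofReal_mul (sq_nonneg _), ← ENNReal.ofReal_mul (by positivity)]
  congr 1
  ring

lemma coulombEnergy_rpow_add_le {u v : R3 → ℝ} (hu : AEMeasurable u) (hv : AEMeasurable v) :
    coulombEnergy (u + v) ^ (1 / 4 : ℝ) ≤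
      coulombEnergy u ^ (1 / 4 : ℝ) + coulombEnergy v ^ (1 / 4 : ℝ) := by
  wlog h : Measurable u ∧ Measurable v generalizing u v
  · rw [coulombEnergy_congr (hu.ae_eq_mk.add hv.ae_eq_mk), coulombEnergy_congr hu.ae_eq_mk,
      coulombEnergy_congr hv.ae_eq_mk]
    exact this hu.measurable_mk.aemeasurable hv.measurable_mk.aemeasurable
      ⟨hu.measurable_mk, hv.measurable_mk⟩
  obtain ⟨hu, hv⟩ := h
  have hmh : ∀ q, Measurable (heat q) := fun q => by unfold heat heatConst; fun_prop
  have hG : ∀ {w : R3 → ℝ}, Measurable w → Measurable (fun q : ℝ × R3 =>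
      (∫⁻ x, (heat q x * ‖w x‖ₑ) ^ (2 : ℝ)) ^ (1 / 2 : ℝ)) := by
    intro w hw
    refine Measurable.pow_const ?_ _
    refine Measurable.lintegral_prod_right' (f := fun z : (ℝ × R3) × R3 =>
      (heat z.1 z.2 * ‖w z.2‖ₑ) ^ (2 : ℝ)) ?_
    have := measurable_heat
    fun_prop
  rw [coulombEnergy_eq_heat hu, coulombEnergy_eq_heat hv, coulombEnergy_eq_heat (hu.add hv)]
  refine le_trans ?_ (ENNReal.lintegral_Lp_add_le (hG hu).aemeasurable (hG hv).aemeasurable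
    (by norm_num : (1 : ℝ) ≤ 4))
  refine ENNReal.rpow_le_rpow (lintegral_mono fun q => ?_) (by norm_num)
  refine ENNReal.rpow_le_rpow ?_ (by norm_num)
  have h1 : AEMeasurable (fun x => heat q x * ‖u x‖ₑ) := by have := hmh q; fun_prop
  have h2 : AEMeasurable (fun x => heat q x * ‖v x‖ₑ) := by have := hmh q; fun_prop
  refine le_trans ?_ (ENNReal.lintegral_Lp_add_le h1 h2 (by norm_num : (1 : ℝ) ≤ 2))
  refine ENNReal.rpow_le_rpow (lintegral_mono fun x => ?_) (by norm_num)
  refine ENNReal.rpow_le_rpow ?_ (by norm_num)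
  simp only [Pi.add_apply, ← mul_add]
  gcongr
  exact enorm_add_le _ _

lemma coulombEnergy_smul (c : ℝ) (u : R3 → ℝ) :
    coulombEnergy (fun x => c * u x) = ENNReal.ofReal (c ^ 4) * coulombEnergy u := by
  unfold coulombEnergy
  rw [← lintegral_const_mul' _ _ ENNReal.ofReal_ne_top]
  refine lintegral_congr fun x => ?_
  rw [← lintegral_const_mul' _ _ ENNReal.ofReal_ne_top]
  refine lintegral_congr fun y => ?_
  rw [← ENNReal.ofReal_mul (by positivity)]
  congr 1
  ring

lemma ae_eq_zero_of_coulombEnergy_eq_zero {u : R3 → ℝ} (hu : AEMeasurable u)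
    (h : coulombEnergy u = 0) : u =ᵐ[volume] 0 := by
  wlog hm : Measurable u generalizing u
  · exact hu.ae_eq_mk.trans (this hu.measurable_mk.aemeasurable
      (by rw [← coulombEnergy_congr hu.ae_eq_mk, h]) hu.measurable_mk)
  unfold coulombEnergy at h
  have hM : Measurable (fun w : R3 × R3 =>
      ENNReal.ofReal (u w.1 ^ 2 * u w.2 ^ 2 / ‖w.1 - w.2‖)) := by fun_prop
  rw [lintegral_eq_zero_iff (Measurable.lintegral_prod_right hM)] at h
  by_contra hne
  have hex : ∃ᵐ x, u x ≠ 0 := fun h' => hne (by filter_upwards [h'] with x hx using not_not.1 hx)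
  obtain ⟨x, hx0, hx⟩ := (hex.and_eventually h).exists
  simp only [Pi.zero_apply] at hx
  rw [lintegral_eq_zero_iff (by fun_prop)] at hx
  apply hne
  have hnx : ∀ᵐ y : R3, y ≠ x := by simp [ae_iff]
  filter_upwards [hx, hnx] with y hy hyx
  by_contra h0
  have hp : 0 < ‖x - y‖ := norm_pos_iff.2 (sub_ne_zero.2 hyx.symm)
  have h0 : u y ≠ 0 := h0
  have : 0 < u x ^ 2 * u y ^ 2 / ‖x - y‖ := by positivity
  simp only [Pi.zero_apply, ENNReal.ofReal_eq_zero] at hy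
  linarith

/-- `G` is a weak (distributional) gradient of `u`: `∫ u ∇φ = -∫ φ G` for all test functions `φ`. -/
def IsWeakGradient (u : R3 → ℝ) (G : R3 → R3) : Prop :=
  ∀ φ : R3 → ℝ, ContDiff ℝ ∞ φ → HasCompactSupport φ →
    ∫ x, u x • gradient φ x = -∫ x, φ x • G x

/-- `u` has a weak gradient in `L²`. -/
def HasL2Gradient (u : R3 → ℝ) : Prop :=
  ∃ G : R3 → R3, MemLp G 2 volume ∧ IsWeakGradient u G

open Classical in
/-- The weak gradient `∇u` of `u`, unique up to null sets when it exists in `L²`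
(see `IsWeakGradient.ae_eq`). -/
def weakGrad (u : R3 → ℝ) : R3 → R3 :=
  if h : HasL2Gradient u then h.choose else 0

/-- `D^{1,2}(ℝ³)`: functions in `L⁶` whose weak gradient is in `L²`. -/
def MemD12 (u : R3 → ℝ) : Prop :=
  MemLp u 6 volume ∧ HasL2Gradient u

lemma memLp_weakGrad {u : R3 → ℝ} (h : HasL2Gradient u) : MemLp (weakGrad u) 2 volume := by
  rw [weakGrad, dif_pos h]; exact h.choose_spec.1

lemma isWeakGradient_weakGrad {u : R3 → ℝ} (h : HasL2Gradient u) :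
    IsWeakGradient u (weakGrad u) := by
  rw [weakGrad, dif_pos h]; exact h.choose_spec.2

lemma IsWeakGradient.ae_eq {u : R3 → ℝ} {G H : R3 → R3} (hG : MemLp G 2 volume)
    (hH : MemLp H 2 volume) (h1 : IsWeakGradient u G) (h2 : IsWeakGradient u H) :
    G =ᵐ[volume] H :=
  ae_eq_of_integral_contDiff_smul_eq (hG.locallyIntegrable (by norm_num))
    (hH.locallyIntegrable (by norm_num)) fun φ hφ hc =>
      neg_injective ((h1 φ hφ hc).symm.trans (h2 φ hφ hc))

lemma IsWeakGradient.congr {u v : R3 → ℝ} {G : R3 → R3} (h : IsWeakGradient u G)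
    (huv : u =ᵐ[volume] v) : IsWeakGradient v G := by
  intro φ hφ hc
  rw [← h φ hφ hc]
  refine integral_congr_ae ?_
  filter_upwards [huv] with x hx
  rw [hx]

lemma continuous_gradient {φ : R3 → ℝ} (hφ : ContDiff ℝ ∞ φ) : Continuous (gradient φ) :=
  (InnerProductSpace.toDual ℝ R3).symm.continuous.comp (hφ.continuous_fderiv (by simp))

lemma hasCompactSupport_gradient {φ : R3 → ℝ} (hc : HasCompactSupport φ) :
    HasCompactSupport (gradient φ) :=
  (hc.fderiv ℝ).comp_left (g := (InnerProductSpace.toDual ℝ R3).symm) (map_zero _)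

lemma IsWeakGradient.add {u v : R3 → ℝ} {G H : R3 → R3} (hu : MemLp u 6 volume)
    (hv : MemLp v 6 volume) (hG : MemLp G 2 volume) (hH : MemLp H 2 volume)
    (h1 : IsWeakGradient u G) (h2 : IsWeakGradient v H) : IsWeakGradient (u + v) (G + H) := by
  intro φ hφ hc
  have iu := (hu.locallyIntegrable (by norm_num)).integrable_smul_right_of_hasCompactSupport
    (continuous_gradient hφ) (hasCompactSupport_gradient hc)
  have iv := (hv.locallyIntegrable (by norm_num)).integrable_smul_right_of_hasCompactSupport
    (continuous_gradient hφ) (hasCompactSupport_gradient hc)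
  have iG := (hG.locallyIntegrable (by norm_num)).integrable_smul_left_of_hasCompactSupport
    hφ.continuous hc
  have iH := (hH.locallyIntegrable (by norm_num)).integrable_smul_left_of_hasCompactSupport
    hφ.continuous hc
  simp only [Pi.add_apply, add_smul, smul_add]
  rw [integral_add iu iv, integral_add iG iH, h1 φ hφ hc, h2 φ hφ hc, neg_add]

lemma IsWeakGradient.const_smul {u : R3 → ℝ} {G : R3 → R3} (c : ℝ) (h : IsWeakGradient u G) :
    IsWeakGradient (c • u) (c • G) := by
  intro φ hφ hc
  have := h φ hφ hc
  simp only [Pi.smul_apply, smul_assoc, smul_comm _ c]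
  rw [integral_smul, integral_smul, this, smul_neg]

/-- The space `E` of (classes of) functions in `D^{1,2}(ℝ³)` with finite Coulomb energy. -/
def E : Submodule ℝ (R3 →ₘ[volume] ℝ) where
  carrier := {u | MemD12 u ∧ coulombEnergy u < ⊤}
  zero_mem' := by
    have h0 : ((0 : R3 →ₘ[volume] ℝ) : R3 → ℝ) =ᵐ[volume] 0 := AEEqFun.coeFn_zero
    refine ⟨⟨(memLp_congr_ae h0).2 MemLp.zero, 0, MemLp.zero, ?_⟩, ?_⟩
    · exact IsWeakGradient.congr (u := 0) (fun φ _ _ => by simp) h0.symm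
    · rw [coulombEnergy_congr h0]; simp [coulombEnergy]
  add_mem' := by
    rintro u v ⟨⟨hu, G, hG, huG⟩, cu⟩ ⟨⟨hv, H, hH, hvH⟩, cv⟩
    have h0 := AEEqFun.coeFn_add u v
    refine ⟨⟨(memLp_congr_ae h0).2 (hu.add hv), G + H, hG.add hH,
      (huG.add hu hv hG hH hvH).congr h0.symm⟩, ?_⟩
    rw [coulombEnergy_congr h0]
    have := (coulombEnergy_rpow_add_le u.aemeasurable v.aemeasurable).trans_lt
      (ENNReal.add_lt_top.2 ⟨ENNReal.rpow_lt_top_of_nonneg (by norm_num) cu.ne,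
        ENNReal.rpow_lt_top_of_nonneg (by norm_num) cv.ne⟩)
    exact (ENNReal.rpow_lt_top_iff_of_pos (by norm_num)).1 this
  smul_mem' := by
    rintro c u ⟨⟨hu, G, hG, huG⟩, cu⟩
    have h0 := AEEqFun.coeFn_smul c u
    refine ⟨⟨(memLp_congr_ae h0).2 (hu.const_smul c), c • G, hG.const_smul c,
      (huG.const_smul c).congr h0.symm⟩, ?_⟩
    rw [coulombEnergy_congr h0]
    change coulombEnergy (fun x => c * u x) < ⊤
    rw [coulombEnergy_smul]
    exact ENNReal.mul_lt_top ENNReal.ofReal_lt_top cu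

/-- The Dirichlet energy `∫ |∇u|²`. -/
def gradEnergy (u : R3 → ℝ) : ℝ := ∫ x, ‖weakGrad u x‖ ^ 2

/-- The norm `‖u‖_E = (∫ |∇u|² + (∬ u(x)² u(y)² / |x - y| dx dy)^{1/2})^{1/2}`. -/
instance : Norm E where
  norm u := √(gradEnergy u.1 + √(coulombEnergy u.1).toReal)

lemma norm_def (u : E) : ‖u‖ = √(gradEnergy u.1 + √(coulombEnergy u.1).toReal) := rfl

lemma norm_eq (u : E) : ‖u‖ = √((eLpNorm (weakGrad u.1) 2 volume).toReal ^ 2 +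
    (coulombEnergy u.1 ^ (1 / 4 : ℝ)).toReal ^ 2) := by
  rw [norm_def]
  congr 2
  · have h := memLp_weakGrad u.2.1.2
    rw [h.eLpNorm_eq_integral_rpow_norm (by norm_num) (by norm_num)]
    have hn : 0 ≤ ∫ x, ‖weakGrad u.1 x‖ ^ 2 := integral_nonneg fun x => by positivity
    rw [ENNReal.toReal_ofReal (by simp; positivity)]
    simp only [ENNReal.toReal_ofNat, Real.rpow_ofNat]
    rw [← Real.rpow_natCast, ← Real.rpow_mul hn]
    norm_num [gradEnergy]
  · rw [← ENNReal.toReal_rpow, ← Real.rpow_natCast, ← Real.rpow_mul ENNReal.toReal_nonneg,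
      Real.sqrt_eq_rpow]
    norm_num

lemma weakGrad_add (u v : E) : weakGrad ((u + v : E) : R3 →ₘ[volume] ℝ) =ᵐ[volume]
    weakGrad u.1 + weakGrad v.1 :=
  IsWeakGradient.ae_eq (memLp_weakGrad (u + v).2.1.2)
    ((memLp_weakGrad u.2.1.2).add (memLp_weakGrad v.2.1.2))
    (isWeakGradient_weakGrad (u + v).2.1.2)
    (((isWeakGradient_weakGrad u.2.1.2).add u.2.1.1 v.2.1.1 (memLp_weakGrad u.2.1.2)
      (memLp_weakGrad v.2.1.2) (isWeakGradient_weakGrad v.2.1.2)).congr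
        (AEEqFun.coeFn_add u.1 v.1).symm)

lemma weakGrad_smul (c : ℝ) (u : E) : weakGrad ((c • u : E) : R3 →ₘ[volume] ℝ) =ᵐ[volume]
    c • weakGrad u.1 :=
  IsWeakGradient.ae_eq (memLp_weakGrad (c • u).2.1.2) ((memLp_weakGrad u.2.1.2).const_smul c)
    (isWeakGradient_weakGrad (c • u).2.1.2)
    (((isWeakGradient_weakGrad u.2.1.2).const_smul c).congr (AEEqFun.coeFn_smul c u.1).symm)

lemma sqrt_add_sq_le (a b c d : ℝ) :
    √((a + b) ^ 2 + (c + d) ^ 2) ≤ √(a ^ 2 + c ^ 2) + √(b ^ 2 + d ^ 2) := by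
  have := norm_add_le (a + c * Complex.I) (b + d * Complex.I)
  have e : (a + c * Complex.I) + (b + d * Complex.I) =
      ((a + b : ℝ) : ℂ) + ((c + d : ℝ) : ℂ) * Complex.I := by push_cast; ring
  rwa [e, Complex.norm_add_mul_I, Complex.norm_add_mul_I, Complex.norm_add_mul_I] at this

lemma normCore : NormedSpace.Core ℝ E where
  norm_nonneg u := Real.sqrt_nonneg _
  norm_smul c u := by
    have h0 : coulombEnergy ((c • u : E) : R3 →ₘ[volume] ℝ) =
        ENNReal.ofReal (c ^ 4) * coulombEnergy u.1 :=
      (coulombEnergy_congr (AEEqFun.coeFn_smul c u.1)).trans (coulombEnergy_smul c u.1)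
    rw [norm_eq, norm_eq, eLpNorm_congr_ae (weakGrad_smul c u), eLpNorm_const_smul, h0,
      ENNReal.toReal_mul, ← ENNReal.toReal_rpow, ENNReal.toReal_mul,
      ENNReal.toReal_ofReal (by positivity), Real.mul_rpow (by positivity) ENNReal.toReal_nonneg,
      ← ENNReal.toReal_rpow, toReal_enorm]
    have e : (c ^ 4 : ℝ) ^ (1 / 4 : ℝ) = ‖c‖ := by
      rw [Real.norm_eq_abs, ← Even.pow_abs (by decide : Even 4), ← Real.rpow_natCast,
        ← Real.rpow_mul (abs_nonneg _)]
      norm_num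
    rw [e, mul_pow, mul_pow, ← mul_add, Real.sqrt_mul (by positivity),
      Real.sqrt_sq (norm_nonneg _)]
  norm_triangle u v := by
    rw [norm_eq, norm_eq, norm_eq]
    have hu := memLp_weakGrad u.2.1.2
    have hv := memLp_weakGrad v.2.1.2
    refine le_trans (Real.sqrt_le_sqrt ?_) (sqrt_add_sq_le _ _ _ _)
    gcongr
    · rw [eLpNorm_congr_ae (weakGrad_add u v), ← ENNReal.toReal_add hu.2.ne hv.2.ne]
      exact ENNReal.toReal_mono (ENNReal.add_ne_top.2 ⟨hu.2.ne, hv.2.ne⟩)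
        (eLpNorm_add_le hu.1 hv.1 (by norm_num))
    · have cu : coulombEnergy u.1 ^ (1 / 4 : ℝ) ≠ ⊤ :=
        ENNReal.rpow_ne_top_of_nonneg (by norm_num) u.2.2.ne
      have cv : coulombEnergy v.1 ^ (1 / 4 : ℝ) ≠ ⊤ :=
        ENNReal.rpow_ne_top_of_nonneg (by norm_num) v.2.2.ne
      rw [← ENNReal.toReal_add cu cv]
      refine ENNReal.toReal_mono (ENNReal.add_ne_top.2 ⟨cu, cv⟩) ?_
      have h0 : coulombEnergy ((u + v : E) : R3 →ₘ[volume] ℝ) = coulombEnergy (u.1 + v.1) :=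
        coulombEnergy_congr (AEEqFun.coeFn_add u.1 v.1)
      rw [h0]
      exact coulombEnergy_rpow_add_le u.1.aemeasurable v.1.aemeasurable
  norm_eq_zero_iff u := by
    constructor
    · intro h
      rw [norm_eq, Real.sqrt_eq_zero (by positivity)] at h
      have h2 : (coulombEnergy u.1 ^ (1 / 4 : ℝ)).toReal = 0 := by
        have h3 := sq_nonneg (eLpNorm (weakGrad u.1) 2 volume).toReal
        have h4 := sq_nonneg (coulombEnergy u.1 ^ (1 / 4 : ℝ)).toReal
        exact pow_eq_zero_iff (two_ne_zero) |>.1 (by linarith)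
      rw [← ENNReal.toReal_rpow, Real.rpow_eq_zero ENNReal.toReal_nonneg (by norm_num),
        ENNReal.toReal_eq_zero_iff, or_iff_left u.2.2.ne] at h2
      have := ae_eq_zero_of_coulombEnergy_eq_zero u.1.aemeasurable h2
      exact Subtype.ext (AEEqFun.ext (this.trans AEEqFun.coeFn_zero.symm))
    · rintro rfl
      have hg : weakGrad ((0 : E) : R3 →ₘ[volume] ℝ) =ᵐ[volume] 0 := by
        simpa using weakGrad_smul 0 0
      have hc : coulombEnergy ((0 : E) : R3 →ₘ[volume] ℝ) = 0 :=
        (coulombEnergy_congr AEEqFun.coeFn_zero).trans (by simp [coulombEnergy])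
      rw [norm_eq, eLpNorm_congr_ae hg, hc]
      simp

instance : NormedAddCommGroup E := NormedAddCommGroup.ofCore normCore

instance : NormedSpace ℝ E := NormedSpace.ofCore normCore

/-- The subspace `E_r` of radial functions in `E`, with the norm of `E`. -/
def Er : Submodule ℝ E where
  carrier := {u | ∃ g : ℝ → ℝ, Measurable g ∧ u.1 =ᵐ[volume] fun x : R3 => g ‖x‖}
  zero_mem' := ⟨0, measurable_zero, AEEqFun.coeFn_zero⟩
  add_mem' := by
    rintro u v ⟨g, hg, hu⟩ ⟨h, hh, hv⟩
    exact ⟨g + h, hg.add hh, (AEEqFun.coeFn_add u.1 v.1).trans (hu.add hv)⟩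
  smul_mem' := by
    rintro c u ⟨g, hg, hu⟩
    exact ⟨c • g, hg.const_smul c, (AEEqFun.coeFn_smul c u.1).trans (hu.const_smul c)⟩

/-- The functional `J(v) = ½ ∫ |∇v|² + ¼ ∬ v(x)² v(y)² / |x - y| dx dy - (1/p) ∫ |v|^p` on `E_r`. -/
def J (p : ℝ) (v : Er) : ℝ :=
  1 / 2 * gradEnergy v.1.1 + 1 / 4 * (coulombEnergy v.1.1).toReal
    - 1 / p * ∫ x, |v.1.1 x| ^ p

/-- The convolution `(v² ⋆ 1/|·|)(x) = ∫ v(y)² / |x - y| dy`. -/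
def coulombPotential (v : R3 → ℝ) (x : R3) : ℝ :=
  ∫ y, v y ^ 2 / ‖x - y‖

/-- `v ∈ E` is a weak solution of `-Δv + (v² ⋆ 1/|x|) v = |v|^{p-2} v` in `ℝ³`: every term makes sense
as a distribution and the equation holds against all test functions. -/
structure IsWeakSolution (p : ℝ) (v : E) : Prop where
  integrable_potential : ∀ᵐ x : R3, Integrable (fun y : R3 => v.1 y ^ 2 / ‖x - y‖)
  locallyIntegrable_hartree :
    LocallyIntegrable (fun x : R3 => coulombPotential v.1 x * v.1 x)
  locallyIntegrable_power :
    LocallyIntegrable (fun x : R3 => |v.1 x| ^ (p - 2) * v.1 x)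
  weak_eq : ∀ φ : R3 → ℝ, ContDiff ℝ ∞ φ → HasCompactSupport φ →
    (∫ x, inner ℝ (weakGrad v.1 x) (gradient φ x)) +
        (∫ x, coulombPotential v.1 x * v.1 x * φ x) =
      ∫ x, |v.1 x| ^ (p - 2) * v.1 x * φ x

end CoulombSobolev

end

open MeasureTheory Filter Topology
open scoped ENNReal ContDiff

noncomputable section

namespace CoulombSobolev

open Set Metric

/-! Write `ω` for the area of the unit sphere, `D(u)` for the Coulomb energy, and let `M` bound both
`∫ |∇u|²` and `D(u)`. A radial `u` in `D^{1,2}` agrees almost everywhere with `g(|x|)`, where `(g(r)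
- g(s))² ≤ (M/ω)(1/s - 1/r)` for `s ≤ r`, by Cauchy–Schwarz in the radial variable; since `u ∈ L⁶`,
`g` vanishes at infinity and `g(r)² ≤ M/(ωr)`. Finite Coulomb energy adds `(∫_{r<|x|≤2r} u²)² ≤
4rM`, because `|x - y| ≤ 4r` on that annulus. Averaging `g` over a thin shell combines the two
bounds into `g(r)² ≲ r^(-7/4) M^(3/4)` (`RadialBound.sq_le`). Hence `∫ |u|^p` over the dyadic
annulus at radius `r` is `≲ r^(-(7(p-2)/8 - 1/2))`, which is summable exactly when `p > 18/7`
(`lintegral_tail_le`).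

Cutting at `R = M^(-1/3)` gives `∫ |u|^p ≤ C M^((2p-3)/3)` (`lintegral_rpow_le`). The exponent is
below one exactly when `p < 3`, and coercivity follows. On a sublevel set of `J` the profiles are
equi-Hölder away from the origin, so a subsequence converges pointwise. The Coulomb energy passes to
the limit by Fatou, the gradient by weak compactness in `L²`, and the `Lᵖ` term by dominated
convergence on balls together with the uniform tail (`exists_limit`). This gives a minimizer; it
also gives weak lower semicontinuity, since the integrals over rational balls are countably many
continuous functionals that separate the points of `E_r`. Under `u ↦ t² u(t·)` the two energies
scale by `t³` and the `Lᵖ` term by `t^(2p-3)`, so `J` is negative for small `t`.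

The absolute value of a minimizer is again a minimizer and satisfies the Euler–Lagrange equation
against radial test functions. To reach all test functions, mollify: the residual of the mollified
equation is smooth and radial, and testing it against a cut-off of itself shows that it vanishes off
the origin (`laplacian_mollify`). Finally `w(r) = r g(r)` is, up to mollification, a supersolution
of `w'' = k² w`, so a zero of `g` would spread to every radius (`pos_or_eq_zero`), contradicting
`J(v) < 0`. -/

/-- The area of the unit sphere of `ℝ³`. -/
def sphereArea : ℝ := 3 * volume.real (ball (0 : R3) 1)

lemma sphereArea_pos : 0 < sphereArea := by
  unfold sphereArea
  have : 0 < volume.real (ball (0 : R3) 1) :=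
    ENNReal.toReal_pos (measure_ball_pos _ _ one_pos).ne' measure_ball_lt_top.ne
  positivity

/-! ### Integration in polar coordinates. -/

lemma integral_radial (f : ℝ → ℝ) :
    ∫ x : R3, f ‖x‖ = sphereArea * ∫ r in Ioi (0 : ℝ), r ^ 2 * f r := by
  have := integral_fun_norm_addHaar (volume : Measure R3) f
  simp only [finrank_euclideanSpace, Fintype.card_fin, smul_eq_mul, nsmul_eq_mul] at this
  rw [this, sphereArea, mul_assoc]; norm_num

lemma integrable_radial {f : ℝ → ℝ} :
    Integrable (fun x : R3 => f ‖x‖) ↔ IntegrableOn (fun r => r ^ 2 * f r) (Ioi 0) := by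
  have := integrable_fun_norm_addHaar (volume : Measure R3) (f := f)
  simpa only [finrank_euclideanSpace, Fintype.card_fin, smul_eq_mul] using this

/-- Integrability is not assumed, so that the `L⁶` bound can be proved before membership in `L⁶` is
known for limits. -/
lemma lintegral_radial {f : ℝ → ℝ≥0∞} (hf : Measurable f) :
    ∫⁻ x : R3, f ‖x‖ =
      ENNReal.ofReal sphereArea * ∫⁻ r in Ioi (0 : ℝ), ENNReal.ofReal (r ^ 2) * f r := by
  have h1 : ∫⁻ x : R3, f ‖x‖ = ∫⁻ x : ({(0)}ᶜ : Set R3), f ‖x.1‖ ∂(Measure.comap Subtype.val volume) := by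
    rw [lintegral_subtype_comap (measurableSet_singleton _).compl fun x : R3 ↦ f (‖x‖),
      restrict_compl_singleton]
  have h2 := (volume : Measure R3).measurePreserving_homeomorphUnitSphereProd.lintegral_comp
    (f := fun q => f q.2.1) (by fun_prop)
  simp only [homeomorphUnitSphereProd_apply_snd_coe] at h2
  rw [h1, h2, lintegral_prod _ (by fun_prop)]
  dsimp only
  rw [lintegral_const, mul_comm, Measure.toSphere_apply_univ]
  congr 1
  · rw [sphereArea, ENNReal.ofReal_mul (by norm_num), ofReal_measureReal]
    simp
  · rw [Measure.volumeIoiPow, lintegral_withDensity_eq_lintegral_mul _ (by fun_prop) (by fun_prop)]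
    simp only [Pi.mul_apply, finrank_euclideanSpace, Fintype.card_fin]
    exact lintegral_subtype_comap measurableSet_Ioi (fun r : ℝ => ENNReal.ofReal (r ^ 2) * f r)

/-! ### A radial mollifier -/

/-- It depends on `‖x‖` only, which makes mollification preserve radial symmetry; through `‖x‖ ^ 2`
it is smooth at the origin too. -/
def bump (x : R3) : ℝ := Real.smoothTransition (1 - ‖x‖ ^ 2)

lemma contDiff_bump : ContDiff ℝ ∞ bump :=
  Real.smoothTransition.contDiff.comp (contDiff_const.sub (contDiff_norm_sq ℝ))

lemma bump_nonneg (x : R3) : 0 ≤ bump x := Real.smoothTransition.nonneg _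

lemma bump_le_one (x : R3) : bump x ≤ 1 := Real.smoothTransition.le_one _

lemma bump_eq_zero {x : R3} (hx : 1 ≤ ‖x‖) : bump x = 0 :=
  Real.smoothTransition.zero_of_nonpos (by nlinarith)

lemma hasCompactSupport_bump : HasCompactSupport bump :=
  HasCompactSupport.intro (isCompact_closedBall (0 : R3) 1) fun x hx =>
    bump_eq_zero (by simpa using (not_le.1 (by simpa using hx)).le)

lemma integral_bump_pos : 0 < ∫ x, bump x := by
  refine Continuous.integral_pos_of_hasCompactSupport_nonneg_nonzero (x := 0)
    contDiff_bump.continuous hasCompactSupport_bump bump_nonneg ?_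
  simp [bump]

/-- It has mass one and vanishes for `‖x‖ ≥ 1/(n+1)`; the shift `n + 1` makes `n = 0` admissible and
keeps the support in the unit ball. -/
def mollifier (n : ℕ) (x : R3) : ℝ :=
  ((n + 1 : ℝ) ^ 3 / ∫ y, bump y) * bump ((n + 1 : ℝ) • x)

lemma contDiff_mollifier (n : ℕ) : ContDiff ℝ ∞ (mollifier n) :=
  contDiff_const.mul (contDiff_bump.comp (contDiff_const_smul (n + 1 : ℝ)))

lemma mollifier_nonneg (n : ℕ) (x : R3) : 0 ≤ mollifier n x :=
  mul_nonneg (div_nonneg (by positivity) integral_bump_pos.le) (bump_nonneg _)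

lemma mollifier_eq_zero (n : ℕ) {x : R3} (hx : 1 / (n + 1 : ℝ) ≤ ‖x‖) : mollifier n x = 0 := by
  rw [mollifier, bump_eq_zero, mul_zero]
  rw [norm_smul, Real.norm_of_nonneg (by positivity)]
  rw [div_le_iff₀ (by positivity)] at hx
  linarith

lemma hasCompactSupport_mollifier (n : ℕ) : HasCompactSupport (mollifier n) :=
  HasCompactSupport.intro (isCompact_closedBall (0 : R3) (1 / (n + 1 : ℝ))) fun x hx =>
    mollifier_eq_zero n (by simpa using (not_le.1 (by simpa using hx)).le)

lemma mollifier_congr (n : ℕ) {x y : R3} (h : ‖x‖ = ‖y‖) : mollifier n x = mollifier n y := by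
  simp only [mollifier, bump, norm_smul, h]

lemma integral_mollifier (n : ℕ) : ∫ x, mollifier n x = 1 := by
  unfold mollifier
  rw [integral_const_mul, Measure.integral_comp_smul volume bump]
  have := integral_bump_pos.ne'
  simp only [finrank_euclideanSpace, Fintype.card_fin, smul_eq_mul]
  rw [abs_of_pos (by positivity)]
  field_simp

lemma integrable_mollifier (n : ℕ) : Integrable (mollifier n) :=
  (contDiff_mollifier n).continuous.integrable_of_hasCompactSupport (hasCompactSupport_mollifier n)

lemma integral_mollifier_sub (n : ℕ) (x : R3) : ∫ y, mollifier n (x - y) = 1 := by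
  rw [integral_sub_left_eq_self (mollifier n) volume x, integral_mollifier]

lemma lintegral_mollifier_sub_left (n : ℕ) (x : R3) :
    ∫⁻ y, ENNReal.ofReal (mollifier n (x - y)) = 1 := by
  rw [← ofReal_integral_eq_lintegral_ofReal ((integrable_mollifier n).comp_sub_left x)
    (ae_of_all _ fun y => mollifier_nonneg n _), integral_mollifier_sub, ENNReal.ofReal_one]

lemma lintegral_mollifier_sub_right (n : ℕ) (y : R3) :
    ∫⁻ x, ENNReal.ofReal (mollifier n (x - y)) = 1 := by
  rw [← lintegral_mollifier_sub_left n y]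
  exact lintegral_congr fun x => by rw [mollifier_congr n (norm_sub_rev x y)]

/-- The mollification `ρₙ ⋆ u`. -/
def mollify {F : Type*} [NormedAddCommGroup F] [NormedSpace ℝ F] (n : ℕ) (u : R3 → F) (x : R3) : F :=
  ∫ y, mollifier n (x - y) • u y

/-- Lebesgue differentiation on balls of radius `1/(n+1)`: the kernels have mass one and are bounded
by a constant over the volume of the ball. -/
lemma ae_tendsto_mollify {F : Type*} [NormedAddCommGroup F] [NormedSpace ℝ F] [CompleteSpace F]
    {u : R3 → F} (hu : LocallyIntegrable u) :
    ∀ᵐ x, Tendsto (fun n => mollify n u x) atTop (𝓝 (u x)) := by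
  filter_upwards [(Besicovitch.vitaliFamily (volume : Measure R3)).ae_tendsto_average_norm_sub hu]
    with x₀ h₀
  have hφ' : Tendsto (fun n : ℕ => 1 / (n + 1 : ℝ)) atTop (𝓝[>] 0) :=
    tendsto_nhdsWithin_iff.2 ⟨tendsto_one_div_add_atTop_nhds_zero_nat,
      Eventually.of_forall fun n => by simp only [mem_Ioi]; positivity⟩
  have := (h₀.comp (Besicovitch.tendsto_filterAt volume x₀)).comp hφ'
  refine tendsto_integral_smul_of_tendsto_average_norm_sub
    (volume.real (closedBall (0 : R3) 1) / ∫ y, bump y) this ?_ ?_ ?_ ?_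
  · filter_upwards with i using hu.integrableOn_isCompact (isCompact_closedBall _ _)
  · simp only [integral_mollifier_sub]; exact tendsto_const_nhds
  · filter_upwards with i x hx
    by_contra hx'
    rw [mem_closedBall, not_le, dist_comm, dist_eq_norm] at hx'
    exact hx (mollifier_eq_zero i hx'.le)
  · filter_upwards with i x
    rw [abs_of_nonneg (mollifier_nonneg _ _)]
    have e : volume.real (closedBall x₀ (1 / (i + 1 : ℝ))) =
        (1 / (i + 1 : ℝ)) ^ 3 * volume.real (closedBall (0 : R3) 1) := by
      have := Measure.addHaar_real_closedBall' (volume : Measure R3) x₀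
        (show 0 ≤ 1 / (i + 1 : ℝ) by positivity)
      simpa only [finrank_euclideanSpace, Fintype.card_fin] using this
    simp only [e]
    have := integral_bump_pos
    have hb : 0 < volume.real (closedBall (0 : R3) 1) :=
      ENNReal.toReal_pos (measure_closedBall_pos _ _ one_pos).ne' measure_closedBall_lt_top.ne
    refine (mul_le_of_le_one_right (by positivity) (bump_le_one _)).trans (le_of_eq ?_)
    field_simp

/-! ### Weak gradients and mollification. -/

lemma inner_gradient_left (f : R3 → ℝ) (x w : R3) : inner ℝ (gradient f x) w = fderiv ℝ f x w := by
  simp [gradient]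

/-- A smooth function has its classical gradient as weak gradient. -/
lemma isWeakGradient_gradient {f : R3 → ℝ} (hf : ContDiff ℝ ∞ f) :
    IsWeakGradient f (gradient f) := by
  intro φ hφ hc
  have i1 : Integrable (fun x => f x • gradient φ x) :=
    (hf.continuous.smul (continuous_gradient hφ)).integrable_of_hasCompactSupport
      (hasCompactSupport_gradient hc).smul_left
  have i2 : Integrable (fun x => φ x • gradient f x) :=
    (hφ.continuous.smul (continuous_gradient hf)).integrable_of_hasCompactSupport
      hc.smul_right
  refine ext_inner_right ℝ fun w => ?_
  rw [inner_neg_left, real_inner_comm, real_inner_comm w (∫ x, φ x • _), ← integral_inner i1, ← integral_inner i2]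
  have e1 : ∀ x, inner ℝ w (f x • gradient φ x) = f x * fderiv ℝ φ x w := fun x => by
    rw [inner_smul_right, real_inner_comm, inner_gradient_left]
  have e2 : ∀ x, inner ℝ w (φ x • gradient f x) = fderiv ℝ f x w * φ x := fun x => by
    rw [inner_smul_right, real_inner_comm, inner_gradient_left, mul_comm]
  have j1 := i1.const_inner (𝕜 := ℝ) w
  have j2 := i2.const_inner (𝕜 := ℝ) w
  simp only [e1, e2] at j1 j2 ⊢
  exact integral_mul_fderiv_eq_neg_fderiv_mul_of_integrable j2 j1
    ((hf.continuous.mul hφ.continuous).integrable_of_hasCompactSupport hc.mul_left)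
    (fun x _ => hf.differentiable (by simp) x) (fun x _ => hφ.differentiable (by simp) x)

lemma mollify_eq_convolution (n : ℕ) (u : R3 → ℝ) :
    mollify n u = MeasureTheory.convolution (mollifier n) u (ContinuousLinearMap.lsmul ℝ ℝ) volume := by
  ext x
  rw [convolution_eq_swap]
  rfl

lemma contDiff_mollify (n : ℕ) {u : R3 → ℝ} (hu : LocallyIntegrable u) :
    ContDiff ℝ ∞ (mollify n u) := by
  rw [mollify_eq_convolution]
  exact (hasCompactSupport_mollifier n).contDiff_convolution_left _ (contDiff_mollifier n) hu

lemma contDiff_mollifier_sub (n : ℕ) (x : R3) : ContDiff ℝ ∞ (fun y => mollifier n (x - y)) :=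
  (contDiff_mollifier n).comp (contDiff_const.sub contDiff_id)

lemma hasCompactSupport_mollifier_sub (n : ℕ) (x : R3) :
    HasCompactSupport (fun y => mollifier n (x - y)) :=
  (hasCompactSupport_mollifier n).comp_homeomorph (Homeomorph.subLeft x)

/-- The definition of the weak gradient is applied to the test function `y ↦ ρₙ(x - y)`, whose
gradient in `y` is `-∇ρₙ(x - y)`; the two minus signs cancel. -/
lemma gradient_mollify (n : ℕ) {u : R3 → ℝ} {G : R3 → R3} (hu : LocallyIntegrable u)
    (h : IsWeakGradient u G) : gradient (mollify n u) = mollify n G := by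
  ext1 x
  have hd := (hasCompactSupport_mollifier n).hasFDerivAt_convolution_left
    (ContinuousLinearMap.lsmul ℝ ℝ) ((contDiff_mollifier n).of_le (by simp)) hu x
  rw [← mollify_eq_convolution] at hd
  have key := h _ (contDiff_mollifier_sub n x) (hasCompactSupport_mollifier_sub n x)
  have hg : ∀ y, gradient (fun y => mollifier n (x - y)) y = - gradient (mollifier n) (x - y) := by
    intro y
    refine ext_inner_right ℝ fun w => ?_
    rw [inner_neg_left, inner_gradient_left, inner_gradient_left]
    have h1 : HasFDerivAt (mollifier n) (fderiv ℝ (mollifier n) (x - y)) (x - y) :=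
      ((contDiff_mollifier n).differentiable (by simp) _).hasFDerivAt
    have h2 := h1.comp y ((hasFDerivAt_id y).const_sub x)
    have h3 : fderiv ℝ (fun y => mollifier n (x - y)) y = _ := h2.fderiv
    rw [h3]
    simp
  simp only [hg, smul_neg, integral_neg, neg_inj] at key
  rw [mollify, ← key]
  have i1 : Integrable (fun y => u y • gradient (mollifier n) (x - y)) :=
    hu.integrable_smul_right_of_hasCompactSupport
      ((continuous_gradient (contDiff_mollifier n)).comp (continuous_const.sub continuous_id))
      ((hasCompactSupport_gradient (hasCompactSupport_mollifier n)).comp_homeomorph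
        (Homeomorph.subLeft x))
  refine ext_inner_right ℝ fun w => ?_
  rw [inner_gradient_left, hd.fderiv, real_inner_comm, ← integral_inner i1, convolution_eq_swap]
  have i2 : Integrable (fun y => ((ContinuousLinearMap.lsmul ℝ ℝ).precompL R3
      (fderiv ℝ (mollifier n) (x - y))) (u y)) := by
    have := (((hasCompactSupport_mollifier n).fderiv ℝ).convolutionExists_left
      ((ContinuousLinearMap.lsmul ℝ ℝ).precompL R3)
      ((contDiff_mollifier n).continuous_fderiv (by simp)) hu) x
    exact this.integrable_swap
  rw [ContinuousLinearMap.integral_apply i2]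
  refine integral_congr_ae (ae_of_all _ fun y => ?_)
  simp [ContinuousLinearMap.precompL_apply, inner_smul_right, mul_comm]

/-- Cauchy–Schwarz with the kernel split as `k = k^(1/2) k^(1/2)`, then Tonelli; the kernel has mass
one in each of its two variables. -/
lemma lintegral_enorm_mollify_sq_le (n : ℕ) {G : R3 → R3} (hG : AEStronglyMeasurable G) :
    ∫⁻ x, ‖mollify n G x‖ₑ ^ 2 ≤ ∫⁻ x, ‖G x‖ₑ ^ 2 := by
  have hmm : Measurable (mollifier n) := (contDiff_mollifier n).continuous.measurable
  have hpt : ∀ x, ‖mollify n G x‖ₑ ^ 2 ≤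
      ∫⁻ y, ENNReal.ofReal (mollifier n (x - y)) * ‖G y‖ₑ ^ 2 := by
    intro x
    set k : R3 → ℝ≥0∞ := fun y => ENNReal.ofReal (mollifier n (x - y))
    have hk : Measurable k := by fun_prop
    have h1 : ‖mollify n G x‖ₑ ≤ ∫⁻ y, (k y ^ (1 / 2 : ℝ)) * (k y ^ (1 / 2 : ℝ) * ‖G y‖ₑ) := by
      refine (enorm_integral_le_lintegral_enorm _).trans (le_of_eq (lintegral_congr fun y => ?_))
      rw [← mul_assoc, ← ENNReal.rpow_add_of_nonneg _ _ (by norm_num) (by norm_num)]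
      norm_num [enorm_smul, k, Real.enorm_of_nonneg (mollifier_nonneg n _)]
    have h2 := ENNReal.lintegral_mul_le_Lp_mul_Lq (volume : Measure R3)
      (Real.HolderConjugate.two_two) (f := fun y => k y ^ (1 / 2 : ℝ))
      (g := fun y => k y ^ (1 / 2 : ℝ) * ‖G y‖ₑ) (by fun_prop) (by fun_prop)
    have e1 : ∀ y, (k y ^ (1 / 2 : ℝ)) ^ (2 : ℝ) = k y := fun y => by
      rw [← ENNReal.rpow_mul]; norm_num
    have e2 : ∀ y, (k y ^ (1 / 2 : ℝ) * ‖G y‖ₑ) ^ (2 : ℝ) = k y * ‖G y‖ₑ ^ 2 := fun y => by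
      rw [ENNReal.mul_rpow_of_nonneg _ _ (by norm_num), e1]; norm_num
    simp only [Pi.mul_apply, e1, e2] at h2
    rw [lintegral_mollifier_sub_left, ENNReal.one_rpow, one_mul] at h2
    calc ‖mollify n G x‖ₑ ^ 2 ≤ ((∫⁻ y, k y * ‖G y‖ₑ ^ 2) ^ (1 / 2 : ℝ)) ^ 2 := by
          gcongr; exact h1.trans h2
      _ = _ := by rw [← ENNReal.rpow_natCast, ← ENNReal.rpow_mul]; norm_num [k]
  refine (lintegral_mono hpt).trans ?_
  rw [lintegral_lintegral_swap]
  · refine lintegral_mono fun y => ?_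
    dsimp only
    rw [lintegral_mul_const _ (by fun_prop), lintegral_mollifier_sub_right, one_mul]
  · have : AEMeasurable (fun z : R3 × R3 => ‖G z.2‖ₑ ^ 2) (volume.prod volume) :=
      ((hG.comp_snd (μ := (volume : Measure R3))).enorm).pow_const 2
    have h2 : Measurable (fun z : R3 × R3 => ENNReal.ofReal (mollifier n (z.1 - z.2))) := by
      fun_prop
    exact h2.aemeasurable.mul this

lemma lintegral_enorm_sq_eq {G : R3 → R3} (hG : MemLp G 2) :
    ∫⁻ x, ‖G x‖ₑ ^ 2 = ENNReal.ofReal (∫ x, ‖G x‖ ^ 2) := by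
  rw [ofReal_integral_eq_lintegral_ofReal (hG.integrable_norm_pow two_ne_zero) (ae_of_all _ fun x => by positivity)]
  refine lintegral_congr fun x => ?_
  rw [ENNReal.ofReal_pow (norm_nonneg _), ofReal_norm]

lemma memLp_two_of_lintegral_le {G : R3 → R3} (hm : AEStronglyMeasurable G) {A : ℝ} (hA : 0 ≤ A)
    (h : ∫⁻ x, ‖G x‖ₑ ^ 2 ≤ ENNReal.ofReal A) : MemLp G 2 ∧ ∫ x, ‖G x‖ ^ 2 ≤ A := by
  have hG : MemLp G 2 := by
    refine ⟨hm, (eLpNorm_lt_top_iff_lintegral_rpow_enorm_lt_top (by norm_num) (by norm_num)).2 ?_⟩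
    simpa using h.trans_lt ENNReal.ofReal_lt_top
  refine ⟨hG, ?_⟩
  rw [lintegral_enorm_sq_eq hG] at h
  exact (ENNReal.ofReal_le_ofReal_iff hA).1 h

lemma gradient_mollify_energy (n : ℕ) {u : R3 → ℝ} {G : R3 → R3} (hu : LocallyIntegrable u)
    (hG : MemLp G 2) (h : IsWeakGradient u G) :
    MemLp (gradient (mollify n u)) 2 ∧ ∫ x, ‖gradient (mollify n u) x‖ ^ 2 ≤ ∫ x, ‖G x‖ ^ 2 := by
  refine memLp_two_of_lintegral_le
    (continuous_gradient (contDiff_mollify n hu)).aestronglyMeasurable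
    (integral_nonneg fun x => by positivity) ?_
  rw [gradient_mollify n hu h, ← lintegral_enorm_sq_eq hG]
  exact lintegral_enorm_mollify_sq_le n hG.1

/-- Two vectors of the same norm are related by a linear isometry. -/
lemma exists_isometry_of_norm_eq {x y : R3} (h : ‖x‖ = ‖y‖) : ∃ k : R3 ≃ₗᵢ[ℝ] R3, k x = y :=
  ⟨(ℝ ∙ (x - y))ᗮ.reflection, Submodule.reflection_sub h⟩

lemma mollify_radial (n : ℕ) {u : R3 → ℝ} {g : ℝ → ℝ} (hu : u =ᵐ[volume] fun x => g ‖x‖)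
    {x y : R3} (h : ‖x‖ = ‖y‖) : mollify n u x = mollify n u y := by
  obtain ⟨k, rfl⟩ := exists_isometry_of_norm_eq h
  have e : ∀ z, mollify n u z = ∫ w, mollifier n (z - w) * g ‖w‖ := fun z => by
    refine integral_congr_ae ?_
    filter_upwards [hu] with w hw
    rw [hw, smul_eq_mul]
  rw [e, e (k x), ← k.measurePreserving.integral_comp k.toHomeomorph.measurableEmbedding
    (fun w => mollifier n (k x - w) * g ‖w‖)]
  refine integral_congr_ae (ae_of_all _ fun w => ?_)
  dsimp only
  rw [← map_sub, mollifier_congr n (k.norm_map (x - w)), k.norm_map]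

/-! ### Weak limits in `L²` -/

/-- Bounded sequences in `L²` have weak limits along the hyperfilter. -/
lemma exists_weak_limit {G : ℕ → R3 → R3} (hG : ∀ n, MemLp (G n) 2) {A : ℝ}
    (hA : ∀ n, ∫ x, ‖G n x‖ ^ 2 ≤ A) :
    ∃ H : R3 → R3, MemLp H 2 ∧ ∫ x, ‖H x‖ ^ 2 ≤ A ∧ ∀ F : R3 → R3, MemLp F 2 →
      Tendsto (fun n => ∫ x, inner ℝ (G n x) (F x)) (hyperfilter ℕ)
        (𝓝 (∫ x, inner ℝ (H x) (F x))) := by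
  have hA0 : 0 ≤ A := le_trans (integral_nonneg fun x => by positivity) (hA 0)
  have hsq : ∀ f : Lp R3 2 (volume : Measure R3), ‖f‖ ^ 2 = ∫ x, ‖f x‖ ^ 2 := by
    intro f
    rw [← real_inner_self_eq_norm_sq, L2.inner_def]
    simp only [real_inner_self_eq_norm_sq]
  let T : ℕ → WeakDual ℝ (Lp R3 2 (volume : Measure R3)) := fun n =>
    StrongDual.toWeakDual (InnerProductSpace.toDual ℝ _ ((hG n).toLp (G n)))
  have hT : ∀ n, T n ∈ WeakDual.toStrongDual ⁻¹' closedBall (0 : StrongDual ℝ _) (√A) := by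
    intro n
    simp only [T, mem_preimage, mem_closedBall, dist_zero_right]
    have : ‖(hG n).toLp (G n)‖ ≤ √A := by
      refine Real.le_sqrt_of_sq_le ?_
      rw [hsq]
      refine (integral_congr_ae ((hG n).coeFn_toLp.fun_comp fun z => ‖z‖ ^ 2)).trans_le ?_
      exact hA n
    simpa using this
  -- Banach–Alaoglu: an ultrafilter on a compact ball converges, so no subsequence has to be
  -- extracted.
  obtain ⟨L, hL, hlim⟩ := (WeakDual.isCompact_closedBall (𝕜 := ℝ) (0 : StrongDual ℝ
    (Lp R3 2 (volume : Measure R3))) (√A)).ultrafilter_le_nhds ((hyperfilter ℕ).map T) (by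
      simp only [le_principal_iff, Ultrafilter.coe_map, mem_map]
      exact Eventually.of_forall hT)
  set H := (InnerProductSpace.toDual ℝ (Lp R3 2 (volume : Measure R3))).symm
    (WeakDual.toStrongDual L) with hH
  refine ⟨H, Lp.memLp H, ?_, fun F hF => ?_⟩
  · rw [← hsq]
    have : ‖H‖ ≤ √A := by simpa [hH] using hL
    calc ‖H‖ ^ 2 ≤ √A ^ 2 := by gcongr
      _ = A := Real.sq_sqrt hA0
  · have hlim' : Tendsto T (hyperfilter ℕ) (𝓝 L) := hlim
    have := (WeakDual.eval_continuous (𝕜 := ℝ) (hF.toLp F)).continuousAt.tendsto.comp hlim'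
    have e : L (hF.toLp F) = ∫ x, inner ℝ (H x) (F x) := by
      have h1 : L (hF.toLp F) = inner ℝ H (hF.toLp F) := by
        rw [hH, InnerProductSpace.toDual_symm_apply]; rfl
      rw [h1, L2.inner_def]
      refine integral_congr_ae ?_
      filter_upwards [hF.coeFn_toLp] with x hx
      rw [hx]
    rw [← e]
    refine this.congr fun n => ?_
    have h1 : T n (hF.toLp F) = inner ℝ ((hG n).toLp (G n)) (hF.toLp F) := rfl
    simp only [Function.comp_apply]
    rw [h1, L2.inner_def]
    refine integral_congr_ae ?_
    filter_upwards [hF.coeFn_toLp, (hG n).coeFn_toLp] with x hx hx'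
    rw [hx, hx']

/-- Weak gradients pass to the limit along bounded sequences. -/
lemma exists_weakGradient_of_tendsto {u : ℕ → R3 → ℝ} {G : ℕ → R3 → R3} {v : R3 → ℝ}
    (hG : ∀ n, MemLp (G n) 2) {A : ℝ} (hA : ∀ n, ∫ x, ‖G n x‖ ^ 2 ≤ A)
    (hw : ∀ n, IsWeakGradient (u n) (G n))
    (hlim : ∀ φ : R3 → ℝ, ContDiff ℝ ∞ φ → HasCompactSupport φ →
      Tendsto (fun n => ∫ x, u n x • gradient φ x) atTop (𝓝 (∫ x, v x • gradient φ x))) :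
    ∃ H : R3 → R3, MemLp H 2 ∧ ∫ x, ‖H x‖ ^ 2 ≤ A ∧ IsWeakGradient v H := by
  obtain ⟨H, hH, hHA, hF⟩ := exists_weak_limit hG hA
  refine ⟨H, hH, hHA, fun φ hφ hc => ?_⟩
  refine ext_inner_right ℝ fun w => ?_
  have iφ : ∀ {K : R3 → R3}, MemLp K 2 → Integrable (fun x => φ x • K x) := fun hK =>
    (hK.locallyIntegrable (by norm_num)).integrable_smul_left_of_hasCompactSupport hφ.continuous hc
  have e : ∀ {K : R3 → R3}, MemLp K 2 →
      inner ℝ (∫ x, φ x • K x) w = ∫ x, inner ℝ (K x) (φ x • w) := fun hK => by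
    rw [real_inner_comm, ← integral_inner (iφ hK)]
    refine integral_congr_ae (ae_of_all _ fun x => ?_)
    simp only [inner_smul_right, real_inner_comm]
  have hm : MemLp (fun x => φ x • w) 2 :=
    (hφ.continuous.smul continuous_const).memLp_of_hasCompactSupport hc.smul_right
  have h1 := hF _ hm
  simp only [← e (hG _), ← e hH] at h1
  -- The hyperfilter refines `atTop`, so the assumed limit and the weak limit can be compared along
  -- it.
  have h2 : Tendsto (fun n => inner ℝ (∫ x, u n x • gradient φ x) w) (hyperfilter ℕ)
      (𝓝 (inner ℝ (∫ x, v x • gradient φ x) w)) :=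
    ((hlim φ hφ hc).mono_left Nat.hyperfilter_le_atTop).inner tendsto_const_nhds
  simp only [hw _ φ hφ hc, inner_neg_left] at h2
  rw [inner_neg_left]
  exact tendsto_nhds_unique h2 h1.neg

/-! ### Smooth radial functions -/

def unitVec : R3 := EuclideanSpace.single 0 1

lemma norm_unitVec : ‖unitVec‖ = 1 := by simp [unitVec]

lemma norm_smul_unitVec {r : ℝ} (hr : 0 ≤ r) : ‖r • unitVec‖ = r := by
  rw [norm_smul, norm_unitVec, mul_one, Real.norm_of_nonneg hr]

structure IsRadialSmooth (U : R3 → ℝ) : Prop where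
  smooth : ContDiff ℝ ∞ U
  radial : ∀ x y, ‖x‖ = ‖y‖ → U x = U y
  memLp : MemLp (gradient U) 2

namespace IsRadialSmooth

variable {U : R3 → ℝ}

lemma eq_profile (h : IsRadialSmooth U) (x : R3) : U x = U (‖x‖ • unitVec) :=
  h.radial _ _ (norm_smul_unitVec (norm_nonneg x)).symm

/-- The profile can be read off along any ray. Taking `w = x/‖x‖` and comparing with `unitVec` gives
`inner_gradient`. -/
lemma hasDerivAt (h : IsRadialSmooth U) {w : R3} (hw : ‖w‖ = 1) (t : ℝ) :
    HasDerivAt (fun r : ℝ => U (r • unitVec)) (inner ℝ (gradient U (t • w)) w) t := by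
  have e : (fun r : ℝ => U (r • unitVec)) = U ∘ fun r : ℝ => r • w := by
    ext r
    exact h.radial _ _ (by rw [norm_smul, norm_smul, norm_unitVec, hw])
  rw [e, inner_gradient_left]
  have h1 : HasFDerivAt U (fderiv ℝ U (t • w)) (t • w) :=
    (h.smooth.differentiable (by simp) _).hasFDerivAt
  have h2 : HasDerivAt (fun r : ℝ => r • w) w t := by
    simpa using (hasDerivAt_id t).smul_const w
  exact h1.comp_hasDerivAt t h2

/-- The derivative of the profile. -/
def slope (U : R3 → ℝ) (t : ℝ) : ℝ := inner ℝ (gradient U (t • unitVec)) unitVec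

lemma continuous_slope (h : IsRadialSmooth U) : Continuous (slope U) := by
  have := continuous_gradient h.smooth
  unfold slope
  fun_prop

lemma inner_gradient (h : IsRadialSmooth U) (x : R3) :
    inner ℝ (gradient U x) x = ‖x‖ * slope U ‖x‖ := by
  rcases eq_or_ne x 0 with rfl | hx
  · simp
  have hn : ‖x‖ ≠ 0 := norm_ne_zero_iff.2 hx
  have hw : ‖(‖x‖⁻¹ • x)‖ = 1 := by rw [norm_smul, norm_inv, norm_norm, inv_mul_cancel₀ hn]
  have := (h.hasDerivAt hw ‖x‖).unique (h.hasDerivAt norm_unitVec ‖x‖)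
  rw [smul_smul, mul_inv_cancel₀ hn, one_smul, inner_smul_right] at this
  rw [slope, ← this]
  field_simp

lemma abs_slope_le (h : IsRadialSmooth U) {x : R3} (hx : x ≠ 0) :
    |slope U ‖x‖| ≤ ‖gradient U x‖ := by
  have hn : 0 < ‖x‖ := norm_pos_iff.2 hx
  have h1 := abs_real_inner_le_norm (gradient U x) x
  rw [h.inner_gradient, abs_mul, abs_norm, mul_comm] at h1
  exact le_of_mul_le_mul_right h1 hn

lemma ae_sq_slope_le (h : IsRadialSmooth U) :
    ∀ᵐ x : R3, slope U ‖x‖ ^ 2 ≤ ‖gradient U x‖ ^ 2 := by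
  have : ∀ᵐ x : R3, x ≠ 0 := by simp [ae_iff]
  filter_upwards [this] with x hx
  rw [← sq_abs (slope U ‖x‖)]
  gcongr
  exact h.abs_slope_le hx

lemma integrable_sq_slope (h : IsRadialSmooth U) :
    Integrable (fun x : R3 => slope U ‖x‖ ^ 2) := by
  refine (h.memLp.integrable_norm_pow two_ne_zero).mono'
    (((h.continuous_slope.comp continuous_norm).pow 2).aestronglyMeasurable) ?_
  filter_upwards [h.ae_sq_slope_le] with x hx
  rwa [Real.norm_of_nonneg (by positivity)]

lemma integral_sq_slope_le (h : IsRadialSmooth U) {s r : ℝ} (hs : 0 < s) (hsr : s ≤ r) :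
    ∫ t in s..r, t ^ 2 * slope U t ^ 2 ≤ (∫ x, ‖gradient U x‖ ^ 2) / sphereArea := by
  have h1 := integral_radial (fun t => slope U t ^ 2)
  have h2 := integral_mono_ae h.integrable_sq_slope (h.memLp.integrable_norm_pow two_ne_zero)
    h.ae_sq_slope_le
  rw [h1] at h2
  rw [le_div_iff₀ sphereArea_pos, mul_comm]
  refine le_trans ?_ h2
  gcongr
  · exact sphereArea_pos.le
  rw [intervalIntegral.integral_of_le hsr]
  refine setIntegral_mono_set (integrable_radial.1 h.integrable_sq_slope) ?_ ?_
  · filter_upwards with t; positivity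
  · exact (Ioc_subset_Ioi_self.trans (Ioi_subset_Ioi hs.le)).eventuallyLE

lemma integral_slope (h : IsRadialSmooth U) (s r : ℝ) :
    ∫ t in s..r, slope U t = U (r • unitVec) - U (s • unitVec) :=
  intervalIntegral.integral_eq_sub_of_hasDerivAt (fun t _ => h.hasDerivAt norm_unitVec t)
    (h.continuous_slope.intervalIntegrable _ _)

/-- Cauchy–Schwarz for `U(r) - U(s) = ∫ (t U'(t)) (1/t) dt`, where `∫ 1/t² = 1/s - 1/r`. -/
lemma holder (h : IsRadialSmooth U) {A : ℝ} (hA : ∫ x, ‖gradient U x‖ ^ 2 ≤ A) {s r : ℝ}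
    (hs : 0 < s) (hsr : s ≤ r) :
    (U (r • unitVec) - U (s • unitVec)) ^ 2 ≤ A / sphereArea * (1 / s - 1 / r) := by
  rcases hsr.eq_or_lt with rfl | hlt
  · simp
  have hr : 0 < r := hs.trans hlt
  set D := U (r • unitVec) - U (s • unitVec)
  set b := 1 / s - 1 / r
  have hb : 0 < b := sub_pos.2 (one_div_lt_one_div_of_lt hs hlt)
  have h0 : ∀ t ∈ uIcc s r, t ≠ 0 := fun t ht => by
    rw [uIcc_of_le hsr] at ht; exact (hs.trans_le ht.1).ne'
  have hib : ∫ t in s..r, (1 / t ^ 2) = b := by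
    rw [intervalIntegral.integral_eq_sub_of_hasDerivAt (f := fun t => -(1 / t))]
    · simp only [b]; ring
    · intro t ht
      have := ((hasDerivAt_inv (h0 t ht)).neg)
      simpa [one_div, Pi.neg_def] using this
    · refine ContinuousOn.intervalIntegrable ?_
      exact continuousOn_const.div (continuousOn_id.pow 2) fun t ht => pow_ne_zero 2 (h0 t ht)
  have i1 : IntervalIntegrable (fun t => t ^ 2 * slope U t ^ 2) volume s r :=
    ((continuous_pow 2).mul (h.continuous_slope.pow 2)).intervalIntegrable _ _
  have i2 : IntervalIntegrable (fun t => 2 * (D / b) * slope U t) volume s r :=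
    (continuous_const.mul h.continuous_slope).intervalIntegrable _ _
  have i3 : IntervalIntegrable (fun t => (D / b) ^ 2 * (1 / t ^ 2)) volume s r :=
    ContinuousOn.intervalIntegrable (continuousOn_const.mul
      (continuousOn_const.div (continuousOn_id.pow 2) fun t ht => pow_ne_zero 2 (h0 t ht)))
  -- Cauchy–Schwarz by hand: the integrand is the square of `t U' - (D/b)/t`, and `D/b` is the
  -- optimal multiplier.
  have hnn : 0 ≤ ∫ t in s..r,
      (t ^ 2 * slope U t ^ 2 - 2 * (D / b) * slope U t + (D / b) ^ 2 * (1 / t ^ 2)) := by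
    refine intervalIntegral.integral_nonneg hsr fun t ht => ?_
    have ht0 : t ≠ 0 := (hs.trans_le ht.1).ne'
    have : t ^ 2 * slope U t ^ 2 - 2 * (D / b) * slope U t + (D / b) ^ 2 * (1 / t ^ 2) =
        (t * slope U t - (D / b) / t) ^ 2 := by field_simp; ring
    rw [this]; positivity
  rw [intervalIntegral.integral_add (i1.sub i2) i3, intervalIntegral.integral_sub i1 i2,
    intervalIntegral.integral_const_mul, intervalIntegral.integral_const_mul, hib,
    h.integral_slope] at hnn
  have h1 := h.integral_sq_slope_le hs hsr
  have h2 : (∫ x, ‖gradient U x‖ ^ 2) / sphereArea ≤ A / sphereArea := by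
    gcongr; exact sphereArea_pos.le
  have h3 : D ^ 2 / b ≤ A / sphereArea := by
    have : -(2 * (D / b) * D) + (D / b) ^ 2 * b = - (D ^ 2 / b) := by field_simp; ring
    simp only [D] at this hnn ⊢
    linarith
  rwa [div_le_iff₀ hb] at h3

/-- Integrate `(t U²)' = U² + 2t U U'` and absorb the cross term by `-2t U U' ≤ U²/2 + 2t² U'²`. The
boundary term at `r` stays; it is bounded by the decay estimate once the mollification is removed.
-/
lemma hardy (h : IsRadialSmooth U) {A : ℝ} (hA : ∫ x, ‖gradient U x‖ ^ 2 ≤ A) {s r : ℝ}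
    (hs : 0 < s) (hsr : s ≤ r) :
    ∫ t in s..r, U (t • unitVec) ^ 2 ≤ 2 * r * U (r • unitVec) ^ 2 + 4 * (A / sphereArea) := by
  have hU : Continuous U := h.smooth.continuous
  have hs' := h.continuous_slope
  have hd : ∀ t ∈ uIcc s r, HasDerivAt (fun t : ℝ => t * U (t • unitVec) ^ 2)
      (U (t • unitVec) ^ 2 + 2 * t * U (t • unitVec) * slope U t) t := by
    intro t _
    have : HasDerivAt (fun t : ℝ => t * U (t • unitVec) ^ 2) _ t :=
      (hasDerivAt_id t).mul ((h.hasDerivAt norm_unitVec t).pow 2)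
    refine this.congr_deriv ?_
    simp [slope]
    ring
  have h1 := intervalIntegral.integral_eq_sub_of_hasDerivAt hd
    (Continuous.intervalIntegrable (by fun_prop) _ _)
  have h2 : ∫ t in s..r, 1 / 2 * U (t • unitVec) ^ 2 ≤ ∫ t in s..r,
      ((U (t • unitVec) ^ 2 + 2 * t * U (t • unitVec) * slope U t) + 2 * (t ^ 2 * slope U t ^ 2)) := by
    refine intervalIntegral.integral_mono_on hsr (Continuous.intervalIntegrable (by fun_prop) _ _)
      (Continuous.intervalIntegrable (by fun_prop) _ _) fun t _ => ?_
    nlinarith [sq_nonneg (U (t • unitVec) + 2 * t * slope U t)]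
  rw [intervalIntegral.integral_add (Continuous.intervalIntegrable (by fun_prop) _ _)
    (Continuous.intervalIntegrable (by fun_prop) _ _), h1, intervalIntegral.integral_const_mul,
    intervalIntegral.integral_const_mul] at h2
  have h3 := h.integral_sq_slope_le hs hsr
  have h4 : (∫ x, ‖gradient U x‖ ^ 2) / sphereArea ≤ A / sphereArea := by
    gcongr; exact sphereArea_pos.le
  have h5 : 0 ≤ s * U (s • unitVec) ^ 2 := by positivity
  linarith

end IsRadialSmooth

lemma isRadialSmooth_mollify (n : ℕ) {u : R3 → ℝ} {G : R3 → R3} {g : ℝ → ℝ}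
    (hu : LocallyIntegrable u) (hG : MemLp G 2) (h : IsWeakGradient u G)
    (hr : u =ᵐ[volume] fun x => g ‖x‖) : IsRadialSmooth (mollify n u) :=
  ⟨contDiff_mollify n hu, fun _ _ => mollify_radial n hr, (gradient_mollify_energy n hu hG h).1⟩

/-! ### Powers of the norm -/

lemma integrableOn_norm_rpow {s : ℝ} (hs : s < 3) (R : ℝ) :
    IntegrableOn (fun x : R3 => ‖x‖ ^ (-s)) (ball 0 R) := by
  have h := (integrableOn_fun_norm_addHaar (volume : Measure R3) (f := fun t => t ^ (-s)) (r := R))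
  rw [h]
  have h1 : IntegrableOn (fun t : ℝ => t ^ (2 - s)) (Ioo 0 R) := by
    rcases le_or_gt R 0 with hR | hR
    · simp [Ioo_eq_empty_of_le hR]
    exact ((intervalIntegrable_iff_integrableOn_Ioo_of_le hR.le).1
      (intervalIntegral.intervalIntegrable_rpow' (by linarith)))
  refine h1.congr_fun (fun t ht => ?_) measurableSet_Ioo
  simp only [finrank_euclideanSpace, Fintype.card_fin, smul_eq_mul]
  rw [← Real.rpow_natCast, ← Real.rpow_add ht.1]
  norm_num [sub_eq_add_neg]

lemma integral_norm_rpow {s R : ℝ} (hs : s < 3) (hR : 0 ≤ R) :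
    ∫ x in ball (0 : R3) R, ‖x‖ ^ (-s) = sphereArea * (R ^ (3 - s) / (3 - s)) := by
  rw [← integral_indicator measurableSet_ball]
  have e : ∀ x : R3, (ball (0 : R3) R).indicator (fun x => ‖x‖ ^ (-s)) x =
      (fun t => (Iio R).indicator (fun t => t ^ (-s)) t) ‖x‖ := fun x => by simp [indicator]
  simp only [e]
  rw [integral_radial (fun t => (Iio R).indicator (fun t => t ^ (-s)) t)]
  congr 1
  have e2 : ∀ t ∈ Ioi (0 : ℝ), t ^ 2 * (Iio R).indicator (fun t => t ^ (-s)) t =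
      (Iio R).indicator (fun t => t ^ (2 - s)) t := by
    intro t ht
    by_cases hx : t ∈ Iio R
    · simp only [indicator_of_mem hx]
      rw [← Real.rpow_natCast, ← Real.rpow_add ht]
      norm_num [sub_eq_add_neg]
    · simp only [indicator_of_notMem hx, mul_zero]
  rw [setIntegral_congr_fun measurableSet_Ioi e2, setIntegral_indicator measurableSet_Iio,
    Ioi_inter_Iio, ← integral_Ioc_eq_integral_Ioo, ← intervalIntegral.integral_of_le hR,
    integral_rpow (Or.inl (by linarith)), Real.zero_rpow (by linarith)]
  rw [show 2 - s + 1 = 3 - s by ring, sub_zero]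

/-! ### Profiles of radial functions -/

/-- `g` is the profile of a radial function with Dirichlet energy at most `sphereArea * a`. -/
structure IsProfile (a : ℝ) (g : ℝ → ℝ) : Prop where
  measurable : Measurable g
  holder : ∀ s r, 0 < s → s ≤ r → (g r - g s) ^ 2 ≤ a * (1 / s - 1 / r)
  decay : ∀ r, 0 < r → g r ^ 2 ≤ a / r

lemma integrableOn_one_add_norm_rpow (R : ℝ) :
    IntegrableOn (fun x : R3 => 1 + ‖x‖ ^ (-(1 / 2 : ℝ))) (closedBall 0 R) := by
  have h1 : IntegrableOn (fun x : R3 => ‖x‖ ^ (-(1 / 2 : ℝ))) (closedBall 0 R) :=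
    (integrableOn_norm_rpow (by norm_num) (R + 1)).mono_set
      (closedBall_subset_ball (by linarith))
  exact (integrableOn_const measure_closedBall_lt_top.ne).add h1

/-- Dominated convergence, with the singularity `‖x‖^(-1/2)` that `g(r)² ≤ a/r` allows at the
origin; it is locally integrable in dimension three. -/
lemma tendsto_integral_smul_of_bound {F : Type*} [NormedAddCommGroup F] [NormedSpace ℝ F]
    {f : ℕ → R3 → ℝ} {f' : R3 → ℝ} {Φ : R3 → F} (hΦ : AEStronglyMeasurable Φ) {B R C : ℝ}
    (hB : ∀ x, ‖Φ x‖ ≤ B) (h0 : ∀ x, R < ‖x‖ → Φ x = 0) (hm : ∀ n, AEStronglyMeasurable (f n))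
    (hb : ∀ n, ∀ᵐ x : R3, ‖x‖ ≤ R → |f n x| ≤ C * (1 + ‖x‖ ^ (-(1 / 2 : ℝ))))
    (hl : ∀ᵐ x, Tendsto (fun n => f n x) atTop (𝓝 (f' x))) :
    Tendsto (fun n => ∫ x, f n x • Φ x) atTop (𝓝 (∫ x, f' x • Φ x)) := by
  have hB0 : 0 ≤ B := (norm_nonneg _).trans (hB 0)
  have := ((integrableOn_one_add_norm_rpow R).integrable_indicator
    measurableSet_closedBall).const_mul (C * B)
  refine tendsto_integral_of_dominated_convergence _ (fun n => (hm n).smul hΦ) this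
    (fun n => ?_) ?_
  · filter_upwards [hb n] with x hx
    by_cases h : ‖x‖ ≤ R
    · rw [indicator_of_mem (by simpa using h), norm_smul, Real.norm_eq_abs]
      calc |f n x| * ‖Φ x‖ ≤ (C * (1 + ‖x‖ ^ (-(1 / 2 : ℝ)))) * B :=
            mul_le_mul (hx h) (hB x) (norm_nonneg _) ((abs_nonneg _).trans (hx h))
        _ = _ := by ring
    · rw [h0 x (not_le.1 h), smul_zero, norm_zero, indicator_of_notMem (by simpa using h), mul_zero]
  · filter_upwards [hl] with x hx
    exact hx.smul_const _

lemma exists_bound_of_hasCompactSupport {F : Type*} [NormedAddCommGroup F] {Φ : R3 → F}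
    (hc : Continuous Φ) (h : HasCompactSupport Φ) :
    ∃ B R : ℝ, (∀ x, ‖Φ x‖ ≤ B) ∧ ∀ x, R < ‖x‖ → Φ x = 0 := by
  obtain ⟨B, hB⟩ := hc.bounded_above_of_compact_support h
  obtain ⟨R, hR⟩ := h.isCompact.isBounded.subset_closedBall (0 : R3)
  refine ⟨B, R, hB, fun x hx => image_eq_zero_of_notMem_tsupport fun h' => ?_⟩
  have := hR h'
  rw [mem_closedBall, dist_zero_right] at this
  linarith

lemma sqrt_div_le_mul_rpow {a r : ℝ} (ha : 0 ≤ a) (hr : 0 ≤ r) :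
    √(a / r) = √a * r ^ (-(1 / 2 : ℝ)) := by
  rw [Real.sqrt_div ha, Real.rpow_neg hr, ← Real.sqrt_eq_rpow, div_eq_mul_inv]

lemma measure_annulus_pos {s r : ℝ} (hs : 0 ≤ s) (hsr : s < r) :
    0 < volume {x : R3 | s < ‖x‖ ∧ ‖x‖ < r} := by
  refine IsOpen.measure_pos _ ?_ ⟨((s + r) / 2) • unitVec, ?_⟩
  · exact (isOpen_lt continuous_const continuous_norm).inter
      (isOpen_lt continuous_norm continuous_const)
  · rw [mem_ofPred_eq, norm_smul_unitVec (by linarith)]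
    constructor <;> linarith

lemma exists_norm_mem_of_ae {P : R3 → Prop} (h : ∀ᵐ x, P x) {s r : ℝ} (hs : 0 ≤ s) (hsr : s < r) :
    ∃ x : R3, P x ∧ s < ‖x‖ ∧ ‖x‖ < r := by
  by_contra hcon
  push Not at hcon
  refine (measure_annulus_pos hs hsr).ne' (measure_mono_null (fun x hx => ?_) (ae_iff.1 h))
  exact fun hP => absurd hx.2 (not_lt.2 (hcon x hP hx.1))

/-- Pointwise convergence of functions satisfying a uniform Hölder bound from convergence on a
dense set. -/
lemma cauchySeq_of_holder {γ : ℕ → ℝ → ℝ} {a : ℝ}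
    (hγ : ∀ n s r, 0 < s → s ≤ r → (γ n r - γ n s) ^ 2 ≤ a * (1 / s - 1 / r))
    (hd : ∀ s r, 0 < s → s < r → ∃ t, s < t ∧ t < r ∧ CauchySeq fun n => γ n t) (r : ℝ)
    (hr : 0 < r) : CauchySeq fun n => γ n r := by
  have ha : 0 ≤ a := by
    have h1 := hγ 0 1 2 one_pos one_le_two
    have h2 := sq_nonneg (γ 0 2 - γ 0 1)
    norm_num at h1
    linarith
  rw [Metric.cauchySeq_iff]
  intro ε hε
  have hlim : Tendsto (fun s : ℝ => √(a * (1 / s - 1 / r))) (𝓝 r) (𝓝 0) := by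
    have : ContinuousAt (fun s : ℝ => √(a * (1 / s - 1 / r))) r := by
      have := hr.ne'
      fun_prop (disch := assumption)
    simpa [ContinuousAt] using this
  obtain ⟨δ, hδ, hsub⟩ := Metric.eventually_nhds_iff.1 (hlim.eventually_lt_const (show 0 < ε / 3 by positivity))
  -- The bound `r / 2` keeps `t` positive, and `r - δ` makes the Hölder modulus between `t` and `r`
  -- less than `ε / 3`.
  obtain ⟨t, ht1, ht2, hc⟩ := hd (max (r / 2) (r - δ)) r (lt_of_lt_of_le (by positivity) (le_max_left _ _))
    (max_lt (by linarith) (by linarith))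
  have ht0 : 0 < t := lt_trans (lt_of_lt_of_le (by positivity) (le_max_left _ _)) ht1
  have hts : √(a * (1 / t - 1 / r)) < ε / 3 := hsub (by
    rw [Real.dist_eq, abs_lt]; constructor <;> linarith [le_max_right (r / 2) (r - δ)])
  obtain ⟨N, hN⟩ := Metric.cauchySeq_iff.1 hc (ε / 3) (by positivity)
  have key : ∀ n, |γ n r - γ n t| < ε / 3 := fun n =>
    lt_of_le_of_lt (Real.abs_le_sqrt (hγ n t r ht0 ht2.le)) hts
  refine ⟨N, fun m hm n hn => ?_⟩
  have h1 := abs_lt.1 (key m)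
  have h2 := abs_lt.1 (key n)
  have h3 := hN m hm n hn
  rw [Real.dist_eq, abs_lt] at h3 ⊢
  constructor <;> linarith

/-- If `l ≠ 0`, then `|u| ≥ |l|/2` outside a ball; for `u ∈ L⁶` that set has finite measure, and so
would the whole space. -/
lemma tendsto_zero_of_lintegral_lt_top {u : R3 → ℝ} {g : ℝ → ℝ} {l : ℝ} (hu : MemLp u 6)
    (hg : u =ᵐ[volume] fun x => g ‖x‖) (hl : Tendsto g atTop (𝓝 l)) : l = 0 := by
  by_contra hne
  have hpos : 0 < |l| / 2 := by positivity
  obtain ⟨R, hR⟩ := eventually_atTop.1 ((hl.abs).eventually_const_lt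
    (show |l| / 2 < |l| by linarith [abs_pos.2 hne]))
  have hfin := hu.meas_ge_lt_top (by norm_num) (by norm_num) (ε := Real.toNNReal (|l| / 2))
    (Real.toNNReal_pos.2 hpos).ne'
  have hsub : (closedBall (0 : R3) R)ᶜ ≤ᵐ[volume]
      {x | Real.toNNReal (|l| / 2) ≤ ‖u x‖₊} := by
    filter_upwards [hg] with x hx hxR
    change Real.toNNReal (|l| / 2) ≤ ‖u x‖₊
    rw [hx, ← NNReal.coe_le_coe, Real.coe_toNNReal _ hpos.le, coe_nnnorm, Real.norm_eq_abs]
    refine (hR ‖x‖ ?_).le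
    have : ¬ ‖x‖ ≤ R := fun h => hxR (mem_closedBall_zero_iff.2 h)
    exact (not_le.1 this).le
  have h1 := (measure_mono_ae hsub).trans_lt hfin
  have h2 : volume (univ : Set R3) < ⊤ := by
    rw [← union_compl_self (closedBall (0 : R3) R)]
    exact (measure_union_le _ _).trans_lt (ENNReal.add_lt_top.2 ⟨measure_closedBall_lt_top, h1⟩)
  simp at h2

/-- A function with Hölder bounds near infinity has a limit there. -/
lemma exists_tendsto_atTop_of_holder {g : ℝ → ℝ} {a : ℝ}
    (hg : ∀ s r, 0 < s → s ≤ r → (g r - g s) ^ 2 ≤ a * (1 / s - 1 / r)) :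
    ∃ l, Tendsto g atTop (𝓝 l) := by
  have ha : 0 ≤ a := by
    have h1 := hg 1 2 one_pos one_le_two
    have h2 := sq_nonneg (g 2 - g 1)
    norm_num at h1
    linarith
  refine cauchy_map_iff_exists_tendsto.1 ?_
  rw [Metric.cauchy_iff]
  refine ⟨inferInstance, fun ε hε => ?_⟩
  have hlim : Tendsto (fun s : ℝ => √(a * (1 / s))) atTop (𝓝 0) := by
    have h1 : Tendsto (fun s : ℝ => a * (1 / s)) atTop (𝓝 (a * 0)) :=
      (tendsto_const_nhds.div_atTop tendsto_id).const_mul a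
    simpa using h1.sqrt
  obtain ⟨R, hR, hR0⟩ := ((hlim.eventually_lt_const (show 0 < ε / 2 by positivity)).and
    (eventually_gt_atTop 0)).exists
  have key : ∀ r, R ≤ r → |g r - g R| < ε / 2 := fun r hr => by
    refine lt_of_le_of_lt (Real.abs_le_sqrt (hg R r hR0 hr)) (lt_of_le_of_lt ?_ hR)
    have : 0 ≤ 1 / r := by have := hR0.trans_le hr; positivity
    gcongr
    linarith
  refine ⟨g '' Ici R, image_mem_map (Ici_mem_atTop R), ?_⟩
  rintro _ ⟨x, hx, rfl⟩ _ ⟨y, hy, rfl⟩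
  have h1 := abs_lt.1 (key x hx)
  have h2 := abs_lt.1 (key y hy)
  rw [Real.dist_eq, abs_lt]
  constructor <;> linarith

section Profile

variable {u : R3 → ℝ} {G : R3 → R3} {g₀ : ℝ → ℝ}

/-- Mollifications of a radial function converge pointwise away from the origin. -/
lemma exists_tendsto_mollify (hu : LocallyIntegrable u) (hG : MemLp G 2) (hw : IsWeakGradient u G)
    (hr : u =ᵐ[volume] fun x => g₀ ‖x‖) :
    ∃ g : ℝ → ℝ, Measurable g ∧
      ∀ r, 0 < r → Tendsto (fun n => mollify n u (r • unitVec)) atTop (𝓝 (g r)) := by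
  have hs := fun n => isRadialSmooth_mollify n hu hG hw hr
  have hc : ∀ r : ℝ, 0 < r → CauchySeq fun n => mollify n u (r • unitVec) := by
    intro r hr0
    have hγ : ∀ (n : ℕ) (s r : ℝ), 0 < s → s ≤ r →
        (mollify n u (r • unitVec) - mollify n u (s • unitVec)) ^ 2 ≤
          (∫ x, ‖G x‖ ^ 2) / sphereArea * (1 / s - 1 / r) := fun n s r h h' =>
      (hs n).holder (gradient_mollify_energy n hu hG hw).2 h h'
    refine cauchySeq_of_holder (γ := fun n r => mollify n u (r • unitVec)) hγ ?_ r hr0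
    intro s r h1 h2
    -- Convergence holds almost everywhere, hence at some point of every annulus; the uniform Hölder
    -- bound carries it to all radii.
    obtain ⟨x, hx, hx1, hx2⟩ := exists_norm_mem_of_ae (ae_tendsto_mollify hu) h1.le h2
    refine ⟨‖x‖, hx1, hx2, ?_⟩
    simp only [← (hs _).eq_profile x]
    exact hx.cauchySeq
  choose! g hg using fun r h => cauchySeq_tendsto_of_complete (hc r h)
  -- Cutting off at `r ≤ 0` makes the convergence hold at every real number, so that the limit is
  -- measurable.
  refine ⟨(Ioi 0).indicator g, ?_, fun r h => by rw [indicator_of_mem (mem_Ioi.2 h)]; exact hg r h⟩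
  refine measurable_of_tendsto_metrizable
    (f := fun n => (Ioi (0 : ℝ)).indicator fun r => mollify n u (r • unitVec)) (fun n => ?_) ?_
  · exact (((hs n).smooth.continuous.comp
      (continuous_id.smul continuous_const)).measurable).indicator measurableSet_Ioi
  · rw [tendsto_pi_nhds]
    intro r
    by_cases h : r ∈ Ioi (0 : ℝ)
    · simpa only [indicator_of_mem h] using hg r h
    · simp only [indicator_of_notMem h]; exact tendsto_const_nhds

end Profile

/-- Fatou on `(1/(k+1), k+1)`, then exhaustion of the half-line. In the limit the boundary term `2 r
g(r)²` is at most `2a`, whence `6a = 2a + 4a`. -/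
lemma lintegral_sq_le_of_hardy {γ : ℕ → ℝ → ℝ} {g : ℝ → ℝ} {a : ℝ} (hgm : Measurable g)
    (hc : ∀ n, Continuous (γ n)) (hg : ∀ r, 0 < r → Tendsto (fun n => γ n r) atTop (𝓝 (g r)))
    (hh' : ∀ n s r, 0 < s → s ≤ r → ∫ t in s..r, γ n t ^ 2 ≤ 2 * r * γ n r ^ 2 + 4 * a)
    (hdecay : ∀ r, 0 < r → g r ^ 2 ≤ a / r) :
    ∫⁻ t in Ioi (0 : ℝ), ENNReal.ofReal (g t ^ 2) ≤ ENNReal.ofReal (6 * a) := by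
  have hh : ∀ k : ℕ, ∫⁻ t in Ioo (1 / (k + 1 : ℝ)) (k + 1), ENNReal.ofReal (g t ^ 2) ≤
      ENNReal.ofReal (6 * a) := by
    intro k
    have hs0 : (0 : ℝ) < 1 / (k + 1 : ℝ) := by positivity
    have hsr : 1 / (k + 1 : ℝ) ≤ k + 1 := by
      rw [div_le_iff₀ (by positivity)]; nlinarith [(Nat.cast_nonneg k : (0 : ℝ) ≤ k)]
    have hfat : ∫⁻ t in Ioo (1 / (k + 1 : ℝ)) (k + 1), ENNReal.ofReal (g t ^ 2) ≤
        liminf (fun n => ∫⁻ t in Ioo (1 / (k + 1 : ℝ)) (k + 1),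
          ENNReal.ofReal (γ n t ^ 2)) atTop := by
      refine le_trans (le_of_eq ?_) (lintegral_liminf_le' (fun n => ?_))
      · refine setLIntegral_congr_fun measurableSet_Ioo fun t ht => ?_
        exact ((ENNReal.continuous_ofReal.tendsto _).comp
          ((hg t (hs0.trans ht.1)).pow 2)).liminf_eq.symm
      · have := (hc n).measurable
        exact Measurable.aemeasurable (by fun_prop)
    refine hfat.trans ?_
    have hlim : Tendsto (fun n => ENNReal.ofReal
        (2 * (k + 1 : ℝ) * γ n (k + 1) ^ 2 + 4 * a)) atTop
        (𝓝 (ENNReal.ofReal (2 * (k + 1 : ℝ) * g (k + 1) ^ 2 + 4 * a))) :=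
      (ENNReal.continuous_ofReal.tendsto _).comp
        ((((hg (k + 1) (by positivity)).pow 2).const_mul _).add_const _)
    refine (liminf_le_liminf (Eventually.of_forall fun n => ?_)).trans
      (hlim.liminf_eq.trans_le (ENNReal.ofReal_le_ofReal ?_))
    · have hci : Continuous fun t : ℝ => γ n t ^ 2 := (hc n).pow 2
      rw [← ofReal_integral_eq_lintegral_ofReal
        ((hci.integrableOn_Icc).mono_set Ioo_subset_Icc_self) (ae_of_all _ fun t => by positivity),
        ← integral_Ioc_eq_integral_Ioo, ← intervalIntegral.integral_of_le hsr]
      exact ENNReal.ofReal_le_ofReal (hh' n _ _ hs0 hsr)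
    · have := hdecay (k + 1) (by positivity)
      rw [le_div_iff₀ (by positivity)] at this
      linarith
  have hcov : AECover (volume.restrict (Ioi (0 : ℝ))) atTop
      (fun k : ℕ => Ioo (1 / (k + 1 : ℝ)) (k + 1)) := by
    refine (aecover_Ioi_of_Ioi tendsto_one_div_add_atTop_nhds_zero_nat).inter
      ((aecover_Iio (μ := volume) (tendsto_natCast_atTop_atTop.atTop_add tendsto_const_nhds)).mono_ac ?_)
    exact Measure.restrict_le_self.absolutelyContinuous
  refine le_of_tendsto' (hcov.lintegral_tendsto_of_countably_generated
    (hgm.pow_const 2).ennreal_ofReal.aemeasurable) fun k => (lintegral_mono' ?_ le_rfl).trans (hh k)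
  exact Measure.restrict_mono' (by rfl) Measure.restrict_le_self

/-- The radial Sobolev inequality: `t² g⁶ = (t g²)² g² ≤ a² g²`, so decay and Hardy suffice. Its
role is to keep limits of bounded sequences in `L⁶`. -/
lemma lintegral_pow_six_le {u : R3 → ℝ} {g : ℝ → ℝ} {a : ℝ} (hgm : Measurable g)
    (hae : u =ᵐ[volume] fun x => g ‖x‖) (hdecay : ∀ r, 0 < r → g r ^ 2 ≤ a / r)
    (hall : ∫⁻ t in Ioi (0 : ℝ), ENNReal.ofReal (g t ^ 2) ≤ ENNReal.ofReal (6 * a)) :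
    ∫⁻ x, ‖u x‖ₑ ^ 6 ≤ ENNReal.ofReal (6 * sphereArea * a ^ 3) := by
  have e1 : ∫⁻ x, ‖u x‖ₑ ^ 6 = ∫⁻ x : R3, (fun t => ENNReal.ofReal (g t ^ 6)) ‖x‖ := by
    refine lintegral_congr_ae ?_
    filter_upwards [hae] with x hx
    rw [hx, Real.enorm_eq_ofReal_abs, ← ENNReal.ofReal_pow (abs_nonneg _),
      Even.pow_abs (by decide)]
  rw [e1, lintegral_radial (hgm.pow_const 6).ennreal_ofReal]
  calc ENNReal.ofReal sphereArea * ∫⁻ t in Ioi (0 : ℝ), ENNReal.ofReal (t ^ 2) *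
        ENNReal.ofReal (g t ^ 6)
      ≤ ENNReal.ofReal sphereArea * ∫⁻ t in Ioi (0 : ℝ), ENNReal.ofReal (a ^ 2) *
        ENNReal.ofReal (g t ^ 2) := by
        gcongr ENNReal.ofReal sphereArea * ?_
        refine setLIntegral_mono' measurableSet_Ioi fun t ht => ?_
        have ht : 0 < t := ht
        rw [← ENNReal.ofReal_mul (by positivity), ← ENNReal.ofReal_mul (by positivity)]
        refine ENNReal.ofReal_le_ofReal ?_
        have h1 := hdecay t ht
        rw [le_div_iff₀ ht] at h1
        have h2 : (g t ^ 2 * t) ^ 2 ≤ a ^ 2 := by gcongr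
        nlinarith [mul_le_mul_of_nonneg_right h2 (sq_nonneg (g t))]
    _ ≤ ENNReal.ofReal sphereArea * (ENNReal.ofReal (a ^ 2) * ENNReal.ofReal (6 * a)) := by
        rw [lintegral_const_mul _ (hgm.pow_const 2).ennreal_ofReal]
        gcongr
    _ = _ := by
        rw [← ENNReal.ofReal_mul (by positivity), ← ENNReal.ofReal_mul sphereArea_pos.le]
        congr 1
        ring

/-- The main facts on a radial function in `D^{1,2}`. -/
structure HasProfile (u : R3 → ℝ) (G : R3 → R3) (g : ℝ → ℝ) : Prop where
  isProfile : IsProfile ((∫ x, ‖G x‖ ^ 2) / sphereArea) g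
  ae_eq : u =ᵐ[volume] fun x => g ‖x‖
  sobolev : ∫⁻ x, ‖u x‖ₑ ^ 6 ≤
    ENNReal.ofReal (6 * sphereArea * ((∫ x, ‖G x‖ ^ 2) / sphereArea) ^ 3)
  tendsto : ∀ x : R3, x ≠ 0 → Tendsto (fun n => mollify n u x) atTop (𝓝 (g ‖x‖))
  bound : ∀ R, ∃ C, ∀ n, ∀ x : R3, x ≠ 0 → ‖x‖ ≤ R →
    |mollify n u x| ≤ C * (1 + ‖x‖ ^ (-(1 / 2 : ℝ)))

lemma ae_ne_zero : ∀ᵐ x : R3, x ≠ 0 := by simp [ae_iff]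

/-- The estimates hold for the mollifications uniformly in `n` and pass to their pointwise limit.
Beyond local integrability, `u ∈ L⁶` serves only to make `g` vanish at infinity; sending the outer
radius of the Hölder bound to infinity then gives the decay. -/
theorem exists_hasProfile {u : R3 → ℝ} {G : R3 → R3} {g₀ : ℝ → ℝ} (hu6 : MemLp u 6)
    (hG : MemLp G 2) (hw : IsWeakGradient u G) (hr : u =ᵐ[volume] fun x => g₀ ‖x‖) :
    ∃ g, HasProfile u G g := by
  have hu : LocallyIntegrable u := hu6.locallyIntegrable (by norm_num)
  obtain ⟨g, hgm, hg⟩ := exists_tendsto_mollify hu hG hw hr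
  have hs := fun n => isRadialSmooth_mollify n hu hG hw hr
  have hE := fun n => gradient_mollify_energy n hu hG hw
  set a := (∫ x, ‖G x‖ ^ 2) / sphereArea with ha
  have ha0 : 0 ≤ a := div_nonneg (integral_nonneg fun x => by positivity) sphereArea_pos.le
  have htend : ∀ x : R3, x ≠ 0 → Tendsto (fun n => mollify n u x) atTop (𝓝 (g ‖x‖)) := by
    intro x hx
    simp only [(hs _).eq_profile x]
    exact hg _ (norm_pos_iff.2 hx)
  have hae : u =ᵐ[volume] fun x => g ‖x‖ := by
    filter_upwards [ae_tendsto_mollify hu, ae_ne_zero] with x h1 h2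
    exact tendsto_nhds_unique h1 (htend x h2)
  have hholder : ∀ s r, 0 < s → s ≤ r → (g r - g s) ^ 2 ≤ a * (1 / s - 1 / r) := by
    intro s r h1 h2
    exact le_of_tendsto' (((hg r (h1.trans_le h2)).sub (hg s h1)).pow 2)
      fun n => (hs n).holder (hE n).2 h1 h2
  obtain ⟨l, hl⟩ := exists_tendsto_atTop_of_holder hholder
  obtain rfl := tendsto_zero_of_lintegral_lt_top hu6 hae hl
  have hdecay : ∀ r, 0 < r → g r ^ 2 ≤ a / r := by
    intro r h
    have h1 : Tendsto (fun t => (g t - g r) ^ 2) atTop (𝓝 ((0 - g r) ^ 2)) :=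
      (hl.sub tendsto_const_nhds).pow 2
    rw [zero_sub, neg_sq] at h1
    refine le_of_tendsto h1 ?_
    filter_upwards [eventually_ge_atTop r] with t ht
    refine (hholder r t h ht).trans ?_
    have : 0 ≤ 1 / t := by have := h.trans_le ht; positivity
    rw [div_eq_mul_one_div a r]
    gcongr
    linarith
  have hbound : ∀ R, ∃ C, ∀ n, ∀ x : R3, x ≠ 0 → ‖x‖ ≤ R →
      |mollify n u x| ≤ C * (1 + ‖x‖ ^ (-(1 / 2 : ℝ))) := by
    intro R
    -- A positive reference radius: the values there converge, hence are bounded in `n`, and the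
    -- Hölder bound controls all smaller radii.
    set R' := max R 1
    have hR' : 0 < R' := lt_of_lt_of_le one_pos (le_max_right _ _)
    obtain ⟨B, hB⟩ := (hg R' hR').abs.bddAbove_range
    refine ⟨max B (√a), fun n x hx hxR => ?_⟩
    have hx0 : 0 < ‖x‖ := norm_pos_iff.2 hx
    have h1 := Real.abs_le_sqrt ((hs n).holder (hE n).2 hx0 (hxR.trans (le_max_left R 1)))
    have h2 : √(a * (1 / ‖x‖ - 1 / R')) ≤ √a * ‖x‖ ^ (-(1 / 2 : ℝ)) := by
      rw [← sqrt_div_le_mul_rpow ha0 hx0.le, div_eq_mul_one_div a]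
      have : 0 ≤ 1 / R' := by positivity
      exact Real.sqrt_le_sqrt (mul_le_mul_of_nonneg_left (by linarith) ha0)
    have h3 : |mollify n u (R' • unitVec)| ≤ B := hB ⟨n, rfl⟩
    rw [(hs n).eq_profile x]
    have h4 : 0 ≤ ‖x‖ ^ (-(1 / 2 : ℝ)) := by positivity
    calc |mollify n u (‖x‖ • unitVec)|
        ≤ |mollify n u (R' • unitVec)| +
          |mollify n u (R' • unitVec) - mollify n u (‖x‖ • unitVec)| := by
          have := abs_sub_abs_le_abs_sub (mollify n u (‖x‖ • unitVec)) (mollify n u (R' • unitVec))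
          rw [abs_sub_comm] at this
          linarith
      _ ≤ B + √a * ‖x‖ ^ (-(1 / 2 : ℝ)) := add_le_add h3 (h1.trans h2)
      _ ≤ max B (√a) * 1 + max B (√a) * ‖x‖ ^ (-(1 / 2 : ℝ)) := by
          gcongr
          · simp
          · exact le_max_right _ _
      _ = _ := by ring
  refine ⟨g, ⟨hgm, hholder, hdecay⟩, hae, ?_, htend, hbound⟩
  refine lintegral_pow_six_le hgm hae hdecay (lintegral_sq_le_of_hardy hgm
    (γ := fun n t => mollify n u (t • unitVec)) (fun n => ?_) hg
    (fun n s r h1 h2 => (hs n).hardy (hE n).2 h1 h2) hdecay)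
  exact (hs n).smooth.continuous.comp (continuous_id.smul continuous_const)

/-! ### Estimates for radial functions of finite Coulomb energy -/

/-- The annulus `r < |x| ≤ s`. -/
def annulus (r s : ℝ) : Set R3 := (fun x => ‖x‖) ⁻¹' Ioc r s

lemma mem_annulus {r s : ℝ} {x : R3} : x ∈ annulus r s ↔ r < ‖x‖ ∧ ‖x‖ ≤ s := Iff.rfl

lemma measurableSet_annulus (r s : ℝ) : MeasurableSet (annulus r s) :=
  measurable_norm measurableSet_Ioc

lemma annulus_mono {r s s' : ℝ} (h : s ≤ s') : annulus r s ⊆ annulus r s' :=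
  preimage_mono (Ioc_subset_Ioc_right h)

lemma measureReal_annulus {r s : ℝ} (hr : 0 ≤ r) (hrs : r ≤ s) :
    volume.real (annulus r s) = sphereArea / 3 * (s ^ 3 - r ^ 3) := by
  have e : annulus r s = closedBall (0 : R3) s \ closedBall 0 r := by
    ext x
    simp only [mem_annulus, Set.mem_sdiff, mem_closedBall_zero_iff, not_le]
    tauto
  rw [e, measureReal_sdiff (closedBall_subset_closedBall hrs) measurableSet_closedBall
    (measure_closedBall_lt_top.ne), Measure.addHaar_real_closedBall _ _ (hr.trans hrs),
    Measure.addHaar_real_closedBall _ _ hr, sphereArea]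
  simp only [finrank_euclideanSpace, Fintype.card_fin]
  ring

lemma measure_annulus_ne_top (r s : ℝ) : volume (annulus r s) ≠ ⊤ :=
  ((measure_mono fun _ hx => mem_closedBall_zero_iff.2 (mem_annulus.1 hx).2).trans_lt
    (measure_closedBall_lt_top (x := (0 : R3)) (r := s))).ne

/-- Both points lie in a ball of radius `2r`, so `1 ≤ 4r / |x - y|` and the product of the two
integrals is part of the Coulomb energy. -/
lemma sq_lintegral_annulus_le {u : R3 → ℝ} (hu : AEMeasurable u) {r : ℝ} (hr : 0 < r) :
    (∫⁻ x in annulus r (2 * r), ENNReal.ofReal (u x ^ 2)) ^ 2 ≤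
      ENNReal.ofReal (4 * r) * coulombEnergy u := by
  have hm : AEMeasurable (fun x => ENNReal.ofReal (u x ^ 2)) := (hu.pow_const 2).ennreal_ofReal
  rw [sq, coulombEnergy, ← lintegral_const_mul' _ _ ENNReal.ofReal_ne_top,
    ← lintegral_mul_const'' _ hm.restrict]
  refine le_trans ?_ (setLIntegral_le_lintegral (annulus r (2 * r)) _)
  refine setLIntegral_mono_ae' (measurableSet_annulus _ _) (ae_of_all _ fun x hx => ?_)
  rw [← lintegral_const_mul' _ _ ENNReal.ofReal_ne_top,
    ← lintegral_const_mul' _ _ ENNReal.ofReal_ne_top]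
  refine le_trans ?_ (setLIntegral_le_lintegral (annulus r (2 * r)) _)
  have hne : ∀ᵐ y : R3, y ≠ x := by simp [ae_iff]
  refine setLIntegral_mono_ae' (measurableSet_annulus _ _) ?_
  filter_upwards [hne] with y hyx hy
  rw [← ENNReal.ofReal_mul (by positivity), ← ENNReal.ofReal_mul (by positivity)]
  refine ENNReal.ofReal_le_ofReal ?_
  have hp : 0 < ‖x - y‖ := norm_pos_iff.2 (sub_ne_zero.2 hyx.symm)
  have hle : ‖x - y‖ ≤ 4 * r := by
    have := norm_sub_le x y
    have h1 := (mem_annulus.1 hx).2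
    have h2 := (mem_annulus.1 hy).2
    linarith
  rw [mul_div_assoc', le_div_iff₀ hp]
  have : 0 ≤ u x ^ 2 * u y ^ 2 := by positivity
  nlinarith

lemma lintegral_annulus_le {u : R3 → ℝ} (hu : AEMeasurable u) {r M : ℝ} (hr : 0 < r) (hM : 0 ≤ M)
    (hc : coulombEnergy u ≤ ENNReal.ofReal M) :
    ∫⁻ x in annulus r (2 * r), ENNReal.ofReal (u x ^ 2) ≤ ENNReal.ofReal (2 * √(r * M)) := by
  have h1 := (sq_lintegral_annulus_le hu hr).trans (mul_le_mul_right hc _)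
  rw [← ENNReal.ofReal_mul (by positivity)] at h1
  have e : 4 * r * M = (2 * √(r * M)) ^ 2 := by
    rw [mul_pow, Real.sq_sqrt (by positivity)]; ring
  rw [e, ENNReal.ofReal_pow (by positivity)] at h1
  exact (ENNReal.pow_le_pow_left_iff two_ne_zero).1 h1

/-- The data on a radial function used in the estimates. -/
structure RadialBound (u : R3 → ℝ) (g : ℝ → ℝ) (M : ℝ) : Prop where
  pos : 0 < M
  profile : IsProfile (M / sphereArea) g
  ae_eq : u =ᵐ[volume] fun x => g ‖x‖
  coulomb : coulombEnergy u ≤ ENNReal.ofReal M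

namespace RadialBound

variable {u : R3 → ℝ} {g : ℝ → ℝ} {M : ℝ}

lemma measurable_comp (h : RadialBound u g M) : Measurable fun x : R3 => g ‖x‖ :=
  h.profile.measurable.comp measurable_norm

lemma aemeasurable (h : RadialBound u g M) : AEMeasurable u :=
  h.measurable_comp.aemeasurable.congr h.ae_eq.symm

lemma lintegral_annulus_le (h : RadialBound u g M) {r : ℝ} (hr : 0 < r) :
    ∫⁻ x in annulus r (2 * r), ENNReal.ofReal (g ‖x‖ ^ 2) ≤ ENNReal.ofReal (2 * √(r * M)) := by
  refine CoulombSobolev.lintegral_annulus_le h.measurable_comp.aemeasurable hr h.pos.le ?_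
  rw [← coulombEnergy_congr h.ae_eq]
  exact h.coulomb

/-- Average `g(r)² ≤ 2 g(|x|)² + 2 (g(|x|) - g(r))²` over the shell `r < |x| ≤ r + w`, of volume at
least `ω r² w`. The first term is controlled by the Coulomb energy, since `w ≤ r` keeps the shell in
the dyadic annulus; the second is at most `2 (M/ω) w / r²` by the Hölder bound. -/
lemma sq_le_aux (h : RadialBound u g M) {r w : ℝ} (hr : 0 < r) (hw : 0 < w) (hwr : w ≤ r) :
    g r ^ 2 ≤ 4 * √(r * M) / (sphereArea * r ^ 2 * w) + 2 * (M / sphereArea) * w / r ^ 2 := by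
  have hω := sphereArea_pos
  set c := (M / sphereArea) * w / r ^ 2
  have hM := h.pos
  have hc : 0 ≤ c := by positivity
  set V := volume.real (annulus r (r + w)) with hV
  have hVle : sphereArea * r ^ 2 * w ≤ V := by
    rw [hV, measureReal_annulus hr.le (by linarith)]
    have : 0 ≤ sphereArea / 3 * (3 * r * w ^ 2 + w ^ 3) := by positivity
    nlinarith
  have hV0 : 0 < V := lt_of_lt_of_le (by positivity) hVle
  have hVe : volume (annulus r (r + w)) = ENNReal.ofReal V := by
    rw [hV, ofReal_measureReal (measure_annulus_ne_top _ _)]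
  have hpt : ∀ x ∈ annulus r (r + w), ENNReal.ofReal (g r ^ 2) ≤
      ENNReal.ofReal 2 * ENNReal.ofReal (g ‖x‖ ^ 2) + ENNReal.ofReal (2 * c) := by
    intro x hx
    rw [← ENNReal.ofReal_mul (by norm_num), ← ENNReal.ofReal_add (by positivity) (by positivity)]
    refine ENNReal.ofReal_le_ofReal ?_
    have hx1 := (mem_annulus.1 hx).1
    have hx2 := (mem_annulus.1 hx).2
    have h1 := h.profile.holder r ‖x‖ hr hx1.le
    have h2 : 1 / r - 1 / ‖x‖ ≤ w / r ^ 2 := by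
      have hx0 := hr.trans hx1
      rw [div_sub_div _ _ hr.ne' hx0.ne', div_le_div_iff₀ (by positivity) (by positivity)]
      have : r * (‖x‖ - r) ≤ ‖x‖ * w := by nlinarith
      nlinarith
    have h3 : (g ‖x‖ - g r) ^ 2 ≤ c := by
      refine h1.trans ((mul_le_mul_of_nonneg_left h2 (by positivity)).trans (le_of_eq ?_))
      simp only [c]; ring
    nlinarith [sq_nonneg (g r - 2 * g ‖x‖)]
  have h1 : ENNReal.ofReal (g r ^ 2 * V) ≤ ENNReal.ofReal (2 * (2 * √(r * M)) + 2 * c * V) := by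
    have hm : Measurable fun x : R3 => ENNReal.ofReal (g ‖x‖ ^ 2) :=
      (h.measurable_comp.pow_const 2).ennreal_ofReal
    calc ENNReal.ofReal (g r ^ 2 * V) = ∫⁻ _ in annulus r (r + w), ENNReal.ofReal (g r ^ 2) := by
          rw [setLIntegral_const, hVe, ENNReal.ofReal_mul (by positivity)]
      _ ≤ ∫⁻ x in annulus r (r + w), (ENNReal.ofReal 2 * ENNReal.ofReal (g ‖x‖ ^ 2) +
            ENNReal.ofReal (2 * c)) := setLIntegral_mono' (measurableSet_annulus _ _) hpt
      _ = ENNReal.ofReal 2 * (∫⁻ x in annulus r (r + w), ENNReal.ofReal (g ‖x‖ ^ 2)) +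
            ENNReal.ofReal (2 * c * V) := by
          rw [lintegral_add_right _ measurable_const, lintegral_const_mul _ hm, setLIntegral_const,
            hVe, ENNReal.ofReal_mul (by positivity : 0 ≤ 2 * c)]
      _ ≤ ENNReal.ofReal 2 * ENNReal.ofReal (2 * √(r * M)) + ENNReal.ofReal (2 * c * V) := by
          gcongr
          exact (lintegral_mono_set (annulus_mono (by linarith))).trans (h.lintegral_annulus_le hr)
      _ = _ := by
          rw [← ENNReal.ofReal_mul (by norm_num), ← ENNReal.ofReal_add (by positivity) (by positivity)]
  have h2 := (ENNReal.ofReal_le_ofReal_iff (by positivity)).1 h1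
  have h3 : g r ^ 2 ≤ 4 * √(r * M) / V + 2 * c := by
    rw [← sub_le_iff_le_add, le_div_iff₀ hV0]
    linarith
  refine h3.trans (add_le_add ?_ (le_of_eq ?_))
  · gcongr
  · simp only [c]; ring

/-- Pointwise decay of radial functions in `E`. -/
lemma sq_le (h : RadialBound u g M) {r : ℝ} (hr : 0 < r) (hrM : 1 ≤ r ^ 3 * M) :
    g r ^ 2 ≤ 6 / sphereArea * (r ^ (-(7 / 4) : ℝ) * M ^ (3 / 4 : ℝ)) := by
  have hω := sphereArea_pos
  have hM := h.pos
  -- With `r = q⁴` and `M = m⁴` all the powers involved become integral.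
  obtain ⟨q, hq, rfl⟩ : ∃ q : ℝ, 0 < q ∧ q ^ 4 = r := ⟨r ^ (1 / 4 : ℝ), by positivity, by
    rw [← Real.rpow_natCast, ← Real.rpow_mul hr.le]; norm_num⟩
  obtain ⟨m, hm, rfl⟩ : ∃ m : ℝ, 0 < m ∧ m ^ 4 = M := ⟨M ^ (1 / 4 : ℝ), by positivity, by
    rw [← Real.rpow_natCast, ← Real.rpow_mul hM.le]; norm_num⟩
  have e1 : (q ^ 4) ^ (-(7 / 4) : ℝ) = (q ^ 7)⁻¹ := by
    rw [← Real.rpow_natCast, ← Real.rpow_mul hq.le, ← Real.rpow_natCast, ← Real.rpow_neg hq.le]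
    norm_num
  have e2 : (m ^ 4) ^ (3 / 4 : ℝ) = m ^ 3 := by
    rw [← Real.rpow_natCast, ← Real.rpow_mul hm.le, ← Real.rpow_natCast]
    norm_num
  have e3 : √(q ^ 4 * m ^ 4) = q ^ 2 * m ^ 2 := by
    rw [show q ^ 4 * m ^ 4 = (q ^ 2 * m ^ 2) ^ 2 by ring, Real.sqrt_sq (by positivity)]
  have hqm : 1 ≤ q ^ 3 * m := by
    by_contra hcon
    have : (q ^ 3 * m) ^ 4 < 1 := pow_lt_one₀ (by positivity) (not_le.1 hcon) (by norm_num)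
    nlinarith
  -- The width `w = q/m = (r/M)^(1/4)` makes the two terms of `sq_le_aux` comparable, and `w ≤ r`
  -- amounts to `r³ M ≥ 1`.
  have hw : q / m ≤ q ^ 4 := by
    rw [div_le_iff₀ hm]; nlinarith
  refine (h.sq_le_aux hr (by positivity) hw).trans (le_of_eq ?_)
  rw [e1, e2, e3]
  field_simp
  ring

end RadialBound

namespace RadialBound

variable {u : R3 → ℝ} {g : ℝ → ℝ} {M p : ℝ}

/-- Interpolation `|g|^p = (g²)^((p-2)/2) g²` between the pointwise decay and the `L²` bound on the
annulus. The power of `r` is negative exactly when `p > 18/7`. -/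
lemma lintegral_annulus_rpow_le (h : RadialBound u g M) (hp : 2 < p) {r : ℝ} (hr : 0 < r)
    (hrM : 1 ≤ r ^ 3 * M) :
    ∫⁻ x in annulus r (2 * r), ENNReal.ofReal (|g ‖x‖| ^ p) ≤
      ENNReal.ofReal (2 * (6 / sphereArea) ^ ((p - 2) / 2) *
        (r ^ (-(7 * (p - 2) / 8 - 1 / 2)) * M ^ (3 * (p - 2) / 8 + 1 / 2))) := by
  have hω := sphereArea_pos
  have hM := h.pos
  set B := 6 / sphereArea * (r ^ (-(7 / 4) : ℝ) * M ^ (3 / 4 : ℝ))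
  have hB : 0 ≤ B := by positivity
  have hpt : ∀ x ∈ annulus r (2 * r), ENNReal.ofReal (|g ‖x‖| ^ p) ≤
      ENNReal.ofReal (B ^ ((p - 2) / 2)) * ENNReal.ofReal (g ‖x‖ ^ 2) := by
    intro x hx
    have hx1 := (mem_annulus.1 hx).1
    have hx0 := hr.trans hx1
    rw [← ENNReal.ofReal_mul (by positivity)]
    refine ENNReal.ofReal_le_ofReal ?_
    have h1 : g ‖x‖ ^ 2 ≤ B := by
      refine (h.sq_le hx0 (hrM.trans ?_)).trans ?_
      · gcongr
      · simp only [B]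
        gcongr 6 / sphereArea * (?_ * M ^ (3 / 4 : ℝ))
        exact Real.rpow_le_rpow_of_nonpos hr hx1.le (by norm_num)
    have e : |g ‖x‖| ^ p = (g ‖x‖ ^ 2) ^ ((p - 2) / 2) * g ‖x‖ ^ 2 := by
      rw [← sq_abs, ← Real.rpow_natCast, ← Real.rpow_mul (abs_nonneg _),
        ← Real.rpow_add_of_nonneg (abs_nonneg _) (by norm_num; linarith) (by norm_num)]
      congr 1
      push_cast; ring
    rw [e]
    gcongr
  refine (setLIntegral_mono' (measurableSet_annulus _ _) hpt).trans ?_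
  rw [lintegral_const_mul _ (h.measurable_comp.pow_const 2).ennreal_ofReal]
  refine (mul_le_mul_right (h.lintegral_annulus_le hr) _).trans (le_of_eq ?_)
  rw [← ENNReal.ofReal_mul (by positivity)]
  congr 1
  simp only [B]
  rw [Real.mul_rpow (by positivity) (by positivity), Real.mul_rpow (by positivity) (by positivity),
    ← Real.rpow_mul hr.le, ← Real.rpow_mul hM.le, Real.sqrt_mul hr.le, Real.sqrt_eq_rpow,
    Real.sqrt_eq_rpow, show -(7 * (p - 2) / 8 - 1 / 2) = -(7 / 4) * ((p - 2) / 2) + 1 / 2 by ring,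
    show 3 * (p - 2) / 8 + 1 / 2 = 3 / 4 * ((p - 2) / 2) + 1 / 2 by ring,
    Real.rpow_add hr, Real.rpow_add hM]
  ring

end RadialBound

lemma subset_iUnion_annulus {R : ℝ} (hR : 0 < R) :
    {x : R3 | R < ‖x‖} ⊆ ⋃ k : ℕ, annulus (2 ^ k * R) (2 * (2 ^ k * R)) := by
  intro x hx
  have hx : R < ‖x‖ := hx
  obtain ⟨n, hn1, hn2⟩ := exists_mem_Ioc_zpow (x := ‖x‖ / R) (y := 2)
    (div_pos (hR.trans hx) hR) one_lt_two
  have hn : 0 ≤ n := by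
    by_contra hcon
    have h1 : (2 : ℝ) ^ (n + 1) ≤ 1 := zpow_le_one_of_nonpos₀ one_le_two (by omega)
    have h2 : 1 < ‖x‖ / R := (one_lt_div hR).2 hx
    linarith
  lift n to ℕ using hn
  refine mem_iUnion.2 ⟨n, mem_annulus.2 ⟨?_, ?_⟩⟩
  · rw [lt_div_iff₀ hR] at hn1; exact_mod_cast hn1
  · rw [div_le_iff₀ hR, zpow_add₀ (by norm_num)] at hn2
    norm_cast at hn2 ⊢
    push_cast at hn2 ⊢
    linarith

def tailConst (p : ℝ) : ℝ :=
  2 * (6 / sphereArea) ^ ((p - 2) / 2) * (1 - 2 ^ (-(7 * (p - 2) / 8 - 1 / 2)))⁻¹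

lemma two_rpow_lt_one {p : ℝ} (hp : 18 / 7 < p) : (2 : ℝ) ^ (-(7 * (p - 2) / 8 - 1 / 2)) < 1 :=
  Real.rpow_lt_one_of_one_lt_of_neg one_lt_two (by linarith)

lemma tailConst_pos {p : ℝ} (hp : 18 / 7 < p) : 0 < tailConst p := by
  have := sphereArea_pos
  have h1 := sub_pos.2 (two_rpow_lt_one hp)
  unfold tailConst
  positivity

lemma lintegral_geometric_annulus_le {f : R3 → ℝ≥0∞} {c q R : ℝ} (hR : 0 < R) (hc : 0 ≤ c)
    (hq : 0 ≤ q) (hq1 : q < 1)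
    (hf : ∀ k : ℕ, ∫⁻ x in annulus (2 ^ k * R) (2 * (2 ^ k * R)), f x ≤ ENNReal.ofReal (c * q ^ k)) :
    ∫⁻ x in {x : R3 | R < ‖x‖}, f x ≤ ENNReal.ofReal (c * (1 - q)⁻¹) := by
  refine (lintegral_mono_set (subset_iUnion_annulus hR)).trans ((lintegral_iUnion_le _ _).trans
    ((ENNReal.tsum_le_tsum hf).trans (le_of_eq ?_)))
  rw [← ENNReal.ofReal_tsum_of_nonneg (fun k => by positivity)
    ((summable_geometric_of_lt_one hq hq1).mul_left c), tsum_mul_left,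
    tsum_geometric_of_lt_one hq hq1]

namespace RadialBound

variable {u : R3 → ℝ} {g : ℝ → ℝ} {M p : ℝ}

/-- The tail estimate in `Lᵖ`. -/
lemma lintegral_tail_le (h : RadialBound u g M) (hp : 18 / 7 < p) {R : ℝ} (hR : 0 < R)
    (hRM : 1 ≤ R ^ 3 * M) :
    ∫⁻ x in {x : R3 | R < ‖x‖}, ENNReal.ofReal (|g ‖x‖| ^ p) ≤
      ENNReal.ofReal (tailConst p * (R ^ (-(7 * (p - 2) / 8 - 1 / 2)) *
        M ^ (3 * (p - 2) / 8 + 1 / 2))) := by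
  have hω := sphereArea_pos
  have hM := h.pos
  refine (lintegral_geometric_annulus_le (c := 2 * (6 / sphereArea) ^ ((p - 2) / 2) *
    (R ^ (-(7 * (p - 2) / 8 - 1 / 2)) * M ^ (3 * (p - 2) / 8 + 1 / 2)))
    (q := 2 ^ (-(7 * (p - 2) / 8 - 1 / 2))) hR (by positivity) (by positivity)
    (two_rpow_lt_one hp) fun k => ?_).trans (le_of_eq ?_)
  · refine (h.lintegral_annulus_rpow_le (by linarith) (by positivity) ?_).trans (le_of_eq ?_)
    · refine hRM.trans ?_
      gcongr
      exact le_mul_of_one_le_left hR.le (one_le_pow₀ one_le_two)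
    · congr 1
      rw [Real.mul_rpow (by positivity) hR.le, ← Real.rpow_natCast 2 k, ← Real.rpow_mul (by norm_num),
        mul_comm (k : ℝ), Real.rpow_mul (by norm_num), Real.rpow_natCast]
      ring
  · congr 1
    unfold tailConst
    ring

/-- The estimate in `Lᵖ` near the origin. -/
lemma lintegral_inner_le (h : RadialBound u g M) (hp : 0 < p) (hp6 : p < 6) {R : ℝ} (hR : 0 ≤ R) :
    ∫⁻ x in ball (0 : R3) R, ENNReal.ofReal (|g ‖x‖| ^ p) ≤
      ENNReal.ofReal ((M / sphereArea) ^ (p / 2) *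
        (sphereArea * (R ^ (3 - p / 2) / (3 - p / 2)))) := by
  have hω := sphereArea_pos
  have hM := h.pos
  rw [← integral_norm_rpow (by linarith) hR, ENNReal.ofReal_mul (by positivity),
    ofReal_integral_eq_lintegral_ofReal (integrableOn_norm_rpow (by linarith) R)
      (ae_of_all _ fun x => by positivity),
    ← lintegral_const_mul' _ _ ENNReal.ofReal_ne_top]
  refine lintegral_mono_ae (ae_restrict_of_ae ?_)
  filter_upwards [ae_ne_zero] with x hx
  have hx0 : 0 < ‖x‖ := norm_pos_iff.2 hx
  rw [← ENNReal.ofReal_mul (by positivity)]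
  refine ENNReal.ofReal_le_ofReal ?_
  have h1 := h.profile.decay ‖x‖ hx0
  have e : |g ‖x‖| ^ p = (g ‖x‖ ^ 2) ^ (p / 2) := by
    rw [← sq_abs, ← Real.rpow_natCast, ← Real.rpow_mul (abs_nonneg _)]
    congr 1
    push_cast; ring
  rw [e, Real.rpow_neg hx0.le, ← div_eq_mul_inv, ← Real.div_rpow (by positivity) hx0.le]
  gcongr

end RadialBound

def lpConst (p : ℝ) : ℝ :=
  (1 / sphereArea) ^ (p / 2) * (sphereArea / (3 - p / 2)) + tailConst p

lemma lpConst_pos {p : ℝ} (hp : 18 / 7 < p) (hp6 : p < 6) : 0 < lpConst p := by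
  have := sphereArea_pos
  have h1 := tailConst_pos hp
  have h2 : 0 < 3 - p / 2 := by linarith
  unfold lpConst
  positivity

/-- The embedding into `Lᵖ` with the right scaling. -/
lemma RadialBound.lintegral_rpow_le {u : R3 → ℝ} {g : ℝ → ℝ} {M p : ℝ} (h : RadialBound u g M)
    (hp : 18 / 7 < p) (hp6 : p < 6) :
    ∫⁻ x, ENNReal.ofReal (|u x| ^ p) ≤ ENNReal.ofReal (lpConst p * M ^ ((2 * p - 3) / 3)) := by
  have hω := sphereArea_pos
  have hM := h.pos
  have h3 : 0 < 3 - p / 2 := by linarith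
  have e0 : ∫⁻ x, ENNReal.ofReal (|u x| ^ p) = ∫⁻ x : R3, ENNReal.ofReal (|g ‖x‖| ^ p) := by
    refine lintegral_congr_ae ?_
    filter_upwards [h.ae_eq] with x hx
    rw [hx]
  rw [e0]
  -- This is the smallest radius allowed by `R³ M ≥ 1`; it makes the inner and the outer
  -- contributions the same power of `M`.
  set R := M ^ (-(1 / 3) : ℝ) with hR
  have hR0 : 0 < R := by positivity
  have hRM : R ^ 3 * M = 1 := by
    rw [hR, ← Real.rpow_natCast, ← Real.rpow_mul hM.le]
    norm_num [Real.rpow_neg_one, hM.ne']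
  have hs : ∀ᵐ x : R3, x ∈ ball (0 : R3) R ∪ {x : R3 | R < ‖x‖} := by
    have : volume (sphere (0 : R3) R) = 0 := Measure.addHaar_sphere _ _ _
    filter_upwards [measure_eq_zero_iff_ae_notMem.1 this] with x hx
    simp only [mem_sphere, dist_zero_right] at hx
    rcases lt_or_gt_of_ne hx with h | h
    · exact Or.inl (by simpa using h)
    · exact Or.inr h
  rw [← setLIntegral_univ, ← setLIntegral_congr (eventuallyEq_univ.2 hs)]
  refine (lintegral_union_le _ _ _).trans
    ((add_le_add (h.lintegral_inner_le (by linarith) hp6 hR0.le)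
      (h.lintegral_tail_le hp hR0 hRM.ge)).trans (le_of_eq ?_))
  have ht := tailConst_pos hp
  rw [← ENNReal.ofReal_add (by positivity) (by positivity), hR, ← Real.rpow_mul hM.le,
    ← Real.rpow_mul hM.le, ← Real.rpow_add hM, div_eq_mul_one_div M,
    Real.mul_rpow hM.le (by positivity), lpConst]
  congr 1
  have e1 : M ^ (p / 2) * M ^ (-(1 / 3) * (3 - p / 2)) = M ^ ((2 * p - 3) / 3) := by
    rw [← Real.rpow_add hM]; congr 1; ring
  have e2 : -(1 / 3) * -(7 * (p - 2) / 8 - 1 / 2) + (3 * (p - 2) / 8 + 1 / 2) = (2 * p - 3) / 3 := by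
    ring
  rw [e2, ← e1]
  ring

/-! ### The spaces `E` and `E_r` -/

lemma gradEnergy_eq {u : R3 → ℝ} {G : R3 → R3} (hG : MemLp G 2) (hw : IsWeakGradient u G) :
    gradEnergy u = ∫ x, ‖G x‖ ^ 2 := by
  have h : HasL2Gradient u := ⟨G, hG, hw⟩
  refine integral_congr_ae ?_
  filter_upwards [IsWeakGradient.ae_eq (memLp_weakGrad h) hG (isWeakGradient_weakGrad h) hw]
    with x hx
  rw [hx]

lemma gradEnergy_nonneg (u : R3 → ℝ) : 0 ≤ gradEnergy u := integral_nonneg fun x => by positivity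

lemma exists_mem_E {f : R3 → ℝ} {G : R3 → R3} (hf : MemLp f 6) (hG : MemLp G 2)
    (hw : IsWeakGradient f G) (hc : coulombEnergy f < ⊤) : ∃ v : E, v.1 =ᵐ[volume] f := by
  have h0 : AEEqFun.mk f hf.1 =ᵐ[volume] f := AEEqFun.coeFn_mk f hf.1
  refine ⟨⟨AEEqFun.mk f hf.1, ⟨(memLp_congr_ae h0).2 hf, G, hG, hw.congr h0.symm⟩, ?_⟩, h0⟩
  rwa [coulombEnergy_congr h0]

lemma exists_mem_Er {f : R3 → ℝ} {G : R3 → R3} {g : ℝ → ℝ} (hg : Measurable g)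
    (hfg : f =ᵐ[volume] fun x => g ‖x‖) (hf : MemLp f 6) (hG : MemLp G 2)
    (hw : IsWeakGradient f G) (hc : coulombEnergy f < ⊤) : ∃ v : Er, v.1.1 =ᵐ[volume] f := by
  obtain ⟨v, hv⟩ := exists_mem_E hf hG hw hc
  exact ⟨⟨v, g, hg, hv.trans hfg⟩, hv⟩

lemma exists_hasProfile_Er (v : Er) : ∃ g, HasProfile v.1.1 (weakGrad v.1.1) g := by
  obtain ⟨g, -, hg⟩ := v.2
  exact exists_hasProfile v.1.2.1.1 (memLp_weakGrad v.1.2.1.2) (isWeakGradient_weakGrad v.1.2.1.2) hg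

/-- The continuous profile of a radial function. -/
def profile (v : Er) : ℝ → ℝ := (exists_hasProfile_Er v).choose

lemma hasProfile (v : Er) : HasProfile v.1.1 (weakGrad v.1.1) (profile v) :=
  (exists_hasProfile_Er v).choose_spec

/-- The Coulomb energy as a real number. -/
def coulomb (v : Er) : ℝ := (coulombEnergy v.1.1).toReal

lemma coulomb_nonneg (v : Er) : 0 ≤ coulomb v := ENNReal.toReal_nonneg

lemma ofReal_coulomb (v : Er) : ENNReal.ofReal (coulomb v) = coulombEnergy v.1.1 :=
  ENNReal.ofReal_toReal v.1.2.2.ne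

lemma IsProfile.mono {a b : ℝ} {g : ℝ → ℝ} (h : IsProfile a g) (hab : a ≤ b) : IsProfile b g where
  measurable := h.measurable
  holder s r hs hr := (h.holder s r hs hr).trans (mul_le_mul_of_nonneg_right hab
    (sub_nonneg.2 (one_div_le_one_div_of_le hs hr)))
  decay r hr := (h.decay r hr).trans (by gcongr)

/-- The summand `1` makes `M` positive even for `v = 0`. It also gives `M ≥ 1`, so that the tail
estimate is available for every radius `R ≥ 1`. -/
lemma radialBound (v : Er) {M : ℝ} (hM : gradEnergy v.1.1 + coulomb v + 1 ≤ M) :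
    RadialBound v.1.1 (profile v) M := by
  have h1 := gradEnergy_nonneg v.1.1
  have h2 := coulomb_nonneg v
  refine ⟨by linarith, (hasProfile v).isProfile.mono ?_, (hasProfile v).ae_eq, ?_⟩
  · have : (∫ x, ‖weakGrad v.1.1 x‖ ^ 2) ≤ M := by
      change gradEnergy v.1.1 ≤ M; linarith
    gcongr
    exact sphereArea_pos.le
  · rw [← ofReal_coulomb]
    exact ENNReal.ofReal_le_ofReal (by linarith)

/-! ### The `Lᵖ` bound and coercivity. -/

lemma integrable_rpow (v : Er) {p : ℝ} (hp : 18 / 7 < p) (hp6 : p < 6) :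
    Integrable fun x => |v.1.1 x| ^ p := by
  refine ⟨(v.1.1.aestronglyMeasurable.norm.aemeasurable.pow_const p).aestronglyMeasurable, ?_⟩
  have := (radialBound v le_rfl).lintegral_rpow_le hp hp6
  rw [hasFiniteIntegral_iff_ofReal (ae_of_all _ fun x => by positivity)]
  exact this.trans_lt ENNReal.ofReal_lt_top

lemma integral_rpow_le (v : Er) {p : ℝ} (hp : 18 / 7 < p) (hp6 : p < 6) :
    ∫ x, |v.1.1 x| ^ p ≤
      lpConst p * (gradEnergy v.1.1 + coulomb v + 1) ^ ((2 * p - 3) / 3) := by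
  have hb := radialBound v le_rfl
  have := hb.lintegral_rpow_le hp hp6
  rw [← ofReal_integral_eq_lintegral_ofReal (integrable_rpow v hp hp6)
    (ae_of_all _ fun x => by positivity)] at this
  have h1 := hb.pos
  have h2 := lpConst_pos hp hp6
  exact (ENNReal.ofReal_le_ofReal_iff (by positivity)).1 this

/-- A sublinear power is absorbed by `M / 8` beyond the threshold `M₀`, where `c M₀^θ = M₀ / 8`. -/
lemma exists_rpow_le_linear {c θ : ℝ} (hc : 0 < c) (h0 : 0 < θ) (h1 : θ < 1) :
    ∃ K, ∀ M : ℝ, 0 < M → c * M ^ θ ≤ M / 8 + K := by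
  set M₀ := (8 * c) ^ (1 / (1 - θ)) with hM₀
  have hM₀p : 0 < M₀ := by positivity
  refine ⟨c * M₀ ^ θ, fun M hM => ?_⟩
  rcases le_total M M₀ with h | h
  · have : c * M ^ θ ≤ c * M₀ ^ θ := by gcongr
    linarith
  · have e : M₀ ^ (1 - θ) = 8 * c := by
      rw [hM₀, ← Real.rpow_mul (by positivity), one_div_mul_cancel (by linarith), Real.rpow_one]
    have h2 : 8 * c ≤ M ^ (1 - θ) := by
      rw [← e]
      have : 0 ≤ 1 - θ := by linarith
      gcongr
    have h3 : M = M ^ (1 - θ) * M ^ θ := by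
      rw [← Real.rpow_add hM]; simp
    have h4 : 0 < M ^ θ := by positivity
    have h5 : 0 ≤ c * M₀ ^ θ := by positivity
    nlinarith

/-- The coercivity estimate. -/
lemma exists_le_J {p : ℝ} (hp : 18 / 7 < p) (hp3 : p < 3) :
    ∃ C, ∀ v : Er, (gradEnergy v.1.1 + coulomb v) / 8 - C ≤ J p v := by
  -- Here `p < 3` is decisive: it is the condition `(2p - 3)/3 < 1`.
  obtain ⟨K, hK⟩ := exists_rpow_le_linear (c := 1 / p * lpConst p) (θ := (2 * p - 3) / 3)
    (mul_pos (by positivity) (lpConst_pos hp (by linarith))) (by linarith) (by linarith)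
  refine ⟨1 / 8 + K, fun v => ?_⟩
  have h1 := gradEnergy_nonneg v.1.1
  have h2 := coulomb_nonneg v
  have h3 := hK (gradEnergy v.1.1 + coulomb v + 1) (by linarith)
  have h4 := mul_le_mul_of_nonneg_left (integral_rpow_le v hp (by linarith))
    (show 0 ≤ 1 / p by positivity)
  have e : J p v = 1 / 2 * gradEnergy v.1.1 + 1 / 4 * coulomb v - 1 / p * ∫ x, |v.1.1 x| ^ p := rfl
  rw [e]
  rw [← mul_assoc] at h4
  linarith

/-- The norm contains the square root of the Coulomb energy, and `√d ≤ d + 1`. -/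
lemma norm_sq_le (v : Er) : ‖v‖ ^ 2 ≤ gradEnergy v.1.1 + coulomb v + 1 := by
  have e : ‖v‖ = √(gradEnergy v.1.1 + √(coulomb v)) := rfl
  rw [e, Real.sq_sqrt (add_nonneg (gradEnergy_nonneg _) (Real.sqrt_nonneg _))]
  have h1 := Real.sq_sqrt (coulomb_nonneg v)
  nlinarith [sq_nonneg (√(coulomb v) - 1), Real.sqrt_nonneg (coulomb v)]

lemma gradEnergy_le_norm_sq (v : Er) : gradEnergy v.1.1 ≤ ‖v‖ ^ 2 := by
  have e : ‖v‖ = √(gradEnergy v.1.1 + √(coulomb v)) := rfl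
  rw [e, Real.sq_sqrt (add_nonneg (gradEnergy_nonneg _) (Real.sqrt_nonneg _))]
  linarith [Real.sqrt_nonneg (coulomb v)]

theorem tendsto_J_cobounded {p : ℝ} (hp : 18 / 7 < p) (hp3 : p < 3) :
    Tendsto (J p) (Bornology.cobounded Er) atTop := by
  obtain ⟨C, hC⟩ := exists_le_J hp hp3
  have h1 : Tendsto (fun v : Er => ‖v‖ ^ 2 / 8 + (-1 / 8 - C)) (Bornology.cobounded Er) atTop :=
    tendsto_atTop_add_const_right _ _
      (((tendsto_pow_atTop two_ne_zero).comp tendsto_norm_cobounded_atTop).atTop_div_const (by norm_num))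
  refine tendsto_atTop_mono (fun v => ?_) h1
  have := hC v
  have := norm_sq_le v
  linarith

/-! ### Compactness -/

lemma coulombEnergy_le_liminf {f : ℕ → R3 → ℝ} {f' : R3 → ℝ} (hf : ∀ n, Measurable (f n))
    (hl : ∀ᵐ x, Tendsto (fun n => f n x) atTop (𝓝 (f' x))) :
    coulombEnergy f' ≤ liminf (fun n => coulombEnergy (f n)) atTop := by
  have hM : ∀ n, Measurable (fun w : R3 × R3 =>
      ENNReal.ofReal (f n w.1 ^ 2 * f n w.2 ^ 2 / ‖w.1 - w.2‖)) := fun n => by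
    have := hf n; fun_prop
  unfold coulombEnergy
  refine le_trans ?_ (lintegral_liminf_le fun n => (hM n).lintegral_prod_right')
  refine lintegral_mono_ae ?_
  filter_upwards [hl] with x hx
  refine le_trans (le_of_eq ?_) (lintegral_liminf_le fun n => (hM n).comp measurable_prodMk_left)
  refine lintegral_congr_ae ?_
  filter_upwards [hl] with y hy
  exact ((ENNReal.continuous_ofReal.tendsto _).comp
    (((hx.pow 2).mul (hy.pow 2)).div_const _)).liminf_eq.symm

lemma IsProfile.nonneg {a : ℝ} {g : ℝ → ℝ} (h : IsProfile a g) : 0 ≤ a := by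
  have h1 := h.decay 1 one_pos
  have h2 := sq_nonneg (g 1)
  rw [div_one] at h1
  linarith

lemma IsProfile.abs_le {a : ℝ} {g : ℝ → ℝ} (h : IsProfile a g) {r : ℝ} (hr : 0 < r) :
    |g r| ≤ √a * r ^ (-(1 / 2 : ℝ)) := by
  rw [← sqrt_div_le_mul_rpow h.nonneg hr.le]
  exact Real.abs_le_sqrt (h.decay r hr)

lemma IsProfile.ae_abs_le {a : ℝ} {g : ℝ → ℝ} (h : IsProfile a g) :
    ∀ᵐ x : R3, |g ‖x‖| ≤ √a * (1 + ‖x‖ ^ (-(1 / 2 : ℝ))) := by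
  filter_upwards [ae_ne_zero] with x hx
  refine (h.abs_le (norm_pos_iff.2 hx)).trans ?_
  gcongr
  linarith

lemma IsProfile.continuousOn {a : ℝ} {g : ℝ → ℝ} (h : IsProfile a g) : ContinuousOn g (Ioi 0) := by
  intro r hr
  have hr : 0 < r := hr
  refine ContinuousAt.continuousWithinAt ?_
  rw [ContinuousAt, tendsto_iff_dist_tendsto_zero]
  have hlim : Tendsto (fun s : ℝ => √(a * |1 / s - 1 / r|)) (𝓝 r) (𝓝 0) := by
    have : ContinuousAt (fun s : ℝ => √(a * |1 / s - 1 / r|)) r := by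
      have := hr.ne'
      fun_prop (disch := assumption)
    simpa [ContinuousAt] using this
  refine squeeze_zero' (Eventually.of_forall fun _ => dist_nonneg) ?_ hlim
  filter_upwards [lt_mem_nhds hr] with s hs
  rw [Real.dist_eq]
  refine Real.abs_le_sqrt ?_
  rcases le_total s r with h1 | h1
  · rw [← neg_sub, neg_sq]
    exact (h.holder s r hs h1).trans (mul_le_mul_of_nonneg_left (le_abs_self _) h.nonneg)
  · rw [abs_sub_comm]
    exact (h.holder r s hr h1).trans (mul_le_mul_of_nonneg_left (le_abs_self _) h.nonneg)

lemma exists_limit_profile {g : ℕ → ℝ → ℝ} {a : ℝ} (hg : ∀ n, IsProfile a (g n))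
    (hq : ∀ q : ℚ, 0 < (q : ℝ) → CauchySeq fun n => g n q) :
    ∃ g' : ℝ → ℝ, IsProfile a g' ∧ ∀ r, 0 < r → Tendsto (fun n => g n r) atTop (𝓝 (g' r)) := by
  have hc : ∀ r : ℝ, 0 < r → CauchySeq fun n => g n r := by
    refine cauchySeq_of_holder (fun n => (hg n).holder) fun s r hs hsr => ?_
    obtain ⟨q, h1, h2⟩ := exists_rat_btwn hsr
    exact ⟨q, h1, h2, hq q (hs.trans h1)⟩
  choose! g' hg' using fun r h => cauchySeq_tendsto_of_complete (hc r h)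
  have key : ∀ r, 0 < r → Tendsto (fun n => g n r) atTop (𝓝 ((Ioi 0).indicator g' r)) :=
    fun r h => by rw [indicator_of_mem (mem_Ioi.2 h)]; exact hg' r h
  refine ⟨(Ioi 0).indicator g', ⟨?_, fun s r hs hr => ?_, fun r hr => ?_⟩, key⟩
  · refine measurable_of_tendsto_metrizable (f := fun n => (Ioi (0 : ℝ)).indicator (g n))
      (fun n => (hg n).measurable.indicator measurableSet_Ioi) (tendsto_pi_nhds.2 fun r => ?_)
    by_cases h : r ∈ Ioi (0 : ℝ)
    · simpa only [indicator_of_mem h] using hg' r h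
    · simp only [indicator_of_notMem h]; exact tendsto_const_nhds
  · exact le_of_tendsto' (((key r (hs.trans_le hr)).sub (key s hs)).pow 2)
      fun n => (hg n).holder s r hs hr
  · exact le_of_tendsto' ((key r hr).pow 2) fun n => (hg n).decay r hr

/-- Compactness of a countable product of intervals, indexed by the positive rational radii and the
two energies, replaces a diagonal argument. The Hölder bound extends convergence from rational to
all positive radii. -/
lemma exists_subseq_tendsto {e d : ℕ → ℝ} {g : ℕ → ℝ → ℝ} {M a : ℝ} (he : ∀ n, e n ∈ Icc 0 M)
    (hd : ∀ n, d n ∈ Icc 0 M) (hg : ∀ n, IsProfile a (g n)) :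
    ∃ s : ℕ → ℕ, StrictMono s ∧ (∃ e', Tendsto (e ∘ s) atTop (𝓝 e')) ∧
      (∃ d', Tendsto (d ∘ s) atTop (𝓝 d')) ∧ ∃ g' : ℝ → ℝ, IsProfile a g' ∧
        ∀ r, 0 < r → Tendsto (fun n => g (s n) r) atTop (𝓝 (g' r)) := by
  set B : ℚ → ℝ := fun q => √a * (q : ℝ) ^ (-(1 / 2 : ℝ))
  let z : ℕ → ℝ × ℝ × (ℚ → ℝ) := fun n => (e n, d n, fun q => if 0 < (q : ℝ) then g n q else 0)
  have hK : IsCompact (Icc (0 : ℝ) M ×ˢ (Icc (0 : ℝ) M ×ˢ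
      (univ.pi fun q : ℚ => Icc (-|B q|) |B q|))) :=
    isCompact_Icc.prod (isCompact_Icc.prod (isCompact_univ_pi fun q => isCompact_Icc))
  have hz : ∀ n, z n ∈ Icc (0 : ℝ) M ×ˢ (Icc (0 : ℝ) M ×ˢ
      (univ.pi fun q : ℚ => Icc (-|B q|) |B q|)) := by
    intro n
    refine ⟨he n, hd n, fun q _ => ?_⟩
    simp only [z]
    split_ifs with h
    · exact abs_le.1 (((hg n).abs_le h).trans (le_abs_self _))
    · simp
  obtain ⟨z', -, s, hs, hlim⟩ := hK.tendsto_subseq hz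
  have h1 := (continuous_fst.tendsto z').comp hlim
  have h2 := ((continuous_fst.comp continuous_snd).tendsto z').comp hlim
  have h3 : ∀ q : ℚ, Tendsto (fun n => (z (s n)).2.2 q) atTop (𝓝 (z'.2.2 q)) := fun q =>
    (((continuous_apply q).comp (continuous_snd.comp continuous_snd)).tendsto z').comp hlim
  refine ⟨s, hs, ⟨_, h1⟩, ⟨_, h2⟩, exists_limit_profile (fun n => hg (s n)) fun q hq => ?_⟩
  have := h3 q
  simp only [z, if_pos hq] at this
  exact this.cauchySeq

lemma integrableOn_norm_rpow_closedBall {s : ℝ} (hs : s < 3) (R : ℝ) :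
    IntegrableOn (fun x : R3 => ‖x‖ ^ (-s)) (closedBall 0 R) :=
  (integrableOn_norm_rpow hs (R + 1)).mono_set (closedBall_subset_ball (by linarith))

/-- Dominated convergence with majorant `a^(p/2) ‖x‖^(-p/2)`, locally integrable because `p < 6`. -/
lemma tendsto_setIntegral_rpow {g : ℕ → ℝ → ℝ} {g' : ℝ → ℝ} {a p : ℝ} (hp : 0 < p) (hp6 : p < 6)
    (hg : ∀ n, IsProfile a (g n))
    (hl : ∀ r, 0 < r → Tendsto (fun n => g n r) atTop (𝓝 (g' r))) (R : ℝ) :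
    Tendsto (fun n => ∫ x in closedBall (0 : R3) R, |g n ‖x‖| ^ p) atTop
      (𝓝 (∫ x in closedBall (0 : R3) R, |g' ‖x‖| ^ p)) := by
  refine tendsto_integral_of_dominated_convergence (fun x => √a ^ p * ‖x‖ ^ (-(p / 2)))
    (fun n => ?_) ((integrableOn_norm_rpow_closedBall (by linarith) R).const_mul _) (fun n => ?_) ?_
  · have := (hg n).measurable
    exact Measurable.aestronglyMeasurable (by fun_prop)
  · filter_upwards [ae_restrict_of_ae ae_ne_zero] with x hx
    have hx0 := norm_pos_iff.2 hx
    rw [Real.norm_of_nonneg (by positivity)]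
    refine (Real.rpow_le_rpow (abs_nonneg _) ((hg n).abs_le hx0) hp.le).trans (le_of_eq ?_)
    rw [Real.mul_rpow (by positivity) (by positivity), ← Real.rpow_mul hx0.le]
    congr 2
    ring
  · filter_upwards [ae_restrict_of_ae ae_ne_zero] with x hx
    exact ((hl _ (norm_pos_iff.2 hx)).abs).rpow_const (Or.inr hp.le)

lemma tendsto_integral_profile {F : Type*} [NormedAddCommGroup F] [NormedSpace ℝ F]
    {g : ℕ → ℝ → ℝ} {g' : ℝ → ℝ} {a : ℝ} (hg : ∀ n, IsProfile a (g n))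
    (hl : ∀ r, 0 < r → Tendsto (fun n => g n r) atTop (𝓝 (g' r))) {Φ : R3 → F}
    (hΦ : AEStronglyMeasurable Φ) {B R : ℝ} (hB : ∀ x, ‖Φ x‖ ≤ B) (h0 : ∀ x, R < ‖x‖ → Φ x = 0) :
    Tendsto (fun n => ∫ x, g n ‖x‖ • Φ x) atTop (𝓝 (∫ x, g' ‖x‖ • Φ x)) := by
  refine tendsto_integral_smul_of_bound (f := fun n x => g n ‖x‖) (C := √a) hΦ hB h0
    (fun n => ((hg n).measurable.comp measurable_norm).aestronglyMeasurable) (fun n => ?_) ?_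
  · filter_upwards [(hg n).ae_abs_le] with x hx _ using hx
  · filter_upwards [ae_ne_zero] with x hx using hl _ (norm_pos_iff.2 hx)

lemma memLp_six_of_lintegral {f : R3 → ℝ} (hm : AEStronglyMeasurable f)
    (h : ∫⁻ x, ‖f x‖ₑ ^ 6 < ⊤) : MemLp f 6 := by
  refine ⟨hm, (eLpNorm_lt_top_iff_lintegral_rpow_enorm_lt_top (by norm_num) (by norm_num)).2 ?_⟩
  simpa using h

lemma exists_Er_limit {v : ℕ → Er} {M : ℝ} (hM : ∀ n, gradEnergy (v n).1.1 + coulomb (v n) + 1 ≤ M)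
    {g' : ℝ → ℝ} (hg' : IsProfile (M / sphereArea) g') {e d : ℝ}
    (hl : ∀ r, 0 < r → Tendsto (fun n => profile (v n) r) atTop (𝓝 (g' r)))
    (he : Tendsto (fun n => gradEnergy (v n).1.1) atTop (𝓝 e))
    (hd : Tendsto (fun n => coulomb (v n)) atTop (𝓝 d)) :
    ∃ w : Er, w.1.1 =ᵐ[volume] (fun x => g' ‖x‖) ∧ gradEnergy w.1.1 ≤ e ∧ coulomb w ≤ d := by
  have hω := sphereArea_pos
  have hb := fun n => radialBound (v n) (hM n)
  have hM0 : 0 ≤ M := (hb 0).pos.le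
  set f : R3 → ℝ := fun x => g' ‖x‖ with hf
  have hfm : Measurable f := hg'.measurable.comp measurable_norm
  have hae : ∀ᵐ x : R3, Tendsto (fun n => profile (v n) ‖x‖) atTop (𝓝 (f x)) := by
    filter_upwards [ae_ne_zero] with x hx using hl _ (norm_pos_iff.2 hx)
  have h6 : MemLp f 6 := by
    refine memLp_six_of_lintegral hfm.aestronglyMeasurable
      (lt_of_le_of_lt ?_ (ENNReal.ofReal_lt_top (r := 6 * sphereArea * (M / sphereArea) ^ 3)))
    have h1 : ∫⁻ x, ‖f x‖ₑ ^ 6 ≤ liminf (fun n => ∫⁻ x : R3, ‖profile (v n) ‖x‖‖ₑ ^ 6) atTop := by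
      refine le_trans (le_of_eq ?_) (lintegral_liminf_le fun n => ?_)
      · refine lintegral_congr_ae ?_
        filter_upwards [hae] with x hx
        exact ((ENNReal.continuous_pow 6).tendsto _ |>.comp hx.enorm).liminf_eq.symm
      · have := (hb n).measurable_comp
        fun_prop
    refine h1.trans ((liminf_le_liminf (Eventually.of_forall fun n => ?_)).trans
      (tendsto_const_nhds.liminf_eq.le))
    have e1 : ∫⁻ x : R3, ‖profile (v n) ‖x‖‖ₑ ^ 6 = ∫⁻ x, ‖(v n).1.1 x‖ₑ ^ 6 := by
      refine lintegral_congr_ae ?_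
      filter_upwards [(hb n).ae_eq] with x hx
      rw [hx]
    rw [e1]
    refine (hasProfile (v n)).sobolev.trans (ENNReal.ofReal_le_ofReal ?_)
    have h2 : (∫ x, ‖weakGrad (v n).1.1 x‖ ^ 2) ≤ M := by
      change gradEnergy (v n).1.1 ≤ M
      linarith [hM n, coulomb_nonneg (v n)]
    have h3 : 0 ≤ ∫ x, ‖weakGrad (v n).1.1 x‖ ^ 2 := gradEnergy_nonneg _
    gcongr
  have hD : coulombEnergy f ≤ ENNReal.ofReal d := by
    refine (coulombEnergy_le_liminf (fun n => (hb n).measurable_comp) hae).trans ?_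
    have : ∀ n, coulombEnergy (fun x => profile (v n) ‖x‖) = ENNReal.ofReal (coulomb (v n)) :=
      fun n => by rw [ofReal_coulomb, coulombEnergy_congr (hb n).ae_eq]
    simp only [this]
    exact ((ENNReal.continuous_ofReal.tendsto _).comp hd).liminf_eq.le
  -- For every `A > e` a tail of the sequence has Dirichlet energy at most `A`, and so has a weak
  -- limit of its gradients. By uniqueness of the weak gradient, `A` can then decrease to `e`.
  have hG : ∀ A, e < A → ∃ H : R3 → R3, MemLp H 2 ∧ ∫ x, ‖H x‖ ^ 2 ≤ A ∧ IsWeakGradient f H := by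
    intro A hA
    obtain ⟨N, hN⟩ := eventually_atTop.1 (he.eventually_le_const hA)
    obtain ⟨H, h1, h2, h3⟩ := exists_weakGradient_of_tendsto (v := f)
      (u := fun n x => profile (v (n + N)) ‖x‖)
      (G := fun n => weakGrad (v (n + N)).1.1) (A := A)
      (fun n => memLp_weakGrad (v (n + N)).1.2.1.2) (fun n => hN (n + N) (by omega))
      (fun n => (isWeakGradient_weakGrad (v (n + N)).1.2.1.2).congr (hb (n + N)).ae_eq) (by
        intro φ hφ hc
        obtain ⟨B, R, hB, h0⟩ := exists_bound_of_hasCompactSupport (continuous_gradient hφ)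
          (hasCompactSupport_gradient hc)
        exact tendsto_integral_profile (fun n => (hb (n + N)).profile)
          (fun r hr => (hl r hr).comp (tendsto_add_atTop_nat N))
          (continuous_gradient hφ).aestronglyMeasurable hB h0)
    exact ⟨H, h1, h2, h3⟩
  obtain ⟨H, hH, -, hHw⟩ := hG (e + 1) (by linarith)
  obtain ⟨w, hw⟩ := exists_mem_Er hg'.measurable (ae_eq_refl _) h6 hH hHw
    (hD.trans_lt ENNReal.ofReal_lt_top)
  refine ⟨w, hw, le_of_forall_gt_imp_ge_of_dense fun A hA => ?_, ?_⟩
  · obtain ⟨H', hH', hA', hHw'⟩ := hG A hA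
    rw [gradEnergy_eq hH' (hHw'.congr hw.symm)]
    exact hA'
  · have hd0 : 0 ≤ d := ge_of_tendsto' hd fun n => coulomb_nonneg _
    rw [coulomb, coulombEnergy_congr hw]
    exact ENNReal.toReal_le_of_le_ofReal hd0 hD

lemma setIntegral_tail_le (v : Er) {M p : ℝ} (hM : gradEnergy v.1.1 + coulomb v + 1 ≤ M)
    (hp : 18 / 7 < p) (hp6 : p < 6) {R : ℝ} (hR : 1 ≤ R) :
    ∫ x, |v.1.1 x| ^ p ≤ (∫ x in closedBall (0 : R3) R, |profile v ‖x‖| ^ p) +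
      tailConst p * (R ^ (-(7 * (p - 2) / 8 - 1 / 2)) * M ^ (3 * (p - 2) / 8 + 1 / 2)) := by
  have hb := radialBound v hM
  have hM1 : 1 ≤ M := by
    linarith [gradEnergy_nonneg v.1.1, coulomb_nonneg v]
  have hi := integrable_rpow v hp hp6
  have e : (fun x => |v.1.1 x| ^ p) =ᵐ[volume] fun x => |profile v ‖x‖| ^ p := by
    filter_upwards [hb.ae_eq] with x hx
    rw [hx]
  have hi' := hi.congr e
  rw [integral_congr_ae e, ← integral_add_compl measurableSet_closedBall hi']
  gcongr
  have ht := hb.lintegral_tail_le hp (R := R) (by linarith) (by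
    have : 1 ≤ R ^ 3 := one_le_pow₀ hR
    nlinarith)
  have hs : (closedBall (0 : R3) R)ᶜ = {x : R3 | R < ‖x‖} := by
    ext x
    rw [mem_compl_iff, mem_closedBall_zero_iff, not_le]
    rfl
  rw [hs]
  rw [← ofReal_integral_eq_lintegral_ofReal hi'.integrableOn (ae_of_all _ fun x => by positivity)] at ht
  have h1 := tailConst_pos hp
  exact (ENNReal.ofReal_le_ofReal_iff (by positivity)).1 ht

/-- Sublevel sets of `J` are sequentially compact, in a weak sense. -/
theorem exists_limit {p : ℝ} (hp : 18 / 7 < p) (hp3 : p < 3) {v : ℕ → Er} {c : ℕ → ℝ} {c₀ : ℝ}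
    (hJ : ∀ n, J p (v n) ≤ c n) (hc : Tendsto c atTop (𝓝 c₀)) :
    ∃ w : Er, J p w ≤ c₀ ∧ ∃ s : ℕ → ℕ, StrictMono s ∧ ∀ R : ℝ,
      Tendsto (fun n => ∫ x in closedBall (0 : R3) R, (v (s n)).1.1 x) atTop
        (𝓝 (∫ x in closedBall (0 : R3) R, w.1.1 x)) := by
  obtain ⟨C, hC⟩ := exists_le_J hp hp3
  obtain ⟨c', hc'⟩ := hc.bddAbove_range
  -- Coercivity turns `J ≤ c'` into a bound `8 (c' + C)` for the sum of the two energies.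
  set M := 8 * (c' + C) + 1 with hMdef
  have hM : ∀ n, gradEnergy (v n).1.1 + coulomb (v n) + 1 ≤ M := by
    intro n
    have h1 := hC (v n)
    have h2 := hJ n
    have h3 : c n ≤ c' := hc' ⟨n, rfl⟩
    linarith
  obtain ⟨s, hs, ⟨e, he⟩, ⟨d, hd⟩, g', hg', hl⟩ := exists_subseq_tendsto
    (e := fun n => gradEnergy (v n).1.1) (d := fun n => coulomb (v n))
    (g := fun n => profile (v n)) (M := M) (a := M / sphereArea)
    (fun n => ⟨gradEnergy_nonneg _, by linarith [hM n, coulomb_nonneg (v n)]⟩)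
    (fun n => ⟨coulomb_nonneg _, by linarith [hM n, gradEnergy_nonneg (v n).1.1]⟩)
    (fun n => (radialBound (v n) (hM n)).profile)
  have hb := fun n => radialBound (v (s n)) (hM (s n))
  obtain ⟨w, hw, hwe, hwd⟩ := exists_Er_limit (v := fun n => v (s n)) (fun n => hM (s n)) hg' hl he hd
  have hM0 : 0 < M := (hb 0).pos
  refine ⟨w, ?_, s, hs, fun R => ?_⟩
  · set τ : ℝ → ℝ := fun R =>
      tailConst p * (R ^ (-(7 * (p - 2) / 8 - 1 / 2)) * M ^ (3 * (p - 2) / 8 + 1 / 2)) with hτ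
    have hτ0 : Tendsto τ atTop (𝓝 0) := by
      have h1 := tendsto_rpow_neg_atTop (show 0 < 7 * (p - 2) / 8 - 1 / 2 by linarith)
      have h2 := (h1.mul_const (M ^ (3 * (p - 2) / 8 + 1 / 2))).const_mul (tailConst p)
      rwa [zero_mul, mul_zero] at h2
    -- For fixed `R` the integral over the ball converges, while the tail is at most `τ R` for every
    -- `n`; only afterwards does `R` tend to infinity.
    have key : ∀ R, 1 ≤ R → J p w - 1 / p * τ R ≤ c₀ := by
      intro R hR
      have hp0 : 0 < 1 / p := by positivity
      have h1 : Tendsto (fun n => 1 / 2 * gradEnergy (v (s n)).1.1 + 1 / 4 * coulomb (v (s n)) -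
          1 / p * ((∫ x in closedBall (0 : R3) R, |profile (v (s n)) ‖x‖| ^ p) + τ R)) atTop
          (𝓝 (1 / 2 * e + 1 / 4 * d - 1 / p *
            ((∫ x in closedBall (0 : R3) R, |g' ‖x‖| ^ p) + τ R))) :=
        ((he.const_mul _).add (hd.const_mul _)).sub
          (((tendsto_setIntegral_rpow (by linarith) (by linarith) (fun n => (hb n).profile) hl R).add_const
            _).const_mul _)
      have h2 := le_of_tendsto_of_tendsto' h1 (hc.comp hs.tendsto_atTop) fun n => by
        refine le_trans ?_ (hJ (s n))
        have := setIntegral_tail_le (v (s n)) (hM (s n)) hp (by linarith) hR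
        have e1 : J p (v (s n)) = 1 / 2 * gradEnergy (v (s n)).1.1 + 1 / 4 * coulomb (v (s n)) -
          1 / p * ∫ x, |(v (s n)).1.1 x| ^ p := rfl
        rw [e1]
        gcongr
      have h3 : ∫ x in closedBall (0 : R3) R, |g' ‖x‖| ^ p ≤ ∫ x, |w.1.1 x| ^ p := by
        have e2 : ∫ x in closedBall (0 : R3) R, |g' ‖x‖| ^ p =
            ∫ x in closedBall (0 : R3) R, |w.1.1 x| ^ p := by
          refine integral_congr_ae (ae_restrict_of_ae ?_)
          filter_upwards [hw] with x hx
          rw [hx]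
        rw [e2]
        exact setIntegral_le_integral (integrable_rpow w hp (by linarith))
          (ae_of_all _ fun x => by positivity)
      have e1 : J p w = 1 / 2 * gradEnergy w.1.1 + 1 / 4 * coulomb w -
          1 / p * ∫ x, |w.1.1 x| ^ p := rfl
      rw [e1]
      have h4 := mul_le_mul_of_nonneg_left h3 hp0.le
      linarith
    have h5 : Tendsto (fun R => J p w - 1 / p * τ R) atTop (𝓝 (J p w - 1 / p * 0)) :=
      tendsto_const_nhds.sub (hτ0.const_mul _)
    rw [mul_zero, sub_zero] at h5
    exact le_of_tendsto h5 (by filter_upwards [eventually_ge_atTop 1] with R hR using key R hR)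
  -- The integrals over balls are the functionals by which the limit is later identified in the weak
  -- topology.
  · have h1 := tendsto_integral_profile (fun n => (hb n).profile) hl
      (Φ := (closedBall (0 : R3) R).indicator fun _ => (1 : ℝ)) (B := 1) (R := R)
      ((measurable_const.indicator measurableSet_closedBall).aestronglyMeasurable)
      (fun x => by
        rw [indicator]; split_ifs <;> simp)
      (fun x hx => indicator_of_notMem (by simpa using hx) _)
    have e1 : ∀ {f : R3 → ℝ} {h : ℝ → ℝ}, f =ᵐ[volume] (fun x => h ‖x‖) →
        ∫ x : R3, h ‖x‖ • (closedBall (0 : R3) R).indicator (fun _ => (1 : ℝ)) x =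
          ∫ x in closedBall (0 : R3) R, f x := by
      intro f h hfh
      rw [← integral_indicator measurableSet_closedBall]
      refine integral_congr_ae ?_
      filter_upwards [hfh] with x hx
      by_cases hxR : x ∈ closedBall (0 : R3) R
      · simp [indicator_of_mem hxR, hx]
      · simp [indicator_of_notMem hxR]
    rw [e1 hw] at h1
    exact h1.congr fun n => e1 (hb n).ae_eq

/-! ### Weak lower semicontinuity -/

lemma integrableOn_closedBall (v : E) (R : ℝ) : IntegrableOn v.1 (closedBall (0 : R3) R) :=
  (v.2.1.1.locallyIntegrable (by norm_num)).integrableOn_isCompact (isCompact_closedBall _ _)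

/-- The functional `v ↦ ∫_{|x| ≤ R} v` on `E_r`. -/
def ballFunctional (R : ℝ) : Er →L[ℝ] ℝ :=
  LinearMap.mkContinuous
    { toFun := fun v => ∫ x in closedBall (0 : R3) R, v.1.1 x
      map_add' := fun v w => by
        rw [← integral_add (integrableOn_closedBall v.1 R) (integrableOn_closedBall w.1 R)]
        refine integral_congr_ae (ae_restrict_of_ae ?_)
        filter_upwards [AEEqFun.coeFn_add v.1.1 w.1.1] with x hx using hx
      map_smul' := fun c v => by
        rw [RingHom.id_apply, smul_eq_mul, ← integral_const_mul]
        refine integral_congr_ae (ae_restrict_of_ae ?_)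
        filter_upwards [AEEqFun.coeFn_smul c v.1.1] with x hx using hx }
    -- The constant comes from `|v(x)| ≤ √(∫ |∇v|² / ω) ‖x‖^(-1/2)` and `∫ |∇v|² ≤ ‖v‖²`.
    ((√sphereArea)⁻¹ * ∫ x in closedBall (0 : R3) R, ‖x‖ ^ (-(1 / 2 : ℝ))) (by
      intro v
      have hω := sphereArea_pos
      have hv := hasProfile v
      have h1 : ∀ᵐ x ∂(volume.restrict (closedBall (0 : R3) R)),
          ‖v.1.1 x‖ ≤ (√sphereArea)⁻¹ * ‖v‖ * ‖x‖ ^ (-(1 / 2 : ℝ)) := by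
        refine ae_restrict_of_ae ?_
        filter_upwards [hv.ae_eq, ae_ne_zero] with x hx hx0
        rw [hx, Real.norm_eq_abs]
        refine (hv.isProfile.abs_le (norm_pos_iff.2 hx0)).trans ?_
        gcongr
        change √(gradEnergy v.1.1 / sphereArea) ≤ _
        rw [Real.sqrt_div (gradEnergy_nonneg v.1.1), div_eq_inv_mul]
        gcongr
        exact Real.sqrt_le_iff.2 ⟨norm_nonneg v, gradEnergy_le_norm_sq v⟩
      refine (norm_integral_le_of_norm_le
        ((integrableOn_norm_rpow_closedBall (by norm_num) R).const_mul _) h1).trans (le_of_eq ?_)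
      rw [integral_const_mul]
      ring)

lemma ballFunctional_apply (R : ℝ) (v : Er) :
    ballFunctional R v = ∫ x in closedBall (0 : R3) R, v.1.1 x := rfl

/-- The continuous profile has integral zero over every annulus with rational radii, so it cannot
have a strict sign on a thin one. -/
lemma eq_zero_of_ballFunctional {z : Er} (h : ∀ q : ℚ, ballFunctional q z = 0) : z = 0 := by
  have hz := hasProfile z
  have hω := sphereArea_pos
  have hann : ∀ s r : ℚ, 0 < (s : ℝ) → s ≤ r → ∫ x in annulus s r, profile z ‖x‖ = 0 := by
    intro s r hs hsr
    have hsr' : (s : ℝ) ≤ r := by exact_mod_cast hsr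
    have e : annulus s r = closedBall (0 : R3) r \ closedBall 0 s := by
      ext x
      simp only [mem_annulus, Set.mem_sdiff, mem_closedBall_zero_iff, not_le]
      tauto
    have e1 : ∀ q : ℚ, ∫ x in closedBall (0 : R3) q, profile z ‖x‖ = 0 := by
      intro q
      rw [← h q, ballFunctional_apply]
      refine integral_congr_ae (ae_restrict_of_ae ?_)
      filter_upwards [hz.ae_eq] with x hx using hx.symm
    have hi : IntegrableOn (fun x : R3 => profile z ‖x‖) (closedBall 0 r) :=
      (integrableOn_closedBall z.1 r).congr_fun_ae (ae_restrict_of_ae hz.ae_eq)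
    rw [e, setIntegral_sdiff measurableSet_closedBall hi (closedBall_subset_closedBall hsr'), e1, e1,
      sub_zero]
  have hg : ∀ t, 0 < t → profile z t = 0 := by
    intro t ht
    by_contra hne
    -- Multiplying by `profile z t` treats both signs at once.
    have hc : ContinuousAt (fun r => profile z t * profile z r) t :=
      continuousAt_const.mul ((hz.isProfile.continuousOn).continuousAt (Ioi_mem_nhds ht))
    have hpos : profile z t ^ 2 / 2 < profile z t * profile z t := by
      have : 0 < profile z t ^ 2 := by positivity
      nlinarith
    obtain ⟨δ, hδ, hball⟩ := Metric.eventually_nhds_iff.1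
      ((hc.eventually_const_lt hpos).and (lt_mem_nhds ht))
    obtain ⟨s, hs1, hs2⟩ := exists_rat_btwn (show max (t - δ) 0 < t from max_lt (by linarith) ht)
    obtain ⟨r, hr1, hr2⟩ := exists_rat_btwn (show t < t + δ by linarith)
    have hs0 : 0 < (s : ℝ) := lt_of_le_of_lt (le_max_right _ _) hs1
    have hsδ : t - δ < s := lt_of_le_of_lt (le_max_left _ _) hs1
    have hsr : (s : ℝ) < r := hs2.trans hr1
    have h0 := hann s r hs0 (by exact_mod_cast hsr.le)
    have hi : IntegrableOn (fun x : R3 => profile z ‖x‖) (annulus s r) :=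
      ((integrableOn_closedBall z.1 r).congr_fun_ae (ae_restrict_of_ae hz.ae_eq)).mono_set
        fun x hx => mem_closedBall_zero_iff.2 (mem_annulus.1 hx).2
    have h1 : ∫ _ in annulus s r, profile z t ^ 2 / 2 ≤
        ∫ x in annulus s r, profile z t * profile z ‖x‖ := by
      refine setIntegral_mono_on (integrableOn_const (measure_annulus_ne_top _ _)) (hi.const_mul _)
        (measurableSet_annulus _ _) fun x hx => ?_
      refine (hball ?_).1.le
      have := mem_annulus.1 hx
      rw [Real.dist_eq, abs_lt]
      constructor <;> linarith
    rw [integral_const_mul, h0, mul_zero, setIntegral_const, smul_eq_mul,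
      measureReal_annulus hs0.le hsr.le] at h1
    have h2 : (s : ℝ) ^ 3 < r ^ 3 := by gcongr
    have h3 : 0 < sphereArea / 3 * ((r : ℝ) ^ 3 - s ^ 3) * (profile z t ^ 2 / 2) := by
      have : 0 < (r : ℝ) ^ 3 - s ^ 3 := sub_pos.2 h2
      positivity
    linarith
  refine Subtype.ext (Subtype.ext (AEEqFun.ext ?_))
  refine EventuallyEq.trans ?_ AEEqFun.coeFn_zero.symm
  filter_upwards [hz.ae_eq, ae_ne_zero] with x hx hx0
  rw [hx, hg _ (norm_pos_iff.2 hx0), Pi.zero_apply]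

/-- Countably many functionals separate the points of `Er`, so a sequence suffices: one that
approximates `x` on the first `n + 1` of them has, by `exists_limit`, a limit with `J ≤ c`, and this
limit must be `x`. -/
lemma J_le_of_approx {p : ℝ} (hp : 18 / 7 < p) (hp3 : p < 3) {q : ℕ → ℚ}
    (hq : Function.Surjective q) {x : Er} {c : ℝ}
    (h : ∀ n : ℕ, ∃ v : Er, J p v ≤ c ∧ ∀ k ≤ n,
      |ballFunctional (q k) v - ballFunctional (q k) x| < 1 / (n + 1 : ℝ)) : J p x ≤ c := by
  choose v hvJ hv using h
  obtain ⟨w, hwJ, s, hs, hlim⟩ := exists_limit hp hp3 hvJ tendsto_const_nhds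
  have hw : w - x = 0 := by
    refine eq_zero_of_ballFunctional fun r => ?_
    obtain ⟨k, rfl⟩ := hq r
    have h1 : Tendsto (fun n => ballFunctional (q k) (v (s n))) atTop
      (𝓝 (ballFunctional (q k) w)) := hlim (q k)
    rw [ContinuousLinearMap.map_sub, sub_eq_zero]
    refine tendsto_nhds_unique h1 ?_
    rw [tendsto_iff_dist_tendsto_zero]
    refine squeeze_zero' (Eventually.of_forall fun _ => dist_nonneg) ?_
      (tendsto_one_div_add_atTop_nhds_zero_nat.comp hs.tendsto_atTop)
    filter_upwards [eventually_ge_atTop k] with n hn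
    exact (hv (s n) k (hn.trans (hs.id_le n))).le
  rw [← sub_eq_zero.1 hw]
  exact hwJ

/-- Sublevel sets are weakly closed: a weak neighbourhood of a point of the closure may prescribe
finitely many ball functionals to any accuracy, which is the hypothesis of `J_le_of_approx`. -/
theorem lowerSemicontinuous_J {p : ℝ} (hp : 18 / 7 < p) (hp3 : p < 3) :
    LowerSemicontinuous (fun v : WeakSpace ℝ Er => J p ((toWeakSpace ℝ Er).symm v)) := by
  rw [lowerSemicontinuous_iff_isClosed_preimage]
  intro c
  refine isClosed_of_closure_subset fun x hx => ?_
  obtain ⟨q, hq⟩ := exists_surjective_nat ℚ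
  have hcont : ∀ k, Continuous fun v : WeakSpace ℝ Er =>
      ballFunctional (q k) ((toWeakSpace ℝ Er).symm v) := fun k =>
    WeakBilin.eval_continuous (topDualPairing ℝ Er).flip (ballFunctional (q k))
  refine J_le_of_approx hp hp3 hq fun n => ?_
  have hU : ∀ᶠ v in 𝓝 x, ∀ k ∈ Finset.range (n + 1),
      |ballFunctional (q k) ((toWeakSpace ℝ Er).symm v) -
        ballFunctional (q k) ((toWeakSpace ℝ Er).symm x)| < 1 / (n + 1 : ℝ) := by
    refine (eventually_all_finset _).2 fun k _ => ?_
    exact Metric.tendsto_nhds.1 ((hcont k).tendsto x) _ (by positivity)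
  obtain ⟨v, hv1, hv2⟩ := mem_closure_iff_nhds.1 hx _ hU
  exact ⟨(toWeakSpace ℝ Er).symm v, hv2, fun k hk => hv1 k (Finset.mem_range.2 (by omega))⟩

/-- `J` attains its infimum. -/
theorem exists_minimizer {p : ℝ} (hp : 18 / 7 < p) (hp3 : p < 3) :
    ∃ v : Er, ∀ w : Er, J p v ≤ J p w := by
  obtain ⟨C, hC⟩ := exists_le_J hp hp3
  have hbdd : BddBelow (range (J p)) := ⟨-C, by
    rintro _ ⟨v, rfl⟩
    have := hC v
    have := gradEnergy_nonneg v.1.1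
    have := coulomb_nonneg v
    linarith⟩
  obtain ⟨c, -, hc, hmem⟩ := exists_seq_tendsto_sInf (range_nonempty (J p)) hbdd
  choose v hv using hmem
  obtain ⟨w, hw, -⟩ := exists_limit hp hp3 (fun n => (hv n).le) hc
  exact ⟨w, fun z => hw.trans (csInf_le hbdd ⟨z, rfl⟩)⟩

/-! ### Bounded functions of compact support, and scaling -/

lemma lintegral_rpow_norm_sub_le {x : R3} {R R' s : ℝ} (hx : ‖x‖ ≤ R) :
    ∫⁻ y in closedBall (0 : R3) R', ENNReal.ofReal (‖x - y‖ ^ (-s)) ≤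
      ∫⁻ z in closedBall (0 : R3) (R + R'), ENNReal.ofReal (‖z‖ ^ (-s)) := by
  rw [← lintegral_indicator measurableSet_closedBall, ← lintegral_indicator measurableSet_closedBall,
    ← lintegral_sub_left_eq_self (fun z => (closedBall (0 : R3) (R + R')).indicator
      (fun z => ENNReal.ofReal (‖z‖ ^ (-s))) z) x]
  refine lintegral_mono fun y => ?_
  by_cases hy : y ∈ closedBall (0 : R3) R'
  · have h1 : x - y ∈ closedBall (0 : R3) (R + R') := by
      rw [mem_closedBall_zero_iff] at hy ⊢
      exact (norm_sub_le x y).trans (by linarith)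
    rw [indicator_of_mem hy, indicator_of_mem h1]
  · rw [indicator_of_notMem hy]
    exact zero_le

lemma lintegral_rpow_neg_lt_top {s : ℝ} (hs : s < 3) (R : ℝ) :
    ∫⁻ z in closedBall (0 : R3) R, ENNReal.ofReal (‖z‖ ^ (-s)) < ⊤ := by
  have := (integrableOn_norm_rpow_closedBall hs R).2
  rwa [hasFiniteIntegral_iff_ofReal (ae_of_all _ fun x => by positivity)] at this

/-- The kernel `1/|z|` is integrable on the ball of radius `2R`, which contains all differences of
points of the support. -/
lemma coulombEnergy_lt_top_of_bounded {f : R3 → ℝ} {C R : ℝ} (hC : ∀ x, |f x| ≤ C)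
    (h0 : ∀ x, R < ‖x‖ → f x = 0) : coulombEnergy f < ⊤ := by
  have hC0 : 0 ≤ C := (abs_nonneg _).trans (hC 0)
  have hsq : ∀ x, f x ^ 2 ≤ C ^ 2 := fun x => sq_le_sq' (abs_le.1 (hC x)).1 (abs_le.1 (hC x)).2
  set K := ∫⁻ z in closedBall (0 : R3) (R + R), ENNReal.ofReal (‖z‖ ^ (-1 : ℝ))
  have hK : K < ⊤ := lintegral_rpow_neg_lt_top (by norm_num) _
  have h1 : ∀ x, ∫⁻ y, ENNReal.ofReal (f x ^ 2 * f y ^ 2 / ‖x - y‖) ≤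
      (closedBall (0 : R3) R).indicator (fun _ => ENNReal.ofReal (C ^ 4) * K) x := by
    intro x
    by_cases hx : ‖x‖ ≤ R
    · rw [indicator_of_mem (mem_closedBall_zero_iff.2 hx)]
      refine le_trans ?_ (mul_le_mul_right (lintegral_rpow_norm_sub_le (s := 1) (R' := R) hx) _)
      rw [← lintegral_const_mul' _ _ ENNReal.ofReal_ne_top,
        ← lintegral_indicator measurableSet_closedBall]
      refine lintegral_mono fun y => ?_
      by_cases hy : ‖y‖ ≤ R
      · rw [indicator_of_mem (mem_closedBall_zero_iff.2 hy), ← ENNReal.ofReal_mul (by positivity),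
          Real.rpow_neg_one, ← div_eq_mul_inv]
        refine ENNReal.ofReal_le_ofReal ?_
        gcongr
        calc f x ^ 2 * f y ^ 2 ≤ C ^ 2 * C ^ 2 :=
              mul_le_mul (hsq x) (hsq y) (by positivity) (by positivity)
          _ = C ^ 4 := by ring
      · rw [h0 y (not_le.1 hy)]; simp
    · rw [indicator_of_notMem (fun h => hx (mem_closedBall_zero_iff.1 h)), h0 x (not_le.1 hx)]
      simp
  refine (lintegral_mono h1).trans_lt ?_
  rw [lintegral_indicator measurableSet_closedBall, setLIntegral_const]
  exact ENNReal.mul_lt_top (ENNReal.mul_lt_top ENNReal.ofReal_lt_top hK) measure_closedBall_lt_top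

lemma lintegral_comp_smul {t : ℝ} (ht : 0 < t) (f : R3 → ℝ≥0∞) :
    ∫⁻ x, f (t • x) = ENNReal.ofReal (t ^ 3)⁻¹ * ∫⁻ x, f x := by
  have h := (Homeomorph.smulOfNeZero (α := R3) t ht.ne').measurableEmbedding.lintegral_map
    (μ := volume) f
  have e := Measure.map_addHaar_smul (volume : Measure R3) ht.ne'
  simp only [finrank_euclideanSpace, Fintype.card_fin] at e
  rw [abs_of_pos (by positivity)] at e
  have e2 : (⇑(Homeomorph.smulOfNeZero (α := R3) t ht.ne')) = (t • ·) := rfl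
  rw [e2, e, lintegral_smul_measure, smul_eq_mul] at h
  exact h.symm

/-- The amplitude `t²` makes both the Dirichlet and the Coulomb energy scale by `t³`. -/
def scaledBump (t : ℝ) (x : R3) : ℝ := t ^ 2 * bump (t • x)

lemma contDiff_scaledBump (t : ℝ) : ContDiff ℝ ∞ (scaledBump t) :=
  contDiff_const.mul (contDiff_bump.comp (contDiff_const_smul t))

lemma scaledBump_eq_zero {t : ℝ} (ht : 0 < t) {x : R3} (hx : 1 / t < ‖x‖) : scaledBump t x = 0 := by
  rw [scaledBump, bump_eq_zero, mul_zero]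
  rw [norm_smul, Real.norm_of_nonneg ht.le]
  rw [div_lt_iff₀ ht] at hx
  linarith

lemma hasCompactSupport_scaledBump {t : ℝ} (ht : 0 < t) : HasCompactSupport (scaledBump t) :=
  HasCompactSupport.intro (isCompact_closedBall (0 : R3) (1 / t)) fun x hx =>
    scaledBump_eq_zero ht (by simpa using hx)

lemma gradient_scaledBump (t : ℝ) (x : R3) :
    gradient (scaledBump t) x = t ^ 3 • gradient bump (t • x) := by
  refine ext_inner_right ℝ fun w => ?_
  rw [inner_gradient_left, inner_smul_left, inner_gradient_left]
  have h1 : HasFDerivAt bump (fderiv ℝ bump (t • x)) (t • x) :=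
    (contDiff_bump.differentiable (by simp) _).hasFDerivAt
  have h2 : HasFDerivAt (scaledBump t) _ x :=
    (h1.comp x ((hasFDerivAt_id x).const_smul t)).const_mul (t ^ 2)
  rw [h2.fderiv]
  simp
  ring

lemma coulombEnergy_scaledBump {t : ℝ} (ht : 0 < t) :
    coulombEnergy (scaledBump t) = ENNReal.ofReal (t ^ 3) * coulombEnergy bump := by
  have e1 : ∀ x, ∫⁻ y, ENNReal.ofReal (scaledBump t x ^ 2 * scaledBump t y ^ 2 / ‖x - y‖) =
      ENNReal.ofReal (t ^ 6) * (fun z => ∫⁻ y, ENNReal.ofReal (bump z ^ 2 * bump y ^ 2 / ‖z - y‖)) (t • x) := by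
    intro x
    have h := lintegral_comp_smul ht
      (fun y => ENNReal.ofReal (bump (t • x) ^ 2 * bump y ^ 2 / ‖t • x - y‖))
    dsimp only
    have e0 : ENNReal.ofReal (t ^ 6) = ENNReal.ofReal (t ^ 9) * ENNReal.ofReal (t ^ 3)⁻¹ := by
      rw [← ENNReal.ofReal_mul (by positivity)]
      congr 1
      field_simp
    rw [e0, mul_assoc, ← h, ← lintegral_const_mul' _ _ ENNReal.ofReal_ne_top]
    refine lintegral_congr fun y => ?_
    rw [← ENNReal.ofReal_mul (by positivity), ← smul_sub, norm_smul, Real.norm_of_nonneg ht.le]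
    congr 1
    rcases eq_or_ne ‖x - y‖ 0 with h0 | h0
    · simp [h0]
    · simp only [scaledBump]
      field_simp
  unfold coulombEnergy
  simp only [e1]
  rw [lintegral_const_mul' _ _ ENNReal.ofReal_ne_top, lintegral_comp_smul ht
    (fun z => ∫⁻ y, ENNReal.ofReal (bump z ^ 2 * bump y ^ 2 / ‖z - y‖)), ← mul_assoc,
    ← ENNReal.ofReal_mul (by positivity)]
  congr 2
  field_simp

/-- `J` takes negative values. -/
theorem exists_J_neg {p : ℝ} (hp : 18 / 7 < p) (hp3 : p < 3) : ∃ v : Er, J p v < 0 := by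
  set A := 1 / 2 * (∫ x, ‖gradient bump x‖ ^ 2) + 1 / 4 * (coulombEnergy bump).toReal
  set B := 1 / p * ∫ x, |bump x| ^ p
  have hp0 : 0 < p := by linarith
  have hB : 0 < B := by
    refine mul_pos (by positivity) ?_
    refine Continuous.integral_pos_of_hasCompactSupport_nonneg_nonzero (x := 0) ?_ ?_
      (fun x => by positivity) ?_
    · exact contDiff_bump.continuous.abs.rpow_const fun x => Or.inr hp0.le
    · exact hasCompactSupport_bump.comp_left (g := fun y : ℝ => |y| ^ p)
        (by simp [Real.zero_rpow hp0.ne'])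
    · simp [bump]
  -- On scaled bumps `J = t^(2p-3) (t^(6-2p) A - B)`, and `6 - 2p > 0` because `p < 3`.
  have hlim : Tendsto (fun t : ℝ => t ^ (6 - 2 * p) * A) (𝓝[>] 0) (𝓝 0) := by
    have h1 : ContinuousAt (fun t : ℝ => t ^ (6 - 2 * p)) 0 :=
      Real.continuousAt_rpow_const _ _ (Or.inr (by linarith))
    have h2 := (h1.tendsto.mul_const A).mono_left (nhdsWithin_le_nhds (s := Ioi (0 : ℝ)))
    rwa [Real.zero_rpow (by linarith), zero_mul] at h2
  obtain ⟨t, htAB, ht⟩ := ((hlim.eventually_lt_const hB).and self_mem_nhdsWithin).exists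
  have ht : 0 < t := ht
  have hs := contDiff_scaledBump t
  have hcs := hasCompactSupport_scaledBump ht
  have hG : MemLp (gradient (scaledBump t)) 2 :=
    (continuous_gradient hs).memLp_of_hasCompactSupport (hasCompactSupport_gradient hcs)
  have hw := isWeakGradient_gradient hs
  have hc : coulombEnergy (scaledBump t) < ⊤ := by
    refine coulombEnergy_lt_top_of_bounded (C := t ^ 2) (R := 1 / t) (fun x => ?_)
      fun x hx => scaledBump_eq_zero ht hx
    rw [scaledBump, abs_of_nonneg (mul_nonneg (by positivity) (bump_nonneg _))]
    exact mul_le_of_le_one_right (by positivity) (bump_le_one _)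
  obtain ⟨v, hv⟩ := exists_mem_Er (f := scaledBump t) (G := gradient (scaledBump t))
    (g := fun r => t ^ 2 * Real.smoothTransition (1 - (t * r) ^ 2)) (by
      have := Real.smoothTransition.continuous.measurable
      fun_prop) (Eventually.of_forall fun x => by
        simp [scaledBump, bump, norm_smul, abs_of_pos ht]) (hs.continuous.memLp_of_hasCompactSupport hcs) hG hw hc
  refine ⟨v, ?_⟩
  have e1 : gradEnergy v.1.1 = t ^ 3 * ∫ x, ‖gradient bump x‖ ^ 2 := by
    rw [gradEnergy_eq hG (hw.congr hv.symm)]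
    have := Measure.integral_comp_smul (volume : Measure R3) (fun x => ‖gradient bump x‖ ^ 2) t
    simp only [finrank_euclideanSpace, Fintype.card_fin, smul_eq_mul] at this
    rw [abs_of_pos (by positivity)] at this
    have e0 : ∀ x, ‖gradient (scaledBump t) x‖ ^ 2 = t ^ 6 * ‖gradient bump (t • x)‖ ^ 2 := by
      intro x
      rw [gradient_scaledBump, norm_smul, mul_pow, Real.norm_of_nonneg (by positivity)]
      ring
    simp only [e0]
    rw [integral_const_mul, this]
    field_simp
  have e2 : (coulombEnergy v.1.1).toReal = t ^ 3 * (coulombEnergy bump).toReal := by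
    rw [coulombEnergy_congr hv, coulombEnergy_scaledBump ht, ENNReal.toReal_mul,
      ENNReal.toReal_ofReal (by positivity)]
  have e3 : ∫ x, |v.1.1 x| ^ p = t ^ (2 * p - 3) * ∫ x, |bump x| ^ p := by
    have h1 : ∫ x, |v.1.1 x| ^ p = ∫ x, |scaledBump t x| ^ p := by
      refine integral_congr_ae ?_
      filter_upwards [hv] with x hx
      rw [hx]
    have := Measure.integral_comp_smul (volume : Measure R3) (fun x => |bump x| ^ p) t
    simp only [finrank_euclideanSpace, Fintype.card_fin, smul_eq_mul] at this
    rw [abs_of_pos (by positivity)] at this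
    have e0 : ∀ x, |scaledBump t x| ^ p = t ^ (2 * p) * |bump (t • x)| ^ p := by
      intro x
      rw [scaledBump, abs_mul, Real.mul_rpow (abs_nonneg _) (abs_nonneg _),
        abs_of_pos (by positivity), ← Real.rpow_natCast, ← Real.rpow_mul ht.le]
      norm_num
    rw [h1]
    simp only [e0]
    rw [integral_const_mul, this, Real.rpow_sub ht, ← mul_assoc, div_eq_mul_inv]
    norm_num
  have e4 : t ^ 3 = t ^ (2 * p - 3) * t ^ (6 - 2 * p) := by
    rw [← Real.rpow_add ht, ← Real.rpow_natCast]
    congr 1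
    push_cast; ring
  have e5 : J p v = t ^ (2 * p - 3) * (t ^ (6 - 2 * p) * A - B) := by
    rw [J, e1, e2, e3, e4]
    simp only [A, B]
    ring
  rw [e5]
  exact mul_neg_of_pos_of_neg (by positivity) (by linarith)

/-! ### The absolute value -/

lemma contDiff_sqrt_sq_add {U : R3 → ℝ} (hU : ContDiff ℝ ∞ U) {ε : ℝ} (hε : 0 < ε) :
    ContDiff ℝ ∞ (fun x => √(U x ^ 2 + ε)) :=
  ((hU.pow 2).add contDiff_const).sqrt fun x => by positivity

/-- The chain rule multiplies `∇U` by `U / √(U² + ε)`, which is at most one in absolute value. Thus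
`√(U² + ε)` is a smooth substitute for `|U|` with no more energy. -/
lemma norm_gradient_sqrt_le {U : R3 → ℝ} (hU : ContDiff ℝ ∞ U) {ε : ℝ} (hε : 0 < ε) (x : R3) :
    ‖gradient (fun x => √(U x ^ 2 + ε)) x‖ ≤ ‖gradient U x‖ := by
  have h1 : HasFDerivAt U (fderiv ℝ U x) x := (hU.differentiable (by simp) _).hasFDerivAt
  have hpos : 0 < U x ^ 2 + ε := by positivity
  have h2 : HasFDerivAt (fun x => √(U x ^ 2 + ε)) _ x := ((h1.pow 2).add_const ε).sqrt hpos.ne'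
  have e : gradient (fun x => √(U x ^ 2 + ε)) x = (U x / √(U x ^ 2 + ε)) • gradient U x := by
    refine ext_inner_right ℝ fun w => ?_
    rw [inner_gradient_left, inner_smul_left, inner_gradient_left, h2.fderiv]
    simp
    field_simp
  rw [e, norm_smul]
  refine mul_le_of_le_one_left (norm_nonneg _) ?_
  rw [norm_div, Real.norm_of_nonneg (Real.sqrt_nonneg _), Real.norm_eq_abs]
  refine div_le_one_of_le₀ ?_ (Real.sqrt_nonneg _)
  exact Real.abs_le_sqrt (by linarith)

/-- Passing to the absolute value does not increase the energy. -/
theorem exists_abs (v : Er) : ∃ w : Er, w.1.1 =ᵐ[volume] (fun x => |v.1.1 x|) ∧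
    gradEnergy w.1.1 ≤ gradEnergy v.1.1 := by
  have hv := hasProfile v
  have hu6 := v.1.2.1.1
  have hG := memLp_weakGrad v.1.2.1.2
  have hw := isWeakGradient_weakGrad v.1.2.1.2
  have hu : LocallyIntegrable v.1.1 := hu6.locallyIntegrable (by norm_num)
  have hs := fun n => contDiff_mollify n hu
  have hE := fun n => gradient_mollify_energy n hu hG hw
  have hε : ∀ n : ℕ, (0 : ℝ) < 1 / (n + 1 : ℝ) := fun n => by positivity
  have hM : ∀ n : ℕ, MemLp (gradient fun x => √(mollify n v.1.1 x ^ 2 + 1 / (n + 1 : ℝ))) 2 ∧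
      ∫ x, ‖gradient (fun x => √(mollify n v.1.1 x ^ 2 + 1 / (n + 1 : ℝ))) x‖ ^ 2 ≤
        gradEnergy v.1.1 := by
    intro n
    have hm := (continuous_gradient (contDiff_sqrt_sq_add (hs n) (hε n))).aestronglyMeasurable
      (μ := (volume : Measure R3))
    have hL := (hE n).1.of_le hm (ae_of_all _ (norm_gradient_sqrt_le (hs n) (hε n)))
    refine ⟨hL, le_trans (integral_mono (hL.integrable_norm_pow two_ne_zero)
      ((hE n).1.integrable_norm_pow two_ne_zero) fun x => ?_) (hE n).2⟩
    dsimp only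
    gcongr
    exact norm_gradient_sqrt_le (hs n) (hε n) x
  have hlim : ∀ᵐ x, Tendsto (fun n : ℕ => √(mollify n v.1.1 x ^ 2 + 1 / (n + 1 : ℝ))) atTop
      (𝓝 |v.1.1 x|) := by
    filter_upwards [ae_tendsto_mollify hu] with x hx
    have := ((hx.pow 2).add tendsto_one_div_add_atTop_nhds_zero_nat).sqrt
    rwa [add_zero, Real.sqrt_sq_eq_abs] at this
  obtain ⟨H, hH, hHA, hHw⟩ := exists_weakGradient_of_tendsto (v := fun x => |v.1.1 x|)
    (u := fun n x => √(mollify n v.1.1 x ^ 2 + 1 / (n + 1 : ℝ)))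
    (fun n => (hM n).1) (fun n => (hM n).2)
    (fun n => isWeakGradient_gradient (contDiff_sqrt_sq_add (hs n) (hε n))) (by
      intro φ hφ hc
      obtain ⟨B, R, hB, h0⟩ := exists_bound_of_hasCompactSupport (continuous_gradient hφ)
        (hasCompactSupport_gradient hc)
      obtain ⟨C, hC⟩ := hv.bound R
      refine tendsto_integral_smul_of_bound (C := C + 1)
        (continuous_gradient hφ).aestronglyMeasurable hB h0
        (fun n => (contDiff_sqrt_sq_add (hs n) (hε n)).continuous.aestronglyMeasurable)
        (fun n => ?_) hlim
      filter_upwards [ae_ne_zero] with x hx hxR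
      have h1 := hC n x hx hxR
      have h2 : 0 ≤ ‖x‖ ^ (-(1 / 2 : ℝ)) := by positivity
      rw [abs_of_nonneg (Real.sqrt_nonneg _)]
      have h3 : √(mollify n v.1.1 x ^ 2 + 1 / (n + 1 : ℝ)) ≤ |mollify n v.1.1 x| + 1 := by
        rw [Real.sqrt_le_left (by positivity)]
        have h4 : 1 / (n + 1 : ℝ) ≤ 1 := by
          rw [div_le_one (by positivity)]; linarith [(Nat.cast_nonneg n : (0 : ℝ) ≤ n)]
        nlinarith [sq_abs (mollify n v.1.1 x), abs_nonneg (mollify n v.1.1 x)]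
      nlinarith)
  have hcc : coulombEnergy (fun x => |v.1.1 x|) = coulombEnergy v.1.1 := by
    simp only [coulombEnergy, sq_abs]
  obtain ⟨w, hw'⟩ := exists_mem_Er (f := fun x => |v.1.1 x|) (g := fun r => |profile v r|)
    hv.isProfile.measurable.abs (by filter_upwards [hv.ae_eq] with x hx; rw [hx])
    hu6.abs hH hHw (by rw [hcc]; exact v.1.2.2)
  refine ⟨w, hw', ?_⟩
  rw [gradEnergy_eq hH (hHw.congr hw'.symm)]
  exact hHA

theorem exists_abs_J_le (p : ℝ) (v : Er) :
    ∃ w : Er, (∀ᵐ x, 0 ≤ w.1.1 x) ∧ J p w ≤ J p v := by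
  obtain ⟨w, hw, hE⟩ := exists_abs v
  refine ⟨w, by filter_upwards [hw] with x hx; rw [hx]; positivity, ?_⟩
  have e1 : coulombEnergy w.1.1 = coulombEnergy v.1.1 := by
    rw [coulombEnergy_congr hw]
    simp only [coulombEnergy, sq_abs]
  have e2 : ∫ x, |w.1.1 x| ^ p = ∫ x, |v.1.1 x| ^ p := by
    refine integral_congr_ae ?_
    filter_upwards [hw] with x hx
    rw [hx, abs_abs]
  rw [J, J, e1, e2]
  gcongr

/-! ### The Coulomb potential -/

/-- On the annulus `r < |y| ≤ 2r` with `r ≥ 2R` one has `|x - y| ≥ r/2`, so it contributes at most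
`(2/r) · 2√(rM) = 4√(M/r)`; along dyadic radii this is geometric with ratio `1/√2`. -/
lemma RadialBound.lintegral_potential_tail_le {u : R3 → ℝ} {g : ℝ → ℝ} {M : ℝ}
    (h : RadialBound u g M) {R : ℝ} (hR : 0 < R) {x : R3} (hx : ‖x‖ ≤ R) :
    ∫⁻ y in {y : R3 | 2 * R < ‖y‖}, ENNReal.ofReal (g ‖y‖ ^ 2 / ‖x - y‖) ≤
      ENNReal.ofReal (4 * √(M / (2 * R)) * (1 - (√2)⁻¹)⁻¹) := by
  have hM := h.pos
  have h2 : 1 < √2 := Real.lt_sqrt_of_sq_lt (by norm_num)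
  refine lintegral_geometric_annulus_le (by positivity) (by positivity) (by positivity)
    (inv_lt_one_of_one_lt₀ h2) fun k => ?_
  set r : ℝ := 2 ^ k * (2 * R) with hr
  have hr0 : 0 < r := by positivity
  have hrR : 2 * R ≤ r := by
    have : (1 : ℝ) ≤ 2 ^ k := one_le_pow₀ (by norm_num)
    nlinarith
  have h1 : ∫⁻ y in annulus r (2 * r), ENNReal.ofReal (g ‖y‖ ^ 2 / ‖x - y‖) ≤
      ENNReal.ofReal (2 / r) * ∫⁻ y in annulus r (2 * r), ENNReal.ofReal (g ‖y‖ ^ 2) := by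
    rw [← lintegral_const_mul' _ _ ENNReal.ofReal_ne_top]
    refine setLIntegral_mono' (measurableSet_annulus _ _) fun y hy => ?_
    rw [← ENNReal.ofReal_mul (by positivity)]
    refine ENNReal.ofReal_le_ofReal ?_
    have h3 : r / 2 ≤ ‖x - y‖ := by
      have := norm_sub_norm_le y x
      rw [norm_sub_rev] at this
      linarith [(mem_annulus.1 hy).1]
    calc g ‖y‖ ^ 2 / ‖x - y‖ ≤ g ‖y‖ ^ 2 / (r / 2) := by gcongr
      _ = 2 / r * g ‖y‖ ^ 2 := by field_simp
  refine (h1.trans (mul_le_mul_right (h.lintegral_annulus_le hr0) _)).trans ?_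
  rw [← ENNReal.ofReal_mul (by positivity)]
  refine ENNReal.ofReal_le_ofReal (le_of_eq ?_)
  have e1 : √(r * M) = r * √(M / (2 * R)) * (√2)⁻¹ ^ k := by
    rw [Real.sqrt_eq_iff_mul_self_eq (by positivity) (by positivity)]
    symm
    have e2 : √(M / (2 * R)) * √(M / (2 * R)) = M / (2 * R) := Real.mul_self_sqrt (by positivity)
    have e3 : (√2)⁻¹ ^ k * (√2)⁻¹ ^ k = (2 ^ k : ℝ)⁻¹ := by
      rw [← mul_pow, ← mul_inv, Real.mul_self_sqrt (by norm_num), inv_pow]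
    calc r * √(M / (2 * R)) * (√2)⁻¹ ^ k * (r * √(M / (2 * R)) * (√2)⁻¹ ^ k)
        = r ^ 2 * (√(M / (2 * R)) * √(M / (2 * R))) * ((√2)⁻¹ ^ k * (√2)⁻¹ ^ k) := by ring
      _ = r * M := by rw [e2, e3, hr]; field_simp
  rw [e1]
  field_simp
  ring

/-- The Coulomb potential is locally bounded. -/
lemma RadialBound.exists_potential_le {u : R3 → ℝ} {g : ℝ → ℝ} {M : ℝ}
    (h : RadialBound u g M) (R : ℝ) :
    ∃ C : ℝ, 0 ≤ C ∧ ∀ x : R3, ‖x‖ ≤ R →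
      ∫⁻ y, ENNReal.ofReal (u y ^ 2 / ‖x - y‖) ≤ ENNReal.ofReal C := by
  wlog hR : 0 < R generalizing R
  · obtain ⟨C, hC, hb⟩ := this 1 one_pos
    exact ⟨C, hC, fun x hx => hb x (by linarith)⟩
  set a := M / sphereArea
  have ha : 0 ≤ a := h.profile.nonneg
  set K1 := ∫⁻ z in closedBall (0 : R3) (2 * R), ENNReal.ofReal (‖z‖ ^ (-2 : ℝ))
  set K2 := ∫⁻ z in closedBall (0 : R3) (R + 2 * R), ENNReal.ofReal (‖z‖ ^ (-2 : ℝ))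
  have hK : ∀ R : ℝ, ∫⁻ z in closedBall (0 : R3) R, ENNReal.ofReal (‖z‖ ^ (-2 : ℝ)) ≠ ⊤ := by
    exact fun R => (lintegral_rpow_neg_lt_top (by norm_num) R).ne
  set B := ENNReal.ofReal a * (K1 + K2) + ENNReal.ofReal (4 * √(M / (2 * R)) * (1 - (√2)⁻¹)⁻¹)
  have hB : B ≠ ⊤ := by
    refine ENNReal.add_ne_top.2 ⟨ENNReal.mul_ne_top ENNReal.ofReal_ne_top
      (ENNReal.add_ne_top.2 ⟨hK _, hK _⟩), ENNReal.ofReal_ne_top⟩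
  refine ⟨B.toReal, ENNReal.toReal_nonneg, fun x hx => ?_⟩
  rw [ENNReal.ofReal_toReal hB]
  have e1 : ∫⁻ y, ENNReal.ofReal (u y ^ 2 / ‖x - y‖) =
      ∫⁻ y, ENNReal.ofReal (g ‖y‖ ^ 2 / ‖x - y‖) := by
    refine lintegral_congr_ae ?_
    filter_upwards [h.ae_eq] with y hy
    rw [hy]
  have hset : {y : R3 | 2 * R < ‖y‖} = (closedBall (0 : R3) (2 * R))ᶜ := by
    ext y; simp
  rw [e1, ← lintegral_add_compl _ (measurableSet_closedBall (x := (0 : R3)) (ε := 2 * R)), ← hset]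
  refine add_le_add ?_ (h.lintegral_potential_tail_le hR hx)
  refine le_trans ?_ (mul_le_mul_right
    (add_le_add_right (lintegral_rpow_norm_sub_le (s := 2) (R' := 2 * R) hx) K1) _)
  rw [← lintegral_add_left (by fun_prop), ← lintegral_const_mul' _ _ ENNReal.ofReal_ne_top]
  refine lintegral_mono_ae (ae_restrict_of_ae ?_)
  filter_upwards [ae_ne_zero] with y hy
  rw [← ENNReal.ofReal_add (by positivity) (by positivity), ← ENNReal.ofReal_mul ha]
  refine ENNReal.ofReal_le_ofReal ?_
  have hy0 : 0 < ‖y‖ := norm_pos_iff.2 hy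
  rw [Real.rpow_neg (norm_nonneg _), Real.rpow_neg (norm_nonneg _), Real.rpow_two, Real.rpow_two]
  -- Separating the two singularities by Young leaves inverse squares, each locally integrable with
  -- a bound uniform in `‖x‖ ≤ R`.
  calc g ‖y‖ ^ 2 / ‖x - y‖ ≤ a / ‖y‖ / ‖x - y‖ := by gcongr; exact h.profile.decay _ hy0
    _ = a * (‖y‖⁻¹ * ‖x - y‖⁻¹) := by rw [div_eq_mul_inv, div_eq_mul_inv, mul_assoc]
    _ ≤ a * ((‖y‖ ^ 2)⁻¹ + (‖x - y‖ ^ 2)⁻¹) := by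
        gcongr
        rw [← inv_pow, ← inv_pow]
        have h1 : 0 ≤ ‖y‖⁻¹ := by positivity
        have h2 : 0 ≤ ‖x - y‖⁻¹ := by positivity
        nlinarith [sq_nonneg (‖y‖⁻¹ - ‖x - y‖⁻¹)]

lemma aestronglyMeasurable_kernel {u : R3 → ℝ} (hu : AEStronglyMeasurable u) (x : R3) :
    AEStronglyMeasurable (fun y => u y ^ 2 / ‖x - y‖) :=
  (hu.pow 2).div₀ (by fun_prop : Measurable fun y => ‖x - y‖).aestronglyMeasurable

lemma RadialBound.integrable_potential {u : R3 → ℝ} {g : ℝ → ℝ} {M : ℝ}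
    (h : RadialBound u g M) (x : R3) : Integrable (fun y => u y ^ 2 / ‖x - y‖) := by
  obtain ⟨C, -, hC⟩ := h.exists_potential_le ‖x‖
  refine ⟨aestronglyMeasurable_kernel h.aemeasurable.aestronglyMeasurable x, ?_⟩
  rw [hasFiniteIntegral_iff_ofReal (ae_of_all _ fun x => by positivity)]
  exact (hC x le_rfl).trans_lt ENNReal.ofReal_lt_top

lemma coulombPotential_nonneg (u : R3 → ℝ) (x : R3) : 0 ≤ coulombPotential u x :=
  integral_nonneg fun y => by positivity

lemma RadialBound.exists_coulombPotential_le {u : R3 → ℝ} {g : ℝ → ℝ} {M : ℝ}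
    (h : RadialBound u g M) (R : ℝ) :
    ∃ C : ℝ, 0 ≤ C ∧ ∀ x : R3, ‖x‖ ≤ R → coulombPotential u x ≤ C := by
  obtain ⟨C, hC0, hC⟩ := h.exists_potential_le R
  refine ⟨C, hC0, fun x hx => ?_⟩
  rw [← ENNReal.ofReal_le_ofReal_iff hC0, coulombPotential,
    ofReal_integral_eq_lintegral_ofReal (h.integrable_potential x)
      (ae_of_all _ fun y => by positivity)]
  exact hC x hx

lemma aestronglyMeasurable_coulombPotential {u : R3 → ℝ} (hu : AEStronglyMeasurable u) :
    AEStronglyMeasurable (coulombPotential u) := by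
  have h1 : AEStronglyMeasurable (fun z : R3 × R3 => u z.2 ^ 2 / ‖z.1 - z.2‖)
      ((volume : Measure R3).prod volume) :=
    (hu.comp_snd.pow 2).div₀ (by fun_prop : Measurable fun z : R3 × R3 => ‖z.1 - z.2‖).aestronglyMeasurable
  exact h1.integral_prod_right'

lemma coulombPotential_radial {u : R3 → ℝ} {g : ℝ → ℝ} (hu : u =ᵐ[volume] fun x => g ‖x‖)
    {x y : R3} (h : ‖x‖ = ‖y‖) : coulombPotential u x = coulombPotential u y := by
  obtain ⟨k, rfl⟩ := exists_isometry_of_norm_eq h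
  have e : ∀ z, coulombPotential u z = ∫ w, g ‖w‖ ^ 2 / ‖z - w‖ := fun z => by
    refine integral_congr_ae ?_
    filter_upwards [hu] with w hw
    rw [hw]
  rw [e, e (k x), ← k.measurePreserving.integral_comp k.toHomeomorph.measurableEmbedding
    (fun w => g ‖w‖ ^ 2 / ‖k x - w‖)]
  refine integral_congr_ae (ae_of_all _ fun w => ?_)
  dsimp only
  rw [k.norm_map, ← map_sub, k.norm_map]

/-! ### The Euler–Lagrange equation for radial test functions -/

lemma aestronglyMeasurable_coulombKernel {f h : R3 → ℝ} (hf : AEStronglyMeasurable f)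
    (hh : AEStronglyMeasurable h) :
    AEStronglyMeasurable (fun z : R3 × R3 => f z.1 * h z.2 / ‖z.1 - z.2‖)
      ((volume : Measure R3).prod volume) :=
  (hf.comp_fst.mul hh.comp_snd).div₀
    (by fun_prop : Measurable fun z : R3 × R3 => ‖z.1 - z.2‖).aestronglyMeasurable

lemma integrable_coulombEnergy {u : R3 → ℝ} (hu : AEStronglyMeasurable u)
    (hc : coulombEnergy u < ⊤) :
    Integrable (fun z : R3 × R3 => u z.1 ^ 2 * u z.2 ^ 2 / ‖z.1 - z.2‖)
      ((volume : Measure R3).prod volume) := by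
  have hm : AEStronglyMeasurable (fun z : R3 × R3 => u z.1 ^ 2 * u z.2 ^ 2 / ‖z.1 - z.2‖)
      ((volume : Measure R3).prod volume) :=
    aestronglyMeasurable_coulombKernel (hu.pow 2) (hu.pow 2)
  refine ⟨hm, ?_⟩
  rw [hasFiniteIntegral_iff_ofReal (ae_of_all _ fun x => by positivity),
    lintegral_prod _ hm.aemeasurable.ennreal_ofReal]
  exact hc

lemma toReal_coulombEnergy {u : R3 → ℝ} (hu : AEStronglyMeasurable u) :
    (coulombEnergy u).toReal = ∫ z : R3 × R3, u z.1 ^ 2 * u z.2 ^ 2 / ‖z.1 - z.2‖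
      ∂((volume : Measure R3).prod volume) := by
  have hm : AEStronglyMeasurable (fun z : R3 × R3 => u z.1 ^ 2 * u z.2 ^ 2 / ‖z.1 - z.2‖)
      ((volume : Measure R3).prod volume) :=
    aestronglyMeasurable_coulombKernel (hu.pow 2) (hu.pow 2)
  rw [integral_eq_lintegral_of_nonneg_ae (ae_of_all _ fun x => by positivity) hm,
    lintegral_prod _ hm.aemeasurable.ennreal_ofReal]
  rfl

/-- The Coulomb integrand to first order in `t`. The cubic and quartic terms are put into the `t²`
remainder by `|t| ≤ 1`, and an upper bound is all that minimality requires. -/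
lemma sq_mul_sq_le {a b c d t : ℝ} (ht : |t| ≤ 1) :
    (a + t * b) ^ 2 * (c + t * d) ^ 2 ≤ a ^ 2 * c ^ 2 +
      2 * t * (a * b * c ^ 2 + a ^ 2 * (c * d)) +
        t ^ 2 * ((|a| + |b|) ^ 2 * (|c| + |d|) ^ 2) := by
  obtain ⟨h1, h2⟩ := abs_le.1 ht
  have ht2 : t ^ 2 ≤ 1 := by nlinarith
  have k : ∀ x y : ℝ, x ≤ |x| ∧ y * x ≤ |y| * |x| := fun x y =>
    ⟨le_abs_self x, (le_abs_self _).trans (abs_mul _ _).le⟩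
  have e : (a + t * b) ^ 2 * (c + t * d) ^ 2 = a ^ 2 * c ^ 2 +
      2 * t * (a * b * c ^ 2 + a ^ 2 * (c * d)) + t ^ 2 * (b ^ 2 * c ^ 2 + 4 * (a * b * c * d) +
        a ^ 2 * d ^ 2 + t * (2 * a * b * d ^ 2 + 2 * b ^ 2 * c * d) + t ^ 2 * (b ^ 2 * d ^ 2)) := by
    ring
  rw [e]
  have h3 : a * b * c * d ≤ |a| * |b| * |c| * |d| := by
    rw [← abs_mul, ← abs_mul, ← abs_mul]; exact le_abs_self _
  have h4 : t * (2 * a * b * d ^ 2 + 2 * b ^ 2 * c * d) ≤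
      2 * |a| * |b| * |d| ^ 2 + 2 * |b| ^ 2 * |c| * |d| := by
    calc t * (2 * a * b * d ^ 2 + 2 * b ^ 2 * c * d)
        ≤ |t| * |2 * a * b * d ^ 2 + 2 * b ^ 2 * c * d| := (k _ _).2
      _ ≤ 1 * (|2 * a * b * d ^ 2| + |2 * b ^ 2 * c * d|) := by
          gcongr
          exact abs_add_le _ _
      _ = _ := by simp only [abs_mul, abs_pow, abs_two]; ring
  have h5 : t ^ 2 * (b ^ 2 * d ^ 2) ≤ |b| ^ 2 * |d| ^ 2 := by
    rw [sq_abs, sq_abs]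
    exact mul_le_of_le_one_left (by positivity) ht2
  have h6 : b ^ 2 * c ^ 2 = |b| ^ 2 * |c| ^ 2 := by simp only [sq_abs]
  have h7 : a ^ 2 * d ^ 2 = |a| ^ 2 * |d| ^ 2 := by simp only [sq_abs]
  have h8 : 0 ≤ |a| ^ 2 * |c| ^ 2 + 2 * (|a| ^ 2 * |c| * |d|) + 2 * (|a| * |b| * |c| ^ 2) := by
    positivity
  gcongr
  nlinarith

/-- The two first-order terms agree after exchanging `x` and `y`, which gives the factor `4`. The
finite energy of `|u| + |ψ|` dominates the mixed terms and the remainder. -/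
lemma toReal_coulombEnergy_add_le {u ψ : R3 → ℝ} (hu : AEStronglyMeasurable u)
    (hψ : AEStronglyMeasurable ψ) (hcu : coulombEnergy u < ⊤)
    (hcw : coulombEnergy (fun x => |u x| + |ψ x|) < ⊤) {t : ℝ} (ht : |t| ≤ 1) :
    (coulombEnergy fun x => u x + t * ψ x).toReal ≤ (coulombEnergy u).toReal +
      4 * t * (∫ x, coulombPotential u x * u x * ψ x) +
        t ^ 2 * (coulombEnergy fun x => |u x| + |ψ x|).toReal := by
  have hw : AEStronglyMeasurable (fun x => |u x| + |ψ x|) := hu.norm.add hψ.norm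
  have iw := integrable_coulombEnergy hw hcw
  have iu := integrable_coulombEnergy hu hcu
  have key : ∀ a b : ℝ, |a * b| ≤ (|a| + |b|) ^ 2 ∧ a ^ 2 ≤ (|a| + |b|) ^ 2 := fun a b => by
    rw [abs_mul]
    constructor
    · nlinarith [abs_nonneg a, abs_nonneg b]
    · nlinarith [abs_nonneg a, abs_nonneg b, sq_abs a]
  have i1 : Integrable (fun z : R3 × R3 => (u z.1 * ψ z.1) * u z.2 ^ 2 / ‖z.1 - z.2‖)
      ((volume : Measure R3).prod volume) := by
    refine iw.mono' (aestronglyMeasurable_coulombKernel (hu.mul hψ) (hu.pow 2))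
      (ae_of_all _ fun z => ?_)
    rw [norm_div, norm_norm, norm_mul, Real.norm_eq_abs, Real.norm_eq_abs, abs_of_nonneg (sq_nonneg (u z.2))]
    exact div_le_div_of_nonneg_right (mul_le_mul (key _ _).1 (key _ _).2 (sq_nonneg _)
      (sq_nonneg _)) (norm_nonneg _)
  have i2 : Integrable (fun z : R3 × R3 => u z.1 ^ 2 * (u z.2 * ψ z.2) / ‖z.1 - z.2‖)
      ((volume : Measure R3).prod volume) := by
    refine i1.swap.congr (ae_of_all _ fun z => ?_)
    simp only [Function.comp, Prod.fst_swap, Prod.snd_swap, norm_sub_rev z.2]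
    ring
  have e1 : ∫ z : R3 × R3, (u z.1 * ψ z.1) * u z.2 ^ 2 / ‖z.1 - z.2‖
      ∂((volume : Measure R3).prod volume) = ∫ x, coulombPotential u x * u x * ψ x := by
    rw [integral_prod _ i1]
    refine integral_congr_ae (ae_of_all _ fun x => ?_)
    dsimp only
    rw [coulombPotential, mul_assoc, mul_comm (∫ y, u y ^ 2 / ‖x - y‖), ← integral_const_mul]
    exact integral_congr_ae (ae_of_all _ fun y => mul_div_assoc _ _ _)
  have e2 : ∫ z : R3 × R3, u z.1 ^ 2 * (u z.2 * ψ z.2) / ‖z.1 - z.2‖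
      ∂((volume : Measure R3).prod volume) = ∫ x, coulombPotential u x * u x * ψ x := by
    rw [← e1, ← integral_prod_swap]
    refine integral_congr_ae (ae_of_all _ fun z => ?_)
    simp only [Prod.fst_swap, Prod.snd_swap, norm_sub_rev z.2]
    ring
  rw [toReal_coulombEnergy (u := fun x => u x + t * ψ x) (hu.add (hψ.const_mul t)), toReal_coulombEnergy hu,
    toReal_coulombEnergy hw]
  have hI : ∫ z : R3 × R3, (u z.1 ^ 2 * u z.2 ^ 2 / ‖z.1 - z.2‖ +
      2 * t * ((u z.1 * ψ z.1) * u z.2 ^ 2 / ‖z.1 - z.2‖ +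
        u z.1 ^ 2 * (u z.2 * ψ z.2) / ‖z.1 - z.2‖)) +
      t ^ 2 * ((|u z.1| + |ψ z.1|) ^ 2 * (|u z.2| + |ψ z.2|) ^ 2 / ‖z.1 - z.2‖)
      ∂((volume : Measure R3).prod volume) = _ :=
    (integral_add (iu.add ((i1.add i2).const_mul _)) (iw.const_mul _)).trans (congrArg₂ (· + ·)
      ((integral_add iu ((i1.add i2).const_mul _)).trans (congrArg₂ (· + ·) rfl
        ((integral_const_mul _ _).trans (congrArg₂ (· * ·) rfl (integral_add i1 i2)))))
      (integral_const_mul _ _))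
  rw [e1, e2] at hI
  have hmono := integral_mono_of_nonneg (μ := (volume : Measure R3).prod volume)
    (f := fun z : R3 × R3 => (u z.1 + t * ψ z.1) ^ 2 * (u z.2 + t * ψ z.2) ^ 2 / ‖z.1 - z.2‖)
    (ae_of_all _ fun z => by positivity)
    ((iu.add ((i1.add i2).const_mul (2 * t))).add (iw.const_mul (t ^ 2)))
    (ae_of_all _ fun z => by
      have h := div_le_div_of_nonneg_right (sq_mul_sq_le (a := u z.1) (b := ψ z.1) (c := u z.2)
        (d := ψ z.2) ht) (norm_nonneg (z.1 - z.2))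
      refine h.trans (le_of_eq ?_)
      simp only [Pi.add_apply]
      ring)
  refine hmono.trans (hI.le.trans (le_of_eq ?_))
  ring

/-- The convex function `|·|^p` lies above its tangent. As this term enters `J` with a minus sign,
the inequality replaces differentiation under the integral. -/
lemma rpow_add_mul_le {p : ℝ} (hp : 1 < p) (a b : ℝ) :
    |a| ^ p + p * (|a| ^ (p - 2) * a * b) ≤ |a + b| ^ p := by
  have hd : ∀ x : ℝ, HasDerivAt (fun x : ℝ => |x| ^ p) (p * |x| ^ (p - 2) * x) x :=
    fun x => hasDerivAt_abs_rpow x hp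
  have hconv : ConvexOn ℝ univ (fun x : ℝ => |x| ^ p) := by
    refine ⟨convex_univ, fun x _ y _ s t hs ht hst => ?_⟩
    have h1 : |s • x + t • y| ≤ s • |x| + t • |y| := by
      simp only [smul_eq_mul]
      refine (abs_add_le _ _).trans (le_of_eq ?_)
      rw [abs_mul, abs_mul, abs_of_nonneg hs, abs_of_nonneg ht]
    exact (Real.rpow_le_rpow (abs_nonneg _) h1 (by linarith)).trans
      ((convexOn_rpow hp.le).2 (abs_nonneg x) (abs_nonneg y) hs ht hst)
  have hd0 : HasDerivAt (fun s : ℝ => |a + s * b| ^ p) (p * |a| ^ (p - 2) * a * b) 0 := by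
    have h1 : HasDerivAt (fun s : ℝ => a + s * b) b 0 := by
      simpa using ((hasDerivAt_id (0 : ℝ)).mul_const b).const_add a
    have h2 := (hd (a + 0 * b)).comp (0 : ℝ) h1
    rw [zero_mul, add_zero] at h2
    exact h2
  have hconv' : ConvexOn ℝ univ (fun s : ℝ => |a + s * b| ^ p) := by
    refine ⟨convex_univ, fun x _ y _ s t hs ht hst => ?_⟩
    have := hconv.2 (mem_univ (a + x * b)) (mem_univ (a + y * b)) hs ht hst
    refine le_trans (le_of_eq ?_) this
    dsimp only
    congr 2
    simp only [smul_eq_mul]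
    linear_combination (-a) * hst
  have := hconv'.le_slope_of_hasDerivAt (mem_univ 0) (mem_univ 1) one_pos hd0
  rw [slope_def_field] at this
  simp only [one_mul, zero_mul, add_zero, sub_zero, div_one] at this
  linarith

/-- Divide by `|t|` and let `t` tend to zero from either side. -/
lemma eq_zero_of_forall_le {T C : ℝ} (h : ∀ t : ℝ, |t| ≤ 1 → 0 ≤ t * T + t ^ 2 * C) : T = 0 := by
  have key : ∀ S : ℝ, (∀ t : ℝ, 0 < t → t ≤ 1 → 0 ≤ t * S + t ^ 2 * C) → 0 ≤ S := by
    intro S hS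
    refine ge_of_tendsto (f := fun t : ℝ => S + t * C) (x := 𝓝[>] 0) ?_ ?_
    · have : Tendsto (fun t : ℝ => S + t * C) (𝓝 0) (𝓝 (S + 0 * C)) :=
        (by fun_prop : Continuous fun t : ℝ => S + t * C).tendsto 0
      rw [zero_mul, add_zero] at this
      exact this.mono_left nhdsWithin_le_nhds
    · filter_upwards [Ioo_mem_nhdsGT one_pos] with t ht
      have h1 := hS t ht.1 ht.2.le
      have h2 : t * S + t ^ 2 * C = t * (S + t * C) := by ring
      rw [h2] at h1
      exact nonneg_of_mul_nonneg_right h1 ht.1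
  have h1 := key T fun t h0 h1 => h t (by rw [abs_of_pos h0]; exact h1)
  have h2 := key (-T) fun t h0 h1 => by
    have := h (-t) (by rw [abs_neg, abs_of_pos h0]; exact h1)
    linarith [this, neg_sq t, neg_mul t T, mul_neg t T]
  linarith

lemma rpow_sub_one_mul_le {p a b : ℝ} (hp : 1 < p) (ha : 0 ≤ a) (hb : 0 ≤ b) :
    a ^ (p - 1) * b ≤ a ^ p + b ^ p := by
  have key : ∀ c : ℝ, 0 ≤ c → c ^ (p - 1) * c = c ^ p := fun c hc => by
    rw [← Real.rpow_add_one' hc (by linarith), sub_add_cancel]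
  have h1 : 0 ≤ a ^ p := by positivity
  have h2 : 0 ≤ b ^ p := by positivity
  rcases le_total a b with h | h
  · have : a ^ (p - 1) * b ≤ b ^ (p - 1) * b := by gcongr
    linarith [key b hb]
  · have : a ^ (p - 1) * b ≤ a ^ (p - 1) * a := by gcongr
    linarith [key a ha]

lemma abs_rpow_sub_two_mul {p : ℝ} (hp : 1 < p) (a : ℝ) : |(|a| ^ (p - 2) * a)| = |a| ^ (p - 1) := by
  rw [abs_mul, abs_of_nonneg (by positivity), ← Real.rpow_add_one' (abs_nonneg _) (by linarith)]
  congr 1; ring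

lemma integrable_inner_of_memLp {F H : R3 → R3} (hF : MemLp F 2) (hH : MemLp H 2) :
    Integrable fun x => inner ℝ (F x) (H x) := by
  refine ((hF.integrable_norm_pow two_ne_zero).add (hH.integrable_norm_pow two_ne_zero)).mono'
    (hF.1.inner hH.1) (ae_of_all _ fun x => ?_)
  rw [Pi.add_apply]
  nlinarith [norm_inner_le_norm (𝕜 := ℝ) (F x) (H x), sq_nonneg (‖F x‖ - ‖H x‖),
    norm_nonneg (F x), norm_nonneg (H x)]

/-- The Euler–Lagrange equation of a minimizer, tested against smooth radial functions. -/
theorem euler_lagrange_radial {p : ℝ} (hp : 18 / 7 < p) (hp3 : p < 3) {v : Er}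
    (hmin : ∀ w : Er, J p v ≤ J p w) {ψ : R3 → ℝ} (hψ : ContDiff ℝ ∞ ψ)
    (hc : HasCompactSupport ψ) (hr : ∀ x y, ‖x‖ = ‖y‖ → ψ x = ψ y) :
    (∫ x, inner ℝ (weakGrad v.1.1 x) (gradient ψ x)) +
      (∫ x, coulombPotential v.1.1 x * v.1.1 x * ψ x) =
        ∫ x, |v.1.1 x| ^ (p - 2) * v.1.1 x * ψ x := by
  have hG : MemLp (gradient ψ) 2 :=
    (continuous_gradient hψ).memLp_of_hasCompactSupport (hasCompactSupport_gradient hc)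
  have hw := isWeakGradient_gradient hψ
  obtain ⟨B, R, hB, h0⟩ := exists_bound_of_hasCompactSupport hψ.continuous hc
  obtain ⟨Ψ, hΨ⟩ := exists_mem_Er (f := ψ) (G := gradient ψ) (g := fun r => ψ (r • unitVec))
    (hψ.continuous.comp (by fun_prop : Continuous fun r : ℝ => r • unitVec)).measurable
    (Eventually.of_forall fun x => hr _ _ (norm_smul_unitVec (norm_nonneg x)).symm)
    (hψ.continuous.memLp_of_hasCompactSupport hc) hG hw
    (coulombEnergy_lt_top_of_bounded hB h0)
  have hGv := memLp_weakGrad v.1.2.1.2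
  have hGΨ : weakGrad Ψ.1.1 =ᵐ[volume] gradient ψ :=
    IsWeakGradient.ae_eq (memLp_weakGrad Ψ.1.2.1.2) hG (isWeakGradient_weakGrad Ψ.1.2.1.2)
      (hw.congr hΨ.symm)
  have hvm : AEStronglyMeasurable v.1.1 := v.1.1.aestronglyMeasurable
  have hψm : AEStronglyMeasurable ψ := hψ.continuous.aestronglyMeasurable
  have hval : ∀ t : ℝ, (v + t • Ψ).1.1 =ᵐ[volume] fun x => v.1.1 x + t * ψ x := by
    intro t
    filter_upwards [AEEqFun.coeFn_add v.1.1 (t • Ψ.1.1), AEEqFun.coeFn_smul t Ψ.1.1, hΨ]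
      with x h1 h2 h3
    have : (v + t • Ψ).1.1 x = (v.1.1 + t • Ψ.1.1 : R3 →ₘ[volume] ℝ) x := rfl
    rw [this, h1, Pi.add_apply, h2, Pi.smul_apply, h3, smul_eq_mul]
  have hgrad : ∀ t : ℝ, weakGrad (v + t • Ψ).1.1 =ᵐ[volume]
      fun x => weakGrad v.1.1 x + t • gradient ψ x := by
    intro t
    filter_upwards [weakGrad_add v.1 (t • Ψ.1), weakGrad_smul t Ψ.1, hGΨ] with x h1 h2 h3
    have : weakGrad (v + t • Ψ).1.1 x = weakGrad (v.1 + t • Ψ.1 : E).1 x := rfl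
    rw [this, h1, Pi.add_apply, h2, Pi.smul_apply, h3]
  have iin : Integrable fun x => inner ℝ (weakGrad v.1.1 x) (gradient ψ x) :=
    integrable_inner_of_memLp hGv hG
  have eE : ∀ t : ℝ, gradEnergy (v + t • Ψ).1.1 = gradEnergy v.1.1 +
      2 * t * (∫ x, inner ℝ (weakGrad v.1.1 x) (gradient ψ x)) +
        t ^ 2 * ∫ x, ‖gradient ψ x‖ ^ 2 := by
    intro t
    have i1 := hGv.integrable_norm_pow two_ne_zero
    have i2 := hG.integrable_norm_pow two_ne_zero
    have hs : ∫ x, (‖weakGrad v.1.1 x‖ ^ 2 +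
        2 * t * inner ℝ (weakGrad v.1.1 x) (gradient ψ x)) + t ^ 2 * ‖gradient ψ x‖ ^ 2 = _ :=
      (integral_add (i1.add (iin.const_mul _)) (i2.const_mul _)).trans (congrArg₂ (· + ·)
        ((integral_add i1 (iin.const_mul _)).trans (congrArg₂ (· + ·) rfl (integral_const_mul _ _)))
        (integral_const_mul _ _))
    refine (integral_congr_ae ?_).trans hs
    filter_upwards [hgrad t] with x hx
    rw [hx, norm_add_sq_real, inner_smul_right, norm_smul, mul_pow, Real.norm_eq_abs, sq_abs]
    ring
  have hcw : coulombEnergy (fun x => |v.1.1 x| + |ψ x|) < ⊤ := by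
    have h1 := coulombEnergy_rpow_add_le (u := fun x => |v.1.1 x|) (v := fun x => |ψ x|)
      hvm.aemeasurable.norm hψm.aemeasurable.norm
    have e1 : coulombEnergy (fun x => |v.1.1 x|) < ⊤ := by
      simpa only [coulombEnergy, sq_abs] using v.1.2.2
    have e2 : coulombEnergy (fun x => |ψ x|) < ⊤ := by
      simpa only [coulombEnergy, sq_abs] using coulombEnergy_lt_top_of_bounded hB h0
    have := h1.trans_lt (ENNReal.add_lt_top.2
      ⟨ENNReal.rpow_lt_top_of_nonneg (by norm_num) e1.ne,
        ENNReal.rpow_lt_top_of_nonneg (by norm_num) e2.ne⟩)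
    exact (ENNReal.rpow_lt_top_iff_of_pos (by norm_num)).1 this
  have eC : ∀ t : ℝ, |t| ≤ 1 → (coulombEnergy (v + t • Ψ).1.1).toReal ≤ (coulombEnergy v.1.1).toReal +
      4 * t * (∫ x, coulombPotential v.1.1 x * v.1.1 x * ψ x) +
        t ^ 2 * (coulombEnergy fun x => |v.1.1 x| + |ψ x|).toReal := by
    intro t ht
    rw [coulombEnergy_congr (hval t)]
    exact toReal_coulombEnergy_add_le hvm hψm v.1.2.2 hcw ht
  have iv := integrable_rpow v hp (by linarith : p < 6)
  have iψ : Integrable fun x => |ψ x| ^ p := by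
    refine (integrable_rpow Ψ hp (by linarith : p < 6)).congr ?_
    filter_upwards [hΨ] with x hx
    rw [hx]
  have iP : Integrable fun x => |v.1.1 x| ^ (p - 2) * v.1.1 x * ψ x := by
    refine (iv.add iψ).mono' ?_ (ae_of_all _ fun x => ?_)
    · exact ((hvm.norm.aemeasurable.pow_const _).aestronglyMeasurable.mul hvm).mul hψm
    · rw [norm_mul, Real.norm_eq_abs, Real.norm_eq_abs, abs_rpow_sub_two_mul (by linarith)]
      exact rpow_sub_one_mul_le (by linarith) (abs_nonneg _) (abs_nonneg _)
  have eP : ∀ t : ℝ, (∫ x, |v.1.1 x| ^ p) + p * t * (∫ x, |v.1.1 x| ^ (p - 2) * v.1.1 x * ψ x) ≤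
      ∫ x, |(v + t • Ψ).1.1 x| ^ p := by
    intro t
    rw [← integral_const_mul, ← integral_add iv (iP.const_mul _)]
    refine integral_mono_ae (iv.add (iP.const_mul _))
      (integrable_rpow (v + t • Ψ) hp (by linarith : p < 6)) ?_
    filter_upwards [hval t] with x hx
    rw [hx]
    refine le_trans (le_of_eq ?_) (rpow_add_mul_le (by linarith) (v.1.1 x) (t * ψ x))
    ring
  have hp0 : 0 < p := by linarith
  -- The expansions of the three terms combine to `0 ≤ J(v + tΨ) - J(v) ≤ t T + t² C` for `|t| ≤ 1`.
  have hT := eq_zero_of_forall_le (T := (∫ x, inner ℝ (weakGrad v.1.1 x) (gradient ψ x)) +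
      (∫ x, coulombPotential v.1.1 x * v.1.1 x * ψ x) -
        ∫ x, |v.1.1 x| ^ (p - 2) * v.1.1 x * ψ x)
    (C := 1 / 2 * (∫ x, ‖gradient ψ x‖ ^ 2) +
      1 / 4 * (coulombEnergy fun x => |v.1.1 x| + |ψ x|).toReal) (fun t ht => by
      have h1 := hmin (v + t • Ψ)
      rw [J, J, eE t] at h1
      have h2 := eC t ht
      have h3 := mul_le_mul_of_nonneg_left (eP t) (one_div_pos.2 hp0).le
      have h4 : ∀ z : ℝ, 1 / p * (p * t * z) = t * z := fun z => by field_simp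
      rw [mul_add, h4] at h3
      linarith)
  linarith

/-! ### The Laplacian of smooth radial functions -/

/-- The `i`-th standard basis vector. -/
def basisVec (i : Fin 3) : R3 := EuclideanSpace.single i 1

lemma inner_basisVec (x : R3) (i : Fin 3) : inner ℝ x (basisVec i) = x i := by
  simp [basisVec, EuclideanSpace.inner_single_right]

/-- The Laplacian of a smooth function. -/
def laplacian (U : R3 → ℝ) (x : R3) : ℝ :=
  ∑ i, fderiv ℝ (fun y => fderiv ℝ U y (basisVec i)) x (basisVec i)

lemma contDiff_fderiv_apply {U : R3 → ℝ} (hU : ContDiff ℝ ∞ U) (w : R3) :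
    ContDiff ℝ ∞ fun y => fderiv ℝ U y w :=
  (hU.fderiv_right (by simp)).clm_apply contDiff_const

lemma contDiff_laplacian {U : R3 → ℝ} (hU : ContDiff ℝ ∞ U) : ContDiff ℝ ∞ (laplacian U) :=
  ContDiff.sum fun i _ => contDiff_fderiv_apply (contDiff_fderiv_apply hU (basisVec i)) (basisVec i)

lemma integral_laplacian_mul {U φ : R3 → ℝ} (hU : ContDiff ℝ ∞ U) (hφ : ContDiff ℝ ∞ φ)
    (hc : HasCompactSupport φ) :
    ∫ x, laplacian U x * φ x = -∫ x, inner ℝ (gradient U x) (gradient φ x) := by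
  have hUi := fun i => contDiff_fderiv_apply hU (basisVec i)
  have hφi := fun i => contDiff_fderiv_apply hφ (basisVec i)
  have hci : ∀ i, HasCompactSupport fun y => fderiv ℝ φ y (basisVec i) := fun i =>
    hc.fderiv_apply ℝ (basisVec i)
  have j1 : ∀ i, Integrable fun x =>
      fderiv ℝ (fun y => fderiv ℝ U y (basisVec i)) x (basisVec i) * φ x := fun i =>
    ((contDiff_fderiv_apply (hUi i) _).continuous.mul hφ.continuous).integrable_of_hasCompactSupport
      hc.mul_left
  have j2 : ∀ i, Integrable fun x => fderiv ℝ U x (basisVec i) * fderiv ℝ φ x (basisVec i) :=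
    fun i => ((hUi i).continuous.mul (hφi i).continuous).integrable_of_hasCompactSupport
      (hci i).mul_left
  have e : ∀ x, inner ℝ (gradient U x) (gradient φ x) =
      ∑ i, fderiv ℝ U x (basisVec i) * fderiv ℝ φ x (basisVec i) := by
    intro x
    simp only [← inner_gradient_left, inner_basisVec]
    rw [PiLp.inner_apply]
    simp [mul_comm]
  simp only [laplacian, Finset.sum_mul, e]
  rw [integral_finsetSum _ fun i _ => j1 i, integral_finsetSum _ fun i _ => j2 i,
    ← Finset.sum_neg_distrib]
  refine Finset.sum_congr rfl fun i _ => ?_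
  rw [integral_mul_fderiv_eq_neg_fderiv_mul_of_integrable (j1 i) (j2 i)
    (((hUi i).continuous.mul hφ.continuous).integrable_of_hasCompactSupport hc.mul_left)
    (fun x _ => (hUi i).differentiable (by simp) x) (fun x _ => hφ.differentiable (by simp) x),
    neg_neg]

lemma hasDerivAt_norm_add_smul {x : R3} (hx : x ≠ 0) (w : R3) :
    HasDerivAt (fun t : ℝ => ‖x + t • w‖) (inner ℝ x w / ‖x‖) 0 := by
  have h1 : HasDerivAt (fun t : ℝ => x + t • w) w 0 := by
    simpa using ((hasDerivAt_id (0 : ℝ)).smul_const w).const_add x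
  have h2 := h1.norm_sq.sqrt (by simpa using hx)
  simp only [Real.sqrt_sq (norm_nonneg _), zero_smul, add_zero] at h2
  rwa [mul_div_mul_left _ _ two_ne_zero] at h2

namespace IsRadialSmooth

variable {U : R3 → ℝ}

/-- The tangential part `w` of the gradient is orthogonal to `x`, so `‖x + tw‖ = ‖x - tw‖` and `t ↦
U(x + tw)` is even; its derivative at zero vanishes, and that derivative is `‖w‖²`. -/
lemma gradient_eq (h : IsRadialSmooth U) {x : R3} (hx : x ≠ 0) :
    gradient U x = (slope U ‖x‖ / ‖x‖) • x := by
  have hx0 : ‖x‖ ≠ 0 := norm_ne_zero_iff.2 hx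
  set w := gradient U x - (slope U ‖x‖ / ‖x‖) • x with hw
  have h1 : inner ℝ w x = 0 := by
    rw [hw, inner_sub_left, inner_smul_left, real_inner_self_eq_norm_sq, h.inner_gradient x]
    simp only [conj_trivial]
    field_simp
    ring
  have h2 : inner ℝ (gradient U x) w = 0 := by
    rw [inner_gradient_left]
    have hd : ∀ w, HasDerivAt (fun t : ℝ => U (x + t • w)) (fderiv ℝ U x w) 0 := by
      intro w
      have h3 : HasFDerivAt U (fderiv ℝ U x) (x + (0 : ℝ) • w) := by
        simpa using (h.smooth.differentiable (by simp) x).hasFDerivAt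
      have h4 : HasDerivAt (fun t : ℝ => x + t • w) w 0 := by
        simpa using ((hasDerivAt_id (0 : ℝ)).smul_const w).const_add x
      exact h3.comp_hasDerivAt 0 h4
    have e : (fun t : ℝ => U (x + t • w)) = fun t : ℝ => U (x + t • -w) := by
      ext t
      refine h.radial _ _ ?_
      rw [smul_neg, ← sub_eq_add_neg]
      refine (sq_eq_sq₀ (norm_nonneg _) (norm_nonneg _)).1 ?_
      rw [norm_add_sq_real, norm_sub_sq_real, inner_smul_right, real_inner_comm, h1]
      ring
    have h5 := hd w
    rw [e] at h5
    have h6 := h5.unique (hd (-w))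
    rw [map_neg] at h6
    linarith
  have h7 : inner ℝ w w = 0 := by
    nth_rewrite 1 [hw]
    rw [inner_sub_left, h2, inner_smul_left, real_inner_comm, h1]
    simp
  exact sub_eq_zero.1 (inner_self_eq_zero.1 h7)

lemma hasDerivAt_slope (h : IsRadialSmooth U) (t : ℝ) :
    HasDerivAt (slope U) (deriv (slope U) t) t := by
  have h1 : slope U = fun t : ℝ => fderiv ℝ U (t • unitVec) unitVec := by
    ext t
    rw [slope, inner_gradient_left]
  have h2 : Differentiable ℝ (slope U) := by
    rw [h1]
    exact ((contDiff_fderiv_apply h.smooth unitVec).differentiable (by simp)).comp (by fun_prop)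
  exact (h2 t).hasDerivAt

/-- Differentiate `∂ᵢU = (U'(|x|)/|x|) xᵢ` once more and sum. Hence the Laplacian is radial off the
origin and the equation becomes an ordinary differential one. -/
lemma laplacian_eq (h : IsRadialSmooth U) {x : R3} (hx : x ≠ 0) :
    laplacian U x = deriv (slope U) ‖x‖ + 2 * slope U ‖x‖ / ‖x‖ := by
  have hx0 : ‖x‖ ≠ 0 := norm_ne_zero_iff.2 hx
  set r := ‖x‖ with hr
  have key : ∀ i, fderiv ℝ (fun y => fderiv ℝ U y (basisVec i)) x (basisVec i) =
      (deriv (slope U) r / r ^ 2 - slope U r / r ^ 3) * x i ^ 2 + slope U r / r := by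
    intro i
    have h1 : HasDerivAt (fun t : ℝ => x + t • basisVec i) (basisVec i) 0 := by
      simpa using ((hasDerivAt_id (0 : ℝ)).smul_const (basisVec i)).const_add x
    have h2 : HasFDerivAt (fun y => fderiv ℝ U y (basisVec i))
        (fderiv ℝ (fun y => fderiv ℝ U y (basisVec i)) x) (x + (0 : ℝ) • basisVec i) := by
      simpa using ((contDiff_fderiv_apply h.smooth (basisVec i)).differentiable (by simp)
        x).hasFDerivAt
    have h3 := h2.comp_hasDerivAt (0 : ℝ) h1
    have hN := hasDerivAt_norm_add_smul hx (basisVec i)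
    rw [inner_basisVec] at hN
    have hs : HasDerivAt (fun t : ℝ => slope U ‖x + t • basisVec i‖)
        (deriv (slope U) r * (x i / r)) 0 := by
      have h5 : HasDerivAt (slope U) (deriv (slope U) r) ‖x + (0 : ℝ) • basisVec i‖ := by
        rw [zero_smul, add_zero]
        exact h.hasDerivAt_slope r
      exact h5.comp (0 : ℝ) hN
    have hxi : HasDerivAt (fun t : ℝ => x i + t) 1 0 := (hasDerivAt_id (0 : ℝ)).const_add _
    have h4 := (hs.div hN (by simpa using hx)).mul hxi
    have hev : ((fun y => fderiv ℝ U y (basisVec i)) ∘ fun t : ℝ => x + t • basisVec i) =ᶠ[𝓝 0]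
        ((fun t : ℝ => slope U ‖x + t • basisVec i‖) / fun t : ℝ => ‖x + t • basisVec i‖) *
          fun t : ℝ => x i + t := by
      have hne : ∀ᶠ t in 𝓝 (0 : ℝ), x + t • basisVec i ≠ 0 := by
        refine ContinuousAt.eventually_ne (by fun_prop) (by simpa using hx)
      filter_upwards [hne] with t ht
      simp only [Function.comp, Pi.mul_apply, Pi.div_apply]
      rw [← inner_gradient_left, h.gradient_eq ht, inner_smul_left, inner_basisVec]
      simp [basisVec]
    have h6 := h3.unique (h4.congr_of_eventuallyEq hev)
    rw [h6]
    simp only [zero_smul, add_zero, Pi.div_apply, ← hr]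
    field_simp
  have hsum : ∑ i, x i ^ 2 = r ^ 2 := by
    rw [hr, EuclideanSpace.norm_sq_eq]
    simp
  rw [laplacian, Finset.sum_congr rfl fun i _ => key i, Finset.sum_add_distrib, ← Finset.mul_sum,
    hsum]
  simp
  field_simp
  ring

end IsRadialSmooth

/-! ### From radial to arbitrary test functions -/

lemma real_inner_eq_mul (a b : ℝ) : inner ℝ a b = a * b := by simp [mul_comm]

section Mollify

variable {F : Type*} [NormedAddCommGroup F] [InnerProductSpace ℝ F]

lemma norm_mollify_le (n : ℕ) {Φ : R3 → F} {B : ℝ} (hB : ∀ x, ‖Φ x‖ ≤ B) (x : R3) :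
    ‖mollify n Φ x‖ ≤ B := by
  refine (norm_integral_le_of_norm_le (((integrable_mollifier n).comp_sub_left x).mul_const B)
    (ae_of_all _ fun y => ?_)).trans (le_of_eq ?_)
  · rw [norm_smul, Real.norm_of_nonneg (mollifier_nonneg _ _)]
    exact mul_le_mul_of_nonneg_left (hB y) (mollifier_nonneg _ _)
  · rw [integral_mul_const, integral_mollifier_sub, one_mul]

lemma one_div_nat_le_one (n : ℕ) : 1 / (n + 1 : ℝ) ≤ 1 := by
  rw [div_le_one (by positivity)]; linarith [(Nat.cast_nonneg n : (0 : ℝ) ≤ n)]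

lemma mollify_eq_zero (n : ℕ) {Φ : R3 → F} {R : ℝ} (h0 : ∀ x, R < ‖x‖ → Φ x = 0) {x : R3}
    (hx : R + 1 < ‖x‖) : mollify n Φ x = 0 := by
  refine integral_eq_zero_of_ae (ae_of_all _ fun y => ?_)
  by_cases hy : R < ‖y‖
  · simp [h0 y hy]
  · have h1 : 1 / (n + 1 : ℝ) ≤ ‖x - y‖ := by
      have := norm_sub_norm_le x y
      linarith [one_div_nat_le_one n, not_lt.1 hy]
    simp [mollifier_eq_zero n h1]

/-- Fubini, the kernel being even. -/
lemma integral_inner_mollify [CompleteSpace F] (n : ℕ) {H Φ : R3 → F} (hH : LocallyIntegrable H)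
    (hΦ : Continuous Φ) (hc : HasCompactSupport Φ) :
    ∫ x, inner ℝ (mollify n H x) (Φ x) = ∫ x, inner ℝ (H x) (mollify n Φ x) := by
  obtain ⟨B, R, hB, h0⟩ := exists_bound_of_hasCompactSupport hΦ hc
  obtain ⟨C, -, hC, -⟩ := exists_bound_of_hasCompactSupport (contDiff_mollifier n).continuous
    (hasCompactSupport_mollifier n)
  have hC0 : 0 ≤ C := (norm_nonneg _).trans (hC 0)
  have hi : Integrable (fun z : R3 × R3 => mollifier n (z.1 - z.2) * inner ℝ (H z.2) (Φ z.1))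
      ((volume : Measure R3).prod volume) := by
    have h1 : Integrable fun x => ‖Φ x‖ := (hΦ.integrable_of_hasCompactSupport hc).norm
    have h2 : Integrable fun y => C * (closedBall (0 : R3) (R + 1)).indicator (fun y => ‖H y‖) y :=
      ((integrable_indicator_iff measurableSet_closedBall).2
        (hH.integrableOn_isCompact (isCompact_closedBall _ _)).norm).const_mul C
    refine (h1.mul_prod h2).mono' ?_ (ae_of_all _ fun z => ?_)
    · refine AEStronglyMeasurable.mul ?_ (hH.aestronglyMeasurable.comp_snd.inner
        (hΦ.aestronglyMeasurable.comp_fst))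
      exact ((contDiff_mollifier n).continuous.comp (by fun_prop)).aestronglyMeasurable
    · by_cases hx : R < ‖z.1‖
      · simp [h0 _ hx]
      by_cases hy : z.2 ∈ closedBall (0 : R3) (R + 1)
      · rw [indicator_of_mem hy, norm_mul]
        calc ‖mollifier n (z.1 - z.2)‖ * ‖inner ℝ (H z.2) (Φ z.1)‖
            ≤ C * (‖H z.2‖ * ‖Φ z.1‖) :=
              mul_le_mul (hC _) (norm_inner_le_norm _ _) (norm_nonneg _) hC0
          _ = ‖Φ z.1‖ * (C * ‖H z.2‖) := by ring
      · have h3 : 1 / (n + 1 : ℝ) ≤ ‖z.1 - z.2‖ := by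
          rw [mem_closedBall_zero_iff] at hy
          have := norm_sub_norm_le z.2 z.1
          rw [norm_sub_rev] at this
          linarith [one_div_nat_le_one n, not_lt.1 hx]
        simp only [mollifier_eq_zero n h3, zero_mul, norm_zero]
        exact mul_nonneg (norm_nonneg _) (mul_nonneg hC0
          (indicator_nonneg (fun _ _ => norm_nonneg _) _))
  have e1 : ∀ x, inner ℝ (mollify n H x) (Φ x) =
      ∫ y, mollifier n (x - y) * inner ℝ (H y) (Φ x) := by
    intro x
    have hint : Integrable fun y => mollifier n (x - y) • H y :=
      hH.integrable_smul_left_of_hasCompactSupport (contDiff_mollifier_sub n x).continuous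
        (hasCompactSupport_mollifier_sub n x)
    rw [mollify, real_inner_comm, ← integral_inner hint]
    refine integral_congr_ae (ae_of_all _ fun y => ?_)
    dsimp only
    rw [inner_smul_right, real_inner_comm]
  have e2 : ∀ y, inner ℝ (H y) (mollify n Φ y) =
      ∫ x, mollifier n (x - y) * inner ℝ (H y) (Φ x) := by
    intro y
    have hint : Integrable fun x => mollifier n (y - x) • Φ x :=
      hΦ.locallyIntegrable.integrable_smul_left_of_hasCompactSupport
        (contDiff_mollifier_sub n y).continuous (hasCompactSupport_mollifier_sub n y)
    rw [mollify, ← integral_inner hint]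
    refine integral_congr_ae (ae_of_all _ fun x => ?_)
    dsimp only
    rw [inner_smul_right, mollifier_congr n (norm_sub_rev x y)]
  simp only [e1, e2]
  exact integral_integral_swap hi

end Mollify

/-- `u` is radial with weak gradient `G`, and `Δu = F` holds against smooth radial functions. -/
structure IsRadialSolution (u : R3 → ℝ) (G : R3 → R3) (F : R3 → ℝ) : Prop where
  locallyIntegrable : LocallyIntegrable u
  memLp : MemLp G 2
  weakGradient : IsWeakGradient u G
  radial : ∃ g : ℝ → ℝ, u =ᵐ[volume] fun x => g ‖x‖
  locallyIntegrable_source : LocallyIntegrable F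
  radial_source : ∃ f : ℝ → ℝ, F =ᵐ[volume] fun x => f ‖x‖
  eq_zero : ∀ ψ : R3 → ℝ, ContDiff ℝ ∞ ψ → HasCompactSupport ψ →
    (∀ x y, ‖x‖ = ‖y‖ → ψ x = ψ y) →
      (∫ x, inner ℝ (G x) (gradient ψ x)) + ∫ x, F x * ψ x = 0

namespace IsRadialSolution

variable {u F : R3 → ℝ} {G : R3 → R3}

lemma isRadialSmooth (h : IsRadialSolution u G F) (n : ℕ) : IsRadialSmooth (mollify n u) := by
  obtain ⟨g, hg⟩ := h.radial
  exact isRadialSmooth_mollify n h.locallyIntegrable h.memLp h.weakGradient hg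

/-- Mollification moves from `φ` to `u` and `F`, where the gradient term can be integrated by parts;
the result is the residual of the mollified equation, a smooth function. -/
lemma integral_mollify (h : IsRadialSolution u G F) (n : ℕ) {φ : R3 → ℝ} (hφ : ContDiff ℝ ∞ φ)
    (hc : HasCompactSupport φ) :
    (∫ x, inner ℝ (G x) (gradient (mollify n φ) x)) + ∫ x, F x * mollify n φ x =
      ∫ x, (mollify n F x - laplacian (mollify n u) x) * φ x := by
  have hs := contDiff_mollify n h.locallyIntegrable
  have hF := contDiff_mollify n h.locallyIntegrable_source
  have e1 : ∫ x, F x * mollify n φ x = ∫ x, mollify n F x * φ x := by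
    have := integral_inner_mollify n h.locallyIntegrable_source hφ.continuous hc
    simp only [real_inner_eq_mul] at this
    exact this.symm
  have e2 : ∫ x, inner ℝ (G x) (gradient (mollify n φ) x) =
      -∫ x, laplacian (mollify n u) x * φ x := by
    rw [integral_laplacian_mul hs hφ hc, neg_neg, gradient_mollify n h.locallyIntegrable
      h.weakGradient, gradient_mollify n hφ.continuous.locallyIntegrable
      (isWeakGradient_gradient hφ), integral_inner_mollify n (h.memLp.locallyIntegrable
      (by norm_num)) (continuous_gradient hφ) (hasCompactSupport_gradient hc)]
  rw [e1, e2]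
  simp only [sub_mul]
  have i1 : Integrable fun x => mollify n F x * φ x :=
    (hF.continuous.mul hφ.continuous).integrable_of_hasCompactSupport hc.mul_left
  have i2 : Integrable fun x => laplacian (mollify n u) x * φ x :=
    ((contDiff_laplacian hs).continuous.mul hφ.continuous).integrable_of_hasCompactSupport
      hc.mul_left
  rw [integral_sub i1 i2]
  ring

lemma hasCompactSupport_mollify (n : ℕ) {φ : R3 → ℝ} (hφ : Continuous φ)
    (hc : HasCompactSupport φ) : HasCompactSupport (mollify n φ) := by
  obtain ⟨B, R, hB, h0⟩ := exists_bound_of_hasCompactSupport hφ hc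
  exact HasCompactSupport.intro (isCompact_closedBall (0 : R3) (R + 1)) fun x hx =>
    mollify_eq_zero n h0 (by simpa using hx)

/-- The mollifications solve the equation pointwise. -/
lemma laplacian_mollify (h : IsRadialSolution u G F) (n : ℕ) {x : R3} (hx : x ≠ 0) :
    laplacian (mollify n u) x = mollify n F x := by
  set S : R3 → ℝ := fun x => mollify n F x - laplacian (mollify n u) x with hS
  have hsm : ContDiff ℝ ∞ S := (contDiff_mollify n h.locallyIntegrable_source).sub
    (contDiff_laplacian (contDiff_mollify n h.locallyIntegrable))
  obtain ⟨f, hf⟩ := h.radial_source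
  have hSr : ∀ x y, ‖x‖ = ‖y‖ → S x = S y := by
    intro x y hxy
    rcases eq_or_ne x 0 with rfl | hx
    · rw [norm_zero, eq_comm, norm_eq_zero] at hxy
      rw [hxy]
    · have hy : y ≠ 0 := by
        rw [← norm_ne_zero_iff, ← hxy]
        exact norm_ne_zero_iff.2 hx
      simp only [hS]
      rw [(h.isRadialSmooth n).laplacian_eq hx, (h.isRadialSmooth n).laplacian_eq hy, hxy,
        mollify_radial n hf hxy]
  have ht : 0 < 1 / (2 * ‖x‖) := by
    have := norm_pos_iff.2 hx
    positivity
  -- A radial cut-off supported in the ball of radius `2‖x‖`, hence positive at `x`.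
  set χ := scaledBump (1 / (2 * ‖x‖)) with hχ
  have hχs := contDiff_scaledBump (1 / (2 * ‖x‖))
  have hψ : ContDiff ℝ ∞ fun y => χ y * S y := hχs.mul hsm
  have hψc : HasCompactSupport fun y => χ y * S y := (hasCompactSupport_scaledBump ht).mul_right
  have hψr : ∀ x y, ‖x‖ = ‖y‖ → χ x * S x = χ y * S y := by
    intro a b hab
    rw [hSr a b hab, hχ]
    simp only [scaledBump, bump, norm_smul, hab]
  -- The mollification of `χ S` is an admissible radial test function, so `∫ χ S² = 0`.
  have h1 := h.integral_mollify n hψ hψc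
  rw [h.eq_zero _ (contDiff_mollify n hψ.continuous.locallyIntegrable)
    (hasCompactSupport_mollify n hψ.continuous hψc) fun a b hab =>
      mollify_radial n (g := fun r => χ (r • unitVec) * S (r • unitVec)) (ae_of_all _ fun y =>
        hψr _ _ (norm_smul_unitVec (norm_nonneg y)).symm) hab] at h1
  by_contra hne
  have hSx : S x ≠ 0 := fun h0 => hne (sub_eq_zero.1 h0).symm
  have hχ0 : ∀ y, 0 ≤ χ y := fun y => mul_nonneg (by positivity) (bump_nonneg _)
  have hχx : χ x ≠ 0 := by
    have hn := norm_pos_iff.2 hx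
    refine (mul_pos (by positivity) ?_).ne'
    refine Real.smoothTransition.pos_of_pos ?_
    rw [norm_smul, Real.norm_of_nonneg ht.le]
    have : 1 / (2 * ‖x‖) * ‖x‖ = 1 / 2 := by field_simp
    rw [this]; norm_num
  have h2 : 0 < ∫ y, S y * (χ y * S y) := by
    refine Continuous.integral_pos_of_hasCompactSupport_nonneg_nonzero (x := x)
      (hsm.continuous.mul hψ.continuous) hψc.mul_left (fun y => ?_)
      (mul_ne_zero hSx (mul_ne_zero hχx hSx))
    have : S y * (χ y * S y) = χ y * S y ^ 2 := by ring
    rw [this]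
    exact mul_nonneg (hχ0 y) (sq_nonneg _)
  exact h2.ne h1

lemma tendsto_integral_inner {F : Type*} [NormedAddCommGroup F] [InnerProductSpace ℝ F]
    [CompleteSpace F] {H Φ : R3 → F} (hH : LocallyIntegrable H) (hΦ : Continuous Φ)
    (hc : HasCompactSupport Φ) :
    Tendsto (fun n => ∫ x, inner ℝ (H x) (mollify n Φ x)) atTop (𝓝 (∫ x, inner ℝ (H x) (Φ x))) := by
  obtain ⟨B, R, hB, h0⟩ := exists_bound_of_hasCompactSupport hΦ hc
  have hB0 : 0 ≤ B := (norm_nonneg _).trans (hB 0)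
  have hmm : ∀ n, AEStronglyMeasurable (mollify n Φ) := by
    intro n
    have h1 : AEStronglyMeasurable (fun z : R3 × R3 => mollifier n (z.1 - z.2) • Φ z.2)
        ((volume : Measure R3).prod volume) :=
      (((contDiff_mollifier n).continuous.comp (continuous_fst.sub continuous_snd)).smul
        (hΦ.comp continuous_snd)).aestronglyMeasurable
    exact h1.integral_prod_right'
  refine tendsto_integral_of_dominated_convergence
    (fun x => (closedBall (0 : R3) (R + 1)).indicator (fun x => ‖H x‖ * B) x)
    (fun n => hH.aestronglyMeasurable.inner (hmm n))
    ((integrable_indicator_iff measurableSet_closedBall).2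
      ((hH.integrableOn_isCompact (isCompact_closedBall _ _)).norm.mul_const B)) (fun n => ae_of_all _ fun x => ?_) ?_
  · by_cases hx : x ∈ closedBall (0 : R3) (R + 1)
    · rw [indicator_of_mem hx]
      exact (norm_inner_le_norm _ _).trans
        (mul_le_mul_of_nonneg_left (norm_mollify_le n hB x) (norm_nonneg _))
    · rw [mollify_eq_zero n h0 (by simpa using hx), inner_zero_right, norm_zero]
      exact indicator_nonneg (fun _ _ => by positivity) _
  · filter_upwards [ae_tendsto_mollify hΦ.locallyIntegrable] with x hx
    exact tendsto_const_nhds.inner hx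

/-- The equation holds against all test functions. -/
theorem weak_eq (h : IsRadialSolution u G F) {φ : R3 → ℝ} (hφ : ContDiff ℝ ∞ φ)
    (hc : HasCompactSupport φ) :
    (∫ x, inner ℝ (G x) (gradient φ x)) + ∫ x, F x * φ x = 0 := by
  have h1 := tendsto_integral_inner (h.memLp.locallyIntegrable (by norm_num))
    (continuous_gradient hφ) (hasCompactSupport_gradient hc)
  have h2 := tendsto_integral_inner h.locallyIntegrable_source hφ.continuous hc
  have h3 := h1.add h2
  have e : ∀ n, (∫ x, inner ℝ (G x) (mollify n (gradient φ) x)) +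
      (∫ x, inner ℝ (F x) (mollify n φ x)) = 0 := by
    intro n
    have h4 := h.integral_mollify n hφ hc
    rw [gradient_mollify n hφ.continuous.locallyIntegrable (isWeakGradient_gradient hφ)] at h4
    simp only [real_inner_eq_mul]
    rw [h4]
    refine integral_eq_zero_of_ae ?_
    filter_upwards [ae_ne_zero] with x hx
    rw [h.laplacian_mollify n hx, sub_self, zero_mul, Pi.zero_apply]
  simp only [e] at h3
  have h5 := tendsto_nhds_unique h3 tendsto_const_nhds
  simp only [real_inner_eq_mul] at h5
  exact h5

end IsRadialSolution

/-! ### Positivity -/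

/-- A one-dimensional Harnack inequality for supersolutions of `w'' = k² w`. -/
lemma add_le_cosh_mul {w w₁ w₂ : ℝ → ℝ} {r h k : ℝ} (hh : 0 ≤ h)
    (h1 : ∀ t ∈ Icc (r - h) (r + h), HasDerivAt w (w₁ t) t)
    (h2 : ∀ t ∈ Icc (r - h) (r + h), HasDerivAt w₁ (w₂ t) t)
    (hle : ∀ t ∈ Icc (r - h) (r + h), w₂ t ≤ k ^ 2 * w t) :
    w (r + h) + w (r - h) ≤ 2 * Real.cosh (k * h) * w r := by
  have hp : ∀ t ∈ Icc 0 h, r + t ∈ Icc (r - h) (r + h) := fun t ht =>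
    ⟨by linarith [ht.1], by linarith [ht.2]⟩
  have hm : ∀ t ∈ Icc 0 h, r - t ∈ Icc (r - h) (r + h) := fun t ht =>
    ⟨by linarith [ht.2], by linarith [ht.1]⟩
  have dp : ∀ t : ℝ, HasDerivAt (fun t => r + t) 1 t := fun t => (hasDerivAt_id t).const_add r
  have dm : ∀ t : ℝ, HasDerivAt (fun t => r - t) (-1) t := fun t => (hasDerivAt_id t).const_sub r
  have dz : ∀ t ∈ Icc 0 h, HasDerivAt (fun t => w (r + t) + w (r - t))
      (w₁ (r + t) - w₁ (r - t)) t := fun t ht => by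
    have := ((h1 _ (hp t ht)).comp t (dp t)).add ((h1 _ (hm t ht)).comp t (dm t))
    refine this.congr_deriv ?_
    ring
  have dz1 : ∀ t ∈ Icc 0 h, HasDerivAt (fun t => w₁ (r + t) - w₁ (r - t))
      (w₂ (r + t) + w₂ (r - t)) t := fun t ht => by
    have := ((h2 _ (hp t ht)).comp t (dp t)).sub ((h2 _ (hm t ht)).comp t (dm t))
    refine this.congr_deriv ?_
    ring
  have dk : ∀ t : ℝ, HasDerivAt (fun t => k * t) k t := fun t => by
    simpa using (hasDerivAt_id t).const_mul k
  have dc : ∀ t : ℝ, HasDerivAt (fun t => Real.cosh (k * t)) (Real.sinh (k * t) * k) t := fun t =>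
    (dk t).cosh
  have ds : ∀ t : ℝ, HasDerivAt (fun t => Real.sinh (k * t)) (Real.cosh (k * t) * k) t := fun t =>
    (dk t).sinh
  -- With `z(t) = w(r + t) + w(r - t)`, this is the numerator of the derivative of `z / cosh(kt)`.
  -- It vanishes at zero and `A' = (z'' - k² z) cosh(kt) ≤ 0`, so the quotient decreases from `z(0)
  -- = 2 w(r)`.
  set A : ℝ → ℝ := fun t => (w₁ (r + t) - w₁ (r - t)) * Real.cosh (k * t) -
    (w (r + t) + w (r - t)) * (k * Real.sinh (k * t)) with hA
  have dA : ∀ t ∈ Icc 0 h, HasDerivAt A ((w₂ (r + t) + w₂ (r - t) -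
      k ^ 2 * (w (r + t) + w (r - t))) * Real.cosh (k * t)) t := fun t ht => by
    refine (((dz1 t ht).mul (dc t)).sub ((dz t ht).mul ((ds t).const_mul k))).congr_deriv ?_
    ring
  have hA0 : ∀ t ∈ Icc 0 h, A t ≤ 0 := by
    have hanti : AntitoneOn A (Icc 0 h) := by
      refine antitoneOn_of_hasDerivWithinAt_nonpos (convex_Icc 0 h)
        (fun t ht => (dA t ht).continuousAt.continuousWithinAt)
        (fun t ht => (dA t (interior_subset ht)).hasDerivWithinAt) fun t ht => ?_
      have ht := interior_subset ht
      refine mul_nonpos_of_nonpos_of_nonneg ?_ (Real.cosh_pos _).le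
      linarith [hle _ (hp t ht), hle _ (hm t ht)]
    intro t ht
    have := hanti (left_mem_Icc.2 hh) ht ht.1
    simpa [hA] using this
  have hanti : AntitoneOn (fun t => (w (r + t) + w (r - t)) / Real.cosh (k * t)) (Icc 0 h) := by
    have dQ := fun t (ht : t ∈ Icc 0 h) => (dz t ht).div (dc t) (Real.cosh_pos _).ne'
    refine antitoneOn_of_hasDerivWithinAt_nonpos (convex_Icc 0 h)
      (fun t ht => (dQ t ht).continuousAt.continuousWithinAt)
      (fun t ht => (dQ t (interior_subset ht)).hasDerivWithinAt) fun t ht => ?_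
    have := hA0 t (interior_subset ht)
    refine div_nonpos_of_nonpos_of_nonneg ?_ (sq_nonneg _)
    simp only [hA] at this
    linarith
  have h3 := hanti (left_mem_Icc.2 hh) (right_mem_Icc.2 hh) hh
  simp only [add_zero, sub_zero, mul_zero, Real.cosh_zero, div_one] at h3
  rw [div_le_iff₀ (Real.cosh_pos _)] at h3
  linarith

/-- The margin `1` in the radius covers the support of every mollifier. -/
lemma mollify_mono_of_ball (n : ℕ) {u F : R3 → ℝ} (hu : LocallyIntegrable u)
    (hF : LocallyIntegrable F) {R : ℝ} (h : ∀ᵐ y : R3, ‖y‖ ≤ R + 1 → F y ≤ u y) {x : R3}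
    (hx : ‖x‖ ≤ R) : mollify n F x ≤ mollify n u x := by
  refine integral_mono_ae
    (hF.integrable_smul_left_of_hasCompactSupport (contDiff_mollifier_sub n x).continuous
      (hasCompactSupport_mollifier_sub n x))
    (hu.integrable_smul_left_of_hasCompactSupport (contDiff_mollifier_sub n x).continuous
      (hasCompactSupport_mollifier_sub n x)) ?_
  filter_upwards [h] with y hy
  by_cases hyR : ‖y‖ ≤ R + 1
  · exact mul_le_mul_of_nonneg_left (hy hyR) (mollifier_nonneg _ _)
  · have h1 : 1 / (n + 1 : ℝ) ≤ ‖x - y‖ := by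
      have := norm_sub_norm_le y x
      rw [norm_sub_rev] at this
      linarith [one_div_nat_le_one n, not_le.1 hyR]
    simp [mollifier_eq_zero n h1]

/-- In dimension three `(t U(t))'' = t ΔU`, so `t U(t)` satisfies the one-dimensional inequality
`w'' ≤ k² w`. -/
lemma IsRadialSmooth.add_le {U : R3 → ℝ} (hU : IsRadialSmooth U) {k r h : ℝ} (hh : 0 ≤ h)
    (hr : h < r) (hle : ∀ x : R3, x ≠ 0 → ‖x‖ ≤ r + h → laplacian U x ≤ k ^ 2 * U x) :
    (r + h) * U ((r + h) • unitVec) + (r - h) * U ((r - h) • unitVec) ≤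
      2 * Real.cosh (k * h) * (r * U (r • unitVec)) := by
  refine add_le_cosh_mul (w := fun t => t * U (t • unitVec))
    (w₁ := fun t => U (t • unitVec) + t * slope U t)
    (w₂ := fun t => slope U t + (slope U t + t * deriv (slope U) t)) hh (fun t _ => ?_)
    (fun t _ => ?_) fun t ht => ?_
  · have := (hasDerivAt_id t).mul (hU.hasDerivAt norm_unitVec t)
    refine this.congr_deriv ?_
    simp [slope]
  · have := (hU.hasDerivAt norm_unitVec t).add ((hasDerivAt_id t).mul (hU.hasDerivAt_slope t))
    refine this.congr_deriv ?_
    simp [slope]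
  · have ht0 : 0 < t := by linarith [ht.1]
    have hn : ‖t • unitVec‖ = t := norm_smul_unitVec ht0.le
    have hx : t • unitVec ≠ 0 := by
      rw [← norm_ne_zero_iff, hn]; exact ht0.ne'
    have h1 := hle (t • unitVec) hx (hn.trans_le ht.2)
    rw [hU.laplacian_eq hx, hn] at h1
    have h2 := mul_le_mul_of_nonneg_left h1 ht0.le
    have e : t * (deriv (slope U) t + 2 * slope U t / t) =
        slope U t + (slope U t + t * deriv (slope U) t) := by
      field_simp
      ring
    rw [← e]
    linarith

/-- A nonnegative radial supersolution is positive or vanishes identically. -/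
theorem IsRadialSolution.pos_or_eq_zero {u F : R3 → ℝ} {G : R3 → R3} {g : ℝ → ℝ}
    (h : IsRadialSolution u G F) (hg : HasProfile u G g) (hu0 : ∀ᵐ x, 0 ≤ u x)
    (hF : ∀ R : ℝ, ∃ C : ℝ, 0 ≤ C ∧ ∀ᵐ x : R3, ‖x‖ ≤ R → F x ≤ C * u x) :
    (∀ r, 0 < r → 0 < g r) ∨ ∀ r, 0 < r → g r = 0 := by
  have hlim : ∀ r : ℝ, 0 < r → Tendsto (fun n => mollify n u (r • unitVec)) atTop (𝓝 (g r)) := by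
    intro r hr
    have hn : ‖r • unitVec‖ = r := norm_smul_unitVec hr.le
    have := hg.tendsto (r • unitVec) (by rw [← norm_ne_zero_iff, hn]; exact hr.ne')
    rwa [hn] at this
  have hg0 : ∀ r, 0 < r → 0 ≤ g r := by
    intro r hr
    refine ge_of_tendsto' (hlim r hr) fun n => integral_nonneg_of_ae ?_
    filter_upwards [hu0] with y hy
    exact mul_nonneg (mollifier_nonneg _ _) hy
  -- Apply the inequality at `r` with step `δ = |s - r| < r`: the right side tends to zero, and both
  -- nonnegative limits on the left vanish. One of them is a multiple of `g s`.
  have key : ∀ r, 0 < r → g r = 0 → ∀ s, 0 < s → s < 2 * r → g s = 0 := by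
    intro r hr hgr s hs hsr
    obtain ⟨C, hC0, hC⟩ := hF (2 * r + 1)
    set δ := |s - r| with hδ
    have hδr : δ < r := abs_lt.2 ⟨by linarith, by linarith⟩
    have hδ0 : 0 ≤ δ := abs_nonneg _
    have hn : ∀ n, (r + δ) * mollify n u ((r + δ) • unitVec) +
        (r - δ) * mollify n u ((r - δ) • unitVec) ≤
          2 * Real.cosh (√C * δ) * (r * mollify n u (r • unitVec)) := by
      intro n
      refine (h.isRadialSmooth n).add_le hδ0 hδr fun x hx hxr => ?_
      rw [h.laplacian_mollify n hx, Real.sq_sqrt hC0]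
      have e : C * mollify n u x = mollify n (fun y => C * u y) x := by
        rw [mollify, mollify, ← integral_const_mul]
        refine integral_congr_ae (ae_of_all _ fun y => ?_)
        simp only [smul_eq_mul]
        ring
      rw [e]
      exact mollify_mono_of_ball n (h.locallyIntegrable.smul C) h.locallyIntegrable_source hC
        (by linarith)
    have hL := le_of_tendsto_of_tendsto' (((hlim _ (by linarith : 0 < r + δ)).const_mul (r + δ)).add
      ((hlim _ (by linarith : 0 < r - δ)).const_mul (r - δ)))
      (((hlim r hr).const_mul r).const_mul (2 * Real.cosh (√C * δ))) hn
    rw [hgr, mul_zero, mul_zero] at hL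
    have p1 : 0 ≤ g (r + δ) := hg0 _ (by linarith)
    have p2 : 0 ≤ g (r - δ) := hg0 _ (by linarith)
    have q1 := mul_nonneg (by linarith : 0 ≤ r + δ) p1
    have q2 := mul_nonneg (by linarith : 0 ≤ r - δ) p2
    have z1 : g (r + δ) = 0 :=
      (mul_eq_zero.1 (by linarith : (r + δ) * g (r + δ) = 0)).resolve_left (by linarith)
    have z2 : g (r - δ) = 0 :=
      (mul_eq_zero.1 (by linarith : (r - δ) * g (r - δ) = 0)).resolve_left (by linarith)
    rcases abs_cases (s - r) with ⟨h1, -⟩ | ⟨h1, -⟩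
    · rwa [hδ, h1, add_sub_cancel] at z1
    · rwa [hδ, h1, sub_neg_eq_add, add_sub_cancel] at z2
  by_cases hz : ∃ r, 0 < r ∧ g r = 0
  · right
    obtain ⟨r, hr, hgr⟩ := hz
    -- Any ratio strictly between `1` and `2` would carry the zero outwards.
    have hall : ∀ n : ℕ, g ((3 / 2) ^ n * r) = 0 := by
      intro n
      induction n with
      | zero => simpa using hgr
      | succ n ih =>
        have hp : 0 < (3 / 2 : ℝ) ^ n * r := by positivity
        exact key _ hp ih _ (by positivity) (by rw [pow_succ]; linarith)
    intro s hs
    obtain ⟨n, hn⟩ := pow_unbounded_of_one_lt (s / r) (by norm_num : (1 : ℝ) < 3 / 2)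
    rw [div_lt_iff₀ hr] at hn
    exact key _ (by positivity) (hall n) s hs (by linarith)
  · left
    intro r hr
    exact lt_of_le_of_ne (hg0 r hr) fun h0 => hz ⟨r, hr, h0.symm⟩

/-! ### The positive solution -/

lemma locallyIntegrable_hartree (v : Er) :
    LocallyIntegrable fun x => coulombPotential v.1.1 x * v.1.1 x := by
  have hb := radialBound v le_rfl
  have hv : LocallyIntegrable v.1.1 := v.1.2.1.1.locallyIntegrable (by norm_num)
  refine locallyIntegrable_iff.2 fun K hK => ?_
  obtain ⟨R, hR⟩ := hK.isBounded.subset_closedBall (0 : R3)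
  obtain ⟨C, -, hC⟩ := hb.exists_coulombPotential_le R
  refine IntegrableOn.mono_set ?_ hR
  refine Integrable.bdd_mul (c := C) (hv.integrableOn_isCompact (isCompact_closedBall _ _))
    (aestronglyMeasurable_coulombPotential v.1.1.aestronglyMeasurable).restrict ?_
  filter_upwards [ae_restrict_mem measurableSet_closedBall] with x hx
  rw [Real.norm_of_nonneg (coulombPotential_nonneg _ _)]
  exact hC x (mem_closedBall_zero_iff.1 hx)

lemma locallyIntegrable_power (v : Er) {p : ℝ} (hp : 18 / 7 < p) (hp6 : p < 6) :
    LocallyIntegrable fun x => |v.1.1 x| ^ (p - 2) * v.1.1 x := by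
  have hvm : AEStronglyMeasurable v.1.1 := v.1.1.aestronglyMeasurable
  refine ((integrable_rpow v hp hp6).locallyIntegrable.add
    (locallyIntegrable_const (1 : ℝ))).mono
      ((hvm.norm.aemeasurable.pow_const _).aestronglyMeasurable.mul hvm) (ae_of_all _ fun x => ?_)
  rw [Real.norm_eq_abs, abs_rpow_sub_two_mul (by linarith)]
  refine le_trans ?_ (le_abs_self _)
  have := rpow_sub_one_mul_le (p := p) (by linarith) (abs_nonneg (v.1.1 x)) zero_le_one
  simpa using this

/-- The source term of the limit equation. -/
def source (p : ℝ) (v : R3 → ℝ) (x : R3) : ℝ :=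
  coulombPotential v x * v x - |v x| ^ (p - 2) * v x

lemma integral_source_mul (v : Er) {p : ℝ} (hp : 18 / 7 < p) (hp6 : p < 6) {φ : R3 → ℝ}
    (hφ : Continuous φ) (hc : HasCompactSupport φ) :
    ∫ x, source p v.1.1 x * φ x = (∫ x, coulombPotential v.1.1 x * v.1.1 x * φ x) -
      ∫ x, |v.1.1 x| ^ (p - 2) * v.1.1 x * φ x := by
  have i1 := (locallyIntegrable_hartree v).integrable_smul_right_of_hasCompactSupport hφ hc
  have i2 := (locallyIntegrable_power v hp hp6).integrable_smul_right_of_hasCompactSupport hφ hc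
  simp only [smul_eq_mul] at i1 i2
  rw [← integral_sub i1 i2]
  simp only [source, sub_mul]

lemma isRadialSolution {p : ℝ} (hp : 18 / 7 < p) (hp3 : p < 3) {v : Er}
    (hmin : ∀ w : Er, J p v ≤ J p w) :
    IsRadialSolution v.1.1 (weakGrad v.1.1) (source p v.1.1) where
  locallyIntegrable := v.1.2.1.1.locallyIntegrable (by norm_num)
  memLp := memLp_weakGrad v.1.2.1.2
  weakGradient := isWeakGradient_weakGrad v.1.2.1.2
  radial := ⟨_, (hasProfile v).ae_eq⟩
  locallyIntegrable_source :=
    (locallyIntegrable_hartree v).sub (locallyIntegrable_power v hp (by linarith))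
  radial_source := by
    refine ⟨fun r => coulombPotential v.1.1 (r • unitVec) * profile v r -
      |profile v r| ^ (p - 2) * profile v r, ?_⟩
    filter_upwards [(hasProfile v).ae_eq] with x hx
    rw [source, hx, coulombPotential_radial (hasProfile v).ae_eq
      (norm_smul_unitVec (norm_nonneg x)).symm]
  eq_zero ψ hψ hc hr := by
    rw [integral_source_mul v hp (by linarith) hψ.continuous hc]
    linarith [euler_lagrange_radial hp hp3 hmin hψ hc hr]

/-- For a nonnegative minimizer the power term only lowers the source, which is thus at most the
locally bounded Coulomb potential times `v`. This is what the positivity alternative needs, and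
`J(v) < 0` rules out `v = 0`. -/
theorem exists_pos_solution {p : ℝ} (hp : 18 / 7 < p) (hp3 : p < 3) :
    ∃ v : E, (∀ᵐ x : R3, 0 < v.1 x) ∧ IsWeakSolution p v := by
  obtain ⟨v₀, hv₀⟩ := exists_minimizer hp hp3
  obtain ⟨w, hw⟩ := exists_J_neg hp hp3
  obtain ⟨v, hv0, hle⟩ := exists_abs_J_le p v₀
  have hmin : ∀ w : Er, J p v ≤ J p w := fun w => hle.trans (hv₀ w)
  have hneg : J p v < 0 := (hmin w).trans_lt hw
  have hsol := isRadialSolution hp hp3 hmin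
  have hb := radialBound v le_rfl
  refine ⟨v.1, ?_, ae_of_all _ hb.integrable_potential, locallyIntegrable_hartree v,
    locallyIntegrable_power v hp (by linarith), fun φ hφ hc => ?_⟩
  · have hF : ∀ R : ℝ, ∃ C : ℝ, 0 ≤ C ∧
        ∀ᵐ x : R3, ‖x‖ ≤ R → source p v.1.1 x ≤ C * v.1.1 x := by
      intro R
      obtain ⟨C, hC0, hC⟩ := hb.exists_coulombPotential_le R
      refine ⟨C, hC0, ?_⟩
      filter_upwards [hv0] with x hx hxR
      have h1 : 0 ≤ |v.1.1 x| ^ (p - 2) * v.1.1 x := mul_nonneg (by positivity) hx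
      rw [source]
      linarith [mul_le_mul_of_nonneg_right (hC x hxR) hx]
    rcases hsol.pos_or_eq_zero (hasProfile v) hv0 hF with h | h
    · filter_upwards [(hasProfile v).ae_eq, ae_ne_zero] with x hx hx0
      rw [hx]
      exact h _ (norm_pos_iff.2 hx0)
    · exfalso
      have hz : ∫ x, |v.1.1 x| ^ p = 0 := by
        refine integral_eq_zero_of_ae ?_
        filter_upwards [(hasProfile v).ae_eq, ae_ne_zero] with x hx hx0
        rw [hx, h _ (norm_pos_iff.2 hx0), abs_zero, Real.zero_rpow (by linarith), Pi.zero_apply]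
      rw [J, hz] at hneg
      have h1 := gradEnergy_nonneg v.1.1
      have h2 : 0 ≤ (coulombEnergy v.1.1).toReal := ENNReal.toReal_nonneg
      linarith
  · have h1 := hsol.weak_eq hφ hc
    rw [integral_source_mul v hp (by linarith) hφ.continuous hc] at h1
    linarith

end CoulombSobolev

end

theorem theorem1p3 (p : ℝ) (hp : 18 / 7 < p) (hp3 : p < 3) :
    -- `J` is well defined on `E_r`
    (∀ v : CoulombSobolev.Er, Integrable (fun x : CoulombSobolev.R3 => |v.1.1 x| ^ p)) ∧
    -- `J` is coercive
    Tendsto (CoulombSobolev.J p) (Bornology.cobounded CoulombSobolev.Er) atTop ∧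
    -- `J` is lower semicontinuous for the weak topology of `E_r`
    LowerSemicontinuous (fun v : WeakSpace ℝ CoulombSobolev.Er =>
      CoulombSobolev.J p ((toWeakSpace ℝ CoulombSobolev.Er).symm v)) ∧
    -- `J` attains its infimum, which is negative
    (∃ v : CoulombSobolev.Er,
      (∀ w : CoulombSobolev.Er, CoulombSobolev.J p v ≤ CoulombSobolev.J p w) ∧
        CoulombSobolev.J p v < 0) ∧
    -- the limit equation has a positive solution in `E`
    (∃ v : CoulombSobolev.E, (∀ᵐ x : CoulombSobolev.R3, 0 < v.1 x) ∧
      CoulombSobolev.IsWeakSolution p v) := by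
  obtain ⟨v, hv⟩ := CoulombSobolev.exists_minimizer hp hp3
  obtain ⟨w, hw⟩ := CoulombSobolev.exists_J_neg hp hp3
  exact ⟨fun v => CoulombSobolev.integrable_rpow v hp (by linarith),
    CoulombSobolev.tendsto_J_cobounded hp hp3, CoulombSobolev.lowerSemicontinuous_J hp hp3,
    ⟨v, hv, (hv w).trans_lt hw⟩, CoulombSobolev.exists_pos_solution hp hp3⟩
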